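/- Let $M$ be a connected, closed (compact, without boundary), smooth Riemannian manifold, let $0<T\le\infty$, and let $H=H(x,p,u):T^*M\times\mathbb R\to\mathbb R$ satisfy: - (H1) $H$ is continuous on $T^*M\times\mathbb R$; - (H2) for every $R>0$ there is $K>0$ such that $H(x,p,u)>R$ whenever $|u|\le R$ and $|p|\ge K$; - (H3) $p\mapsto H(x,p,u)$ is convex on $T_x^*M$ for every $(x,u)\in M\times\mathbb R$; - (H4) the functions $u\mapsto H(x,p,u)$, $(x,p)\in T^*M$, are Lipschitz continuous on $\mathbb R$ with a common Lipschitz constant. For $\varphi:M\to\mathbb R\cup\{+\infty\}$, a *Barron–Jensen (BJ) solution with datum $\varphi$* is a lower semicontinuous function $u:M\times[0,T)\to\mathbb R\cup\{+\infty\}$ such that - whenever $\psi\in C^1(M\times(0,T),\mathbb R)$ and $u-\psi$ attains its minimum over $M\times(0,T)$ at a point $(x,t)$ with $u(x,t)<\infty$, one has $\psi_t(x,t)+H(x,D_x\psi(x,t),u(x,t))=0$; and - $\varphi(x)=u(x,0)=\liminf_{t\to0+}u(x,t)$ for all $x\in M$. For $y\in M$ and $c\in\mathbb R\cup\{+\infty\}$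 let $h(\cdot,\cdot,y,c)$ denote the BJ solution whose datum is $c$ at $y$ and $+\infty$ on $M\setminus\{y\}$; $h$ is called the fundamental solution. **Theorem.** Let $\varphi:M\to\mathbb R\cup\{+\infty\}$ be lower semicontinuous. Then there is a BJ solution with datum $\varphi$, and every BJ solution $u$ with datum $\varphi$ satisfies $$u(x,t)=\min_{y\in M}h(x,t,y,\varphi(y))\qquad\text{for all }(x,t)\in M\times[0,T),$$ where the minimum is attained. In particular the BJ solution with datum $\varphi$ is unique. -/

import Mathlib

open Set Filter Topology Manifold Bundle
open scoped ContDiff NNReal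

namespace HJ

section Hamiltonian

variable {n : ℕ} {M : Type*} [TopologicalSpace M] [ChartedSpace (EuclideanSpace ℝ (Fin n)) M]

/-- The cotangent space `T*_x M`, the dual of the tangent space `T_x M`. -/
abbrev Cotangent (n : ℕ) {M : Type*} [TopologicalSpace M]
    [ChartedSpace (EuclideanSpace ℝ (Fin n)) M] (x : M) : Type :=
  TangentSpace (𝓡 n) x →L[ℝ] ℝ

/-- The total space `T*M` of the cotangent bundle, with the topology of the vector bundle of
continuous linear maps from the tangent bundle to the trivial line bundle. -/
abbrev CotangentBundle (n : ℕ) (M : Type*) [TopologicalSpace M]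
    [ChartedSpace (EuclideanSpace ℝ (Fin n)) M] : Type _ :=
  TotalSpace (EuclideanSpace ℝ (Fin n) →L[ℝ] ℝ)
    (fun x : M => TangentSpace (𝓡 n) x →L[ℝ] Bundle.Trivial M ℝ x)

/-- The standing assumptions on a Hamiltonian `H = H(x, p, u)`. The norm on `T*_x M` is the dual of
the norm given by the Riemannian metric on `T_x M`. -/
structure IsHamiltonian [IsManifold (𝓡 n) ∞ M]
    [RiemannianBundle (fun x : M => TangentSpace (𝓡 n) x)]
    (H : (x : M) → Cotangent n x → ℝ → ℝ) : Prop where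
  /-- `H` is continuous on `T*M × ℝ`. -/
  continuous : Continuous (fun z : CotangentBundle n M × ℝ => H z.1.proj z.1.snd z.2)
  /-- `H` is coercive in `p`. -/
  coercive : ∀ R : ℝ, 0 < R → ∃ K : ℝ, 0 < K ∧
    ∀ (x : M) (p : Cotangent n x) (u : ℝ), |u| ≤ R → K ≤ ‖p‖ → R < H x p u
  /-- `H` is convex in `p`. -/
  convex : ∀ (x : M) (u : ℝ), ConvexOn ℝ univ (fun p : Cotangent n x => H x p u)
  /-- `H` is Lipschitz continuous in `u`, uniformly in `(x, p)`. -/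
  lipschitz : ∃ L : ℝ≥0, ∀ (x : M) (p : Cotangent n x), LipschitzWith L (H x p)

end Hamiltonian

/-- The set `M × (0, T)`, where `0 < T ≤ ∞`. -/
def openCylinder (M : Type*) (T : EReal) : Set (M × ℝ) :=
  {z | 0 < z.2 ∧ (z.2 : EReal) < T}

/-- The set `M × [0, T)`, where `0 < T ≤ ∞`. -/
def cylinder (M : Type*) (T : EReal) : Set (M × ℝ) :=
  {z | 0 ≤ z.2 ∧ (z.2 : EReal) < T}

section Solutions

variable {n : ℕ} {M : Type*} [TopologicalSpace M] [ChartedSpace (EuclideanSpace ℝ (Fin n)) M]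

/-- `ψ` is a `C¹` function on `M × (0, T)`. -/
def IsTest (n : ℕ) {M : Type*} [TopologicalSpace M]
    [ChartedSpace (EuclideanSpace ℝ (Fin n)) M] (T : EReal) (ψ : M → ℝ → ℝ) : Prop :=
  ContMDiffOn ((𝓡 n).prod 𝓘(ℝ, ℝ)) 𝓘(ℝ, ℝ) 1 (fun z : M × ℝ => ψ z.1 z.2) (openCylinder M T)

/-- The spatial differential `D_x ψ(x, t) ∈ T*_x M`. -/
noncomputable def spaceDiff (n : ℕ) {M : Type*} [TopologicalSpace M]
    [ChartedSpace (EuclideanSpace ℝ (Fin n)) M] (ψ : M → ℝ → ℝ) (x : M) (t : ℝ) :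
    Cotangent n x :=
  mfderiv (𝓡 n) 𝓘(ℝ, ℝ) (fun y => ψ y t) x

/-- The function `u - ψ` attains its minimum over `M × (0, T)` at `(x, t)`. -/
def MinAt {M : Type*} (T : EReal) (u : M → ℝ → EReal) (ψ : M → ℝ → ℝ) (x : M) (t : ℝ) : Prop :=
  IsMinOn (fun z : M × ℝ => u z.1 z.2 - (ψ z.1 z.2 : EReal)) (openCylinder M T) (x, t)

/-- The lower semicontinuous (Barron-Jensen) subsolution inequality for
`u_t + H(x, D_x u, u) = 0` in `M × (0, T)`: the equation is tested from below, at points where `u`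
is finite. -/
def IsSubsol (T : EReal) (H : (x : M) → Cotangent n x → ℝ → ℝ) (u : M → ℝ → EReal) : Prop :=
  ∀ ψ : M → ℝ → ℝ, IsTest n T ψ → ∀ (x : M) (t : ℝ), (x, t) ∈ openCylinder M T →
    MinAt T u ψ x t → ∀ r : ℝ, u x t = (r : EReal) →
      deriv (ψ x) t + H x (spaceDiff n ψ x t) r ≤ 0

/-- The supersolution inequality for `u_t + H(x, D_x u, u) = 0` in `M × (0, T)`. -/
def IsSupersol (T : EReal) (H : (x : M) → Cotangent n x → ℝ → ℝ) (u : M → ℝ → EReal) : Prop :=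
  ∀ ψ : M → ℝ → ℝ, IsTest n T ψ → ∀ (x : M) (t : ℝ), (x, t) ∈ openCylinder M T →
    MinAt T u ψ x t → ∀ r : ℝ, u x t = (r : EReal) →
      0 ≤ deriv (ψ x) t + H x (spaceDiff n ψ x t) r

/-- `u : M × [0, T) → ℝ ∪ {∞}` is a lower semicontinuous viscosity (Barron-Jensen) solution of the
Cauchy problem `u_t + H(x, D_x u, u) = 0` in `M × (0, T)`, `u(·, 0) = φ`. The values of `u` outside
`M × [0, T)` play no role. -/
structure IsBJSolution (T : EReal) (H : (x : M) → Cotangent n x → ℝ → ℝ) (φ : M → EReal)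
    (u : M → ℝ → EReal) : Prop where
  ne_bot : ∀ z ∈ cylinder M T, u z.1 z.2 ≠ ⊥
  lsc : LowerSemicontinuousOn (fun z : M × ℝ => u z.1 z.2) (cylinder M T)
  subsol : IsSubsol T H u
  supersol : IsSupersol T H u
  initial : ∀ x, u x 0 = φ x
  liminf_initial : ∀ x, liminf (fun t => u x t) (𝓝[>] (0 : ℝ)) = φ x

open Classical in
/-- The initial datum equal to `c` at `y` and to `∞` elsewhere. -/
noncomputable def pointDatum {M : Type*} (y : M) (c : EReal) : M → EReal :=
  fun x => if x = y then c else ⊤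

/-- `h` is the fundamental solution: for every `(y, c) ∈ M × (ℝ ∪ {∞})` the function
`(x, t) ↦ h(x, t, y, c)` is the Barron-Jensen solution with datum `c` at `y` and `∞` elsewhere. -/
def IsFundamentalSolution (T : EReal) (H : (x : M) → Cotangent n x → ℝ → ℝ)
    (h : M → ℝ → M → EReal → EReal) : Prop :=
  ∀ (y : M) (c : EReal), c ≠ ⊥ → IsBJSolution T H (pointDatum y c) (fun x t => h x t y c)

end Solutions

end HJ

/-! The formula is a superposition principle. Both inequalities defining a Barron-Jensen solution
are tested from below. A test function touching an attained minimum of solutions from below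
therefore also touches, at the same point, the solution that realises the minimum, and inherits its
inequalities. So the infimum over `y` of `h x t y (φ y)` is a solution with datum `φ` once the
minimum is attained and the envelope is lower semicontinuous
(`IsFundamentalSolution.isBJSolution_iInf`). By `comparison`, applied in both directions, every
other solution with datum `φ` equals this envelope. The existence of `h` itself is the hypothesis
`hh`.

Comparison is delicate because subsolutions are only lower semicontinuous and are tested from the
wrong side for doubling of variables. Convexity repairs this. Bounding the Hamiltonian from below by
an affine function of `p` yields a linear transport inequality, which integrates along straight
lines (`transport`). In integrated form it survives the passage to the upper semicontinuous
envelope, and differentiating it back gives the usual inequality tested from above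
(`SubBelow.upperEnv`). Coercivity makes subsolutions almost nonincreasing in time along all slow
lines (`SubBelow.spread`), so the envelope at a small time `σ` is at most the datum plus `C * σ`;
this is where the liminf condition at time `0` enters. After a time shift by `σ`, the doubling
argument compares the envelope with the supersolution (`weighted_bound`), and `σ → 0` gives
`real_comparison`. Infinite values are handled by taking minima with barriers depending on time
only.

Attainment and semicontinuity follow from joint lower semicontinuity of `h x t y (φ y)` in all
variables (`IsFundamentalSolution.eventually_lt`). The lower relaxed limit of the fundamental
solutions as `y → y₀` is a supersolution by stability. Barriers uniform in `y` show that its datum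
is not below that of the fundamental solution at `y₀`, and comparison concludes. -/

namespace HJ

/-! ### Integration of linear transport inequalities in the lower semicontinuous setting -/

section Transport

variable {E : Type*} [NormedAddCommGroup E] [InnerProductSpace ℝ E] [FiniteDimensional ℝ E]

/-- A lower semicontinuous function plus a continuous function, in the form used below. -/
lemma lsc_sub_continuous {X : Type*} [TopologicalSpace X] {f g : X → ℝ} {s : Set X}
    (hf : LowerSemicontinuousOn f s) (hg : ContinuousOn g s) :
    LowerSemicontinuousOn (fun x => f x - g x) s := by
  simpa [sub_eq_add_neg] using hf.add hg.neg.lowerSemicontinuousOn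

lemma lsc_mul_continuous {X : Type*} [TopologicalSpace X] {f g : X → ℝ} {s : Set X}
    (hf : LowerSemicontinuousOn f s) (hg : ContinuousOn g s) (hpos : ∀ x ∈ s, 0 < g x) :
    LowerSemicontinuousOn (fun x => g x * f x) s := by
  intro x hx c hc
  have hk : ContinuousOn (fun y => c / g y) s :=
    continuousOn_const.div hg fun y hy => (hpos y hy).ne'
  have h0 : 0 < f x - c / g x := by
    rw [sub_pos, div_lt_iff₀ (hpos x hx)]
    linarith [mul_comm (f x) (g x)]
  filter_upwards [lsc_sub_continuous hf hk x hx 0 h0, self_mem_nhdsWithin] with y hy hys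
  rw [gt_iff_lt, sub_pos, div_lt_iff₀ (hpos y hys)] at hy
  linarith [mul_comm (f y) (g y)]

/-- A function which, in the sense of tests from below, satisfies
`f_t + w · Df + L (f - κ) ≤ 0`, satisfies the integrated inequality along the lines of velocity
`w`. -/
lemma transport {f : E × ℝ → ℝ} {D : Set (E × ℝ)} (hD : IsOpen D)
    (hf : LowerSemicontinuousOn f D) {w : E} {κ L : ℝ}
    (h : ∀ q ∈ D, ∀ ψ : E × ℝ → ℝ, ContDiffAt ℝ 1 ψ q → IsLocalMin (fun x => f x - ψ x) q →
      fderiv ℝ ψ q (w, 1) + L * (f q - κ) ≤ 0)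
    {z : E} {t s : ℝ} (hs : 0 < s) (hseg : ∀ τ ∈ Icc t (t + s), (z + (τ - t) • w, τ) ∈ D) :
    f (z + s • w, t + s) - κ ≤ Real.exp (-(L * s)) * (f (z, t) - κ) := by
  by_contra! hcon
  -- The exponential weight absorbs the zeroth order term: formally `F` is nonincreasing along `w`,
  -- with value `f (z, t) - κ` at the starting point.
  set F : E × ℝ → ℝ := fun q => Real.exp (L * (q.2 - t)) * (f q - κ) with hF
  have hFend : f (z, t) - κ < F (z + s • w, t + s) := by
    simp only [hF, add_sub_cancel_left]
    have := mul_lt_mul_of_pos_left hcon (Real.exp_pos (L * s))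
    rwa [← mul_assoc, ← Real.exp_add, add_neg_cancel, Real.exp_zero, one_mul] at this
  obtain ⟨B, hAB, hB⟩ := exists_between hFend
  set A := f (z, t) - κ with hA
  have hFlsc : LowerSemicontinuousOn F D := by
    refine lsc_mul_continuous (lsc_sub_continuous hf continuousOn_const)
      (Continuous.continuousOn (by fun_prop)) fun _ _ => Real.exp_pos _
  -- the tube
  set Θ : E × ℝ → E × ℝ := fun q => (z + q.1 + (q.2 - t) • w, q.2) with hΘ
  have hΘc : Continuous Θ := by fun_prop
  have hKc : IsCompact (({0} : Set E) ×ˢ Icc t (t + s)) := isCompact_singleton.prod isCompact_Icc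
  have hKD : (({0} : Set E) ×ˢ Icc t (t + s)) ⊆ Θ ⁻¹' D := by
    rintro ⟨y, τ⟩ ⟨hy, hτ⟩
    simp only [mem_singleton_iff] at hy
    subst hy
    simpa [hΘ] using hseg τ hτ
  -- The thickening also reaches below time `t`, which leaves room to start the tube at `t₀ = t -
  -- ρ₀`.
  obtain ⟨ρ₀, hρ₀, hρ₀D⟩ := hKc.exists_cthickening_subset_open (hD.preimage hΘc) hKD
  have htube : ∀ y : E, ∀ τ : ℝ, ‖y‖ ≤ ρ₀ → t - ρ₀ ≤ τ → τ ≤ t + s → Θ (y, τ) ∈ D := by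
    intro y τ hy hτ hτ'
    apply hρ₀D
    refine Metric.mem_cthickening_of_dist_le (y, τ) (0, max t τ) ρ₀ _
      (mk_mem_prod rfl ⟨le_max_left _ _, max_le (by linarith) hτ'⟩) ?_
    rw [Prod.dist_eq]
    refine max_le (by simpa using hy) ?_
    simp only [Real.dist_eq]
    rcases le_total t τ with h1 | h1
    · simp [h1, hρ₀.le]
    · simp only [h1, max_eq_left]
      rw [abs_le]
      constructor <;> linarith
  -- lower semicontinuity near the end point
  have hendD : (z + s • w, t + s) ∈ D := by
    simpa using hseg (t + s) ⟨by linarith, le_rfl⟩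
  have hev : ∀ᶠ q in 𝓝 (z + s • w, t + s), B < F q :=
    hD.nhdsWithin_eq hendD ▸ hFlsc _ hendD B hB
  obtain ⟨ρ₁, hρ₁, hρ₁B⟩ := Metric.eventually_nhds_iff.1 hev
  set ρ := min ρ₀ (ρ₁ / 2) with hρdef
  have hρ : 0 < ρ := lt_min hρ₀ (by linarith)
  set t₀ := t - ρ₀ with ht₀
  set η := (B - A) * (t - t₀) with hη
  have htt₀ : 0 < t - t₀ := by simp [ht₀, hρ₀]
  -- With this `η`, the function `F - g + pen` minimised below takes exactly the value `B` at `(z,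
  -- t)`, while near the end point `F` alone already exceeds `B`.
  have hηpos : 0 < η := mul_pos (by linarith) htt₀
  -- lower bound of `F` on the full tube
  have hQ₀c : IsCompact (Θ '' (Metric.closedBall (0 : E) ρ ×ˢ Icc t₀ (t + s))) :=
    ((isCompact_closedBall _ _).prod isCompact_Icc).image hΘc
  have hsub₀ : Θ '' (Metric.closedBall (0 : E) ρ ×ˢ Icc t₀ (t + s)) ⊆ D := by
    rintro _ ⟨⟨y, τ⟩, ⟨hy, hτ⟩, rfl⟩
    exact htube y τ ((mem_closedBall_zero_iff.1 hy).trans (min_le_left _ _)) hτ.1 hτ.2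
  obtain ⟨R, hR⟩ : ∃ R, ∀ q ∈ Θ '' (Metric.closedBall (0 : E) ρ ×ˢ Icc t₀ (t + s)), R ≤ F q := by
    have hne : (Θ '' (Metric.closedBall (0 : E) ρ ×ˢ Icc t₀ (t + s))).Nonempty :=
      ⟨Θ (0, t), (0, t), mk_mem_prod (by simp [hρ.le]) ⟨by linarith, by linarith⟩, rfl⟩
    obtain ⟨q, -, hq⟩ := (hFlsc.mono hsub₀).exists_isMinOn hne hQ₀c
    exact ⟨F q, fun x hx => hq hx⟩
  -- constants
  obtain ⟨ζ, hζ, hζt, hζR⟩ : ∃ ζ, 0 < ζ ∧ t₀ + ζ < t ∧ A + η / (t - t₀) < R + η / ζ := by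
    have hlim : Tendsto (fun ζ : ℝ => R + η / ζ) (𝓝[>] 0) atTop :=
      tendsto_atTop_add_const_left _ _
        ((tendsto_inv_nhdsGT_zero.const_mul_atTop hηpos).congr fun x => by simp [div_eq_mul_inv])
    have h2 : ∀ᶠ ζ : ℝ in 𝓝[>] 0, ζ < t - t₀ :=
      mem_nhdsWithin_of_mem_nhds (Iio_mem_nhds htt₀)
    obtain ⟨ζ, h1, h2, h3⟩ := ((hlim.eventually_gt_atTop (A + η / (t - t₀))).and
      (h2.and self_mem_nhdsWithin)).exists
    exact ⟨ζ, h3, by linarith, h1⟩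
  obtain ⟨N, hN, hNR⟩ : ∃ N : ℝ, 0 ≤ N ∧ A + η / (t - t₀) < R + N * ρ ^ 2 := by
    refine ⟨|(A + η / (t - t₀) - R + 1) / ρ ^ 2|, abs_nonneg _, ?_⟩
    have := mul_le_mul_of_nonneg_right (le_abs_self ((A + η / (t - t₀) - R + 1) / ρ ^ 2))
      (sq_nonneg ρ)
    rw [div_mul_cancel₀ _ (by positivity)] at this
    linarith
  -- `g` is strictly increasing, which will contradict the transport inequality, and tends to `-∞`
  -- at `t₀`, which keeps the minimum of `F - g + pen` off the bottom of the tube. The penalty keeps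
  -- it off the lateral boundary, and `B` off the top. The penalty is constant along lines of
  -- velocity `w`, so it does not contribute to the derivative in that direction.
  set g : ℝ → ℝ := fun τ => -(η / (τ - t₀)) with hg
  set pen : E × ℝ → ℝ := fun q => N * ‖q.1 - z - (q.2 - t) • w‖ ^ 2 with hpen
  set Q := Θ '' (Metric.closedBall (0 : E) ρ ×ˢ Icc (t₀ + ζ) (t + s)) with hQ
  have hQc : IsCompact Q := ((isCompact_closedBall _ _).prod isCompact_Icc).image hΘc
  have hQsub : Q ⊆ Θ '' (Metric.closedBall (0 : E) ρ ×ˢ Icc t₀ (t + s)) :=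
    image_mono (prod_mono_right (Icc_subset_Icc_left (by linarith)))
  have hQmem : ∀ q : E × ℝ, q ∈ Q ↔
      ‖q.1 - z - (q.2 - t) • w‖ ≤ ρ ∧ t₀ + ζ ≤ q.2 ∧ q.2 ≤ t + s := by
    rintro ⟨y, τ⟩
    constructor
    · rintro ⟨⟨y', τ'⟩, ⟨hy, hτ⟩, hq⟩
      simp only [hΘ, Prod.mk.injEq] at hq
      obtain ⟨rfl, rfl⟩ := hq
      refine ⟨?_, hτ.1, hτ.2⟩
      have : z + y' + (τ' - t) • w - z - (τ' - t) • w = y' := by abel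
      simpa [this] using hy
    · rintro ⟨h1, h2, h3⟩
      refine ⟨(y - z - (τ - t) • w, τ), ⟨by simpa using h1, h2, h3⟩, ?_⟩
      simp only [hΘ, Prod.mk.injEq, and_true]
      abel
  have hgc : ContinuousOn (fun q : E × ℝ => g q.2 - pen q) Q := by
    refine ContinuousOn.sub (ContinuousOn.neg (continuousOn_const.div (by fun_prop) ?_))
      (Continuous.continuousOn (by fun_prop))
    intro q hq
    have := ((hQmem q).1 hq).2.1
    exact (by linarith : (0 : ℝ) < q.2 - t₀).ne'
  have hztQ : (z, t) ∈ Q := (hQmem _).2 ⟨by simp [hρ.le], by simp only; linarith,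
    by simp only; linarith⟩
  obtain ⟨q, hqQ, hq⟩ := (lsc_sub_continuous ((hFlsc.mono hsub₀).mono hQsub) hgc).exists_isMinOn
    ⟨_, hztQ⟩ hQc
  have hqD : q ∈ D := hsub₀ (hQsub hqQ)
  obtain ⟨hq1, hq2, hq3⟩ := (hQmem q).1 hqQ
  have hval : F q - (g q.2 - pen q) ≤ A + η / (t - t₀) := by
    have := hq hztQ
    simpa [hF, hg, hpen, hA] using this
  have hRq := hR q (hQsub hqQ)
  have hpenq : 0 ≤ pen q := by positivity
  have hq2pos : 0 < q.2 - t₀ := by linarith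
  have hηq : 0 < η / (q.2 - t₀) := by positivity
  have hlt1 : ‖q.1 - z - (q.2 - t) • w‖ < ρ := by
    refine lt_of_le_of_ne hq1 fun heq => ?_
    have : pen q = N * ρ ^ 2 := by simp only [hpen, heq]
    simp only [hg] at hval
    linarith
  have hlt2 : t₀ + ζ < q.2 := by
    refine lt_of_le_of_ne hq2 fun heq => ?_
    have : q.2 - t₀ = ζ := by linarith
    simp only [hg, this] at hval
    linarith
  have hlt3 : q.2 < t + s := by
    refine lt_of_le_of_ne hq3 fun heq => ?_
    have hBq : B < F q := by
      apply hρ₁B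
      rw [Prod.dist_eq, heq]
      have h2 : q.1 - (z + s • w) = q.1 - z - (q.2 - t) • w := by
        rw [heq, add_sub_cancel_left]; abel
      simp only [dist_self, dist_eq_norm, h2]
      refine max_lt ?_ hρ₁
      exact hlt1.trans_le ((min_le_right _ _).trans (by linarith))
    have h3 : η / (t - t₀) = B - A := by rw [hη]; field_simp
    simp only [hg] at hval
    linarith
  -- test function
  set c := F q - (g q.2 - pen q) with hc
  set ψ : E × ℝ → ℝ := fun x => κ + Real.exp (-(L * (x.2 - t))) * (g x.2 - pen x + c) with hψ
  have hexp : ∀ x : E × ℝ, Real.exp (-(L * (x.2 - t))) * F x = f x - κ := by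
    intro x
    simp only [hF]
    rw [← mul_assoc, ← Real.exp_add, neg_add_cancel, Real.exp_zero, one_mul]
  have hψd : ContDiffAt ℝ 1 ψ q := by
    have h1 : ContDiffAt ℝ 1 (fun x : E × ℝ => g x.2) q := by
      refine ContDiffAt.neg (contDiffAt_const.div (by fun_prop) hq2pos.ne')
    have h2 : ContDiffAt ℝ 1 pen q := by
      refine contDiffAt_const.mul (ContDiffAt.norm_sq ℝ (by fun_prop))
    exact contDiffAt_const.add (ContDiffAt.mul (by fun_prop) ((h1.sub h2).add contDiffAt_const))
  have hmin : IsLocalMin (fun x => f x - ψ x) q := by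
    have hnear : ∀ᶠ x in 𝓝 q, x ∈ Q := by
      have e1 : ∀ᶠ x : E × ℝ in 𝓝 q, ‖x.1 - z - (x.2 - t) • w‖ < ρ :=
        (by fun_prop : Continuous fun x : E × ℝ => ‖x.1 - z - (x.2 - t) • w‖).continuousAt.eventually_lt
          continuousAt_const hlt1
      have e2 : ∀ᶠ x : E × ℝ in 𝓝 q, t₀ + ζ < x.2 :=
        continuousAt_const.eventually_lt continuousAt_snd hlt2
      have e3 : ∀ᶠ x : E × ℝ in 𝓝 q, x.2 < t + s :=
        continuousAt_snd.eventually_lt continuousAt_const hlt3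
      filter_upwards [e1, e2, e3] with x h1 h2 h3
      exact (hQmem x).2 ⟨h1.le, h2.le, h3.le⟩
    filter_upwards [hnear] with x hx
    have h1 : c ≤ F x - (g x.2 - pen x) := hq hx
    have h2 : f q - ψ q = 0 := by
      have := hexp q
      simp only [hψ, hc]
      rw [add_sub_cancel]
      linarith
    have h3 := hexp x
    rw [h2]
    simp only [hψ]
    nlinarith [Real.exp_pos (-(L * (x.2 - t)))]
  have hmain := h q hqD ψ hψd hmin
  -- derivative along the line
  have hd : fderiv ℝ ψ q (w, 1) = Real.exp (-(L * (q.2 - t))) * (η / (q.2 - t₀) ^ 2)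
      - L * (f q - κ) := by
    have hline : HasDerivAt (fun r : ℝ => q + r • ((w, 1) : E × ℝ)) (w, 1) 0 := by
      simpa using ((hasDerivAt_id (0 : ℝ)).smul_const ((w, 1) : E × ℝ)).const_add q
    have hψf : HasFDerivAt ψ (fderiv ℝ ψ q) (q + (0 : ℝ) • ((w, 1) : E × ℝ)) := by
      simpa using (hψd.differentiableAt (by norm_num)).hasFDerivAt
    have h1 := hψf.comp_hasDerivAt (0 : ℝ) hline
    have h2 : (ψ ∘ fun r : ℝ => q + r • ((w, 1) : E × ℝ)) = fun r : ℝ =>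
        κ + Real.exp (-(L * (q.2 + r - t))) * (-(η / (q.2 + r - t₀)) - pen q + c) := by
      funext r
      have : q.1 + r • w - z - (q.2 + r - t) • w = q.1 - z - (q.2 - t) • w := by
        module
      simp only [hψ, hg, hpen, Function.comp, Prod.fst_add, Prod.snd_add, Prod.smul_fst,
        Prod.smul_snd, smul_eq_mul, mul_one, this]
    rw [h2] at h1
    have h3 : HasDerivAt (fun r : ℝ => Real.exp (-(L * (q.2 + r - t))))
        (Real.exp (-(L * (q.2 - t))) * (-L)) 0 := by
      have : HasDerivAt (fun r : ℝ => -(L * (q.2 + r - t))) (-L) 0 := by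
        simpa using ((((hasDerivAt_id (0 : ℝ)).const_add q.2).sub_const t).const_mul L).fun_neg
      simpa using this.exp
    have h4 : HasDerivAt (fun r : ℝ => -(η / (q.2 + r - t₀)) - pen q + c)
        (η / (q.2 - t₀) ^ 2) 0 := by
      have h5 : HasDerivAt (fun r : ℝ => q.2 + r - t₀) 1 0 := by
        simpa using ((hasDerivAt_id (0 : ℝ)).const_add q.2).sub_const t₀
      have := (((hasDerivAt_const (0 : ℝ) η).div h5 (by simpa using hq2pos.ne')).neg.sub_const
        (pen q)).add_const c
      convert! this using 1
      simp [neg_div]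
    have h6 := (h3.mul h4).const_add κ
    rw [h1.unique h6]
    have h7 := hexp q
    have h8 : F q = g q.2 - pen q + c := by simp [hc]
    simp only [add_zero]
    rw [← h7, h8]
    ring
  rw [hd] at hmain
  have : 0 < Real.exp (-(L * (q.2 - t))) * (η / (q.2 - t₀) ^ 2) := by positivity
  linarith

end Transport

end HJ

namespace HJ

/-! ### Convex coercive Hamiltonians on open subsets of a Euclidean space -/

section LocalHamiltonian

set_option linter.unusedSectionVars false

variable {E : Type*} [NormedAddCommGroup E] [InnerProductSpace ℝ E] [FiniteDimensional ℝ E]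

/-- A coercive convex Hamiltonian on an open subset of a Euclidean space, Lipschitz continuous in
the unknown. -/
structure LocalHam (G : E → (E →L[ℝ] ℝ) → ℝ → ℝ) (Ω : Set E) (L : ℝ) : Prop where
  isOpen : IsOpen Ω
  continuousOn : ContinuousOn (fun q : E × (E →L[ℝ] ℝ) × ℝ => G q.1 q.2.1 q.2.2) (Ω ×ˢ univ)
  convex : ∀ z ∈ Ω, ∀ r, ConvexOn ℝ univ (fun p => G z p r)
  lip : ∀ z ∈ Ω, ∀ p r r', |G z p r - G z p r'| ≤ L * |r - r'|
  coercive : ∀ R : ℝ, ∃ K > 0, ∀ z ∈ Ω, ∀ p r, |r| ≤ R → K ≤ ‖p‖ → R < G z p r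
  pos : 0 < L

/-- Subsolution inequality tested from below. -/
def SubBelow (G : E → (E →L[ℝ] ℝ) → ℝ → ℝ) (D : Set (E × ℝ)) (f : E × ℝ → ℝ) : Prop :=
  ∀ q ∈ D, ∀ ψ : E × ℝ → ℝ, ContDiffAt ℝ 1 ψ q → IsLocalMin (fun x => f x - ψ x) q →
    fderiv ℝ ψ q (0, 1) + G q.1 ((fderiv ℝ ψ q).comp (.inl ℝ E ℝ)) (f q) ≤ 0

/-- Subsolution inequality tested from above. -/
def SubAbove (G : E → (E →L[ℝ] ℝ) → ℝ → ℝ) (D : Set (E × ℝ)) (f : E × ℝ → ℝ) : Prop :=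
  ∀ q ∈ D, ∀ ψ : E × ℝ → ℝ, ContDiffAt ℝ 1 ψ q → IsLocalMax (fun x => f x - ψ x) q →
    fderiv ℝ ψ q (0, 1) + G q.1 ((fderiv ℝ ψ q).comp (.inl ℝ E ℝ)) (f q) ≤ 0

/-- Supersolution inequality tested from below. -/
def SupBelow (G : E → (E →L[ℝ] ℝ) → ℝ → ℝ) (D : Set (E × ℝ)) (f : E × ℝ → ℝ) : Prop :=
  ∀ q ∈ D, ∀ ψ : E × ℝ → ℝ, ContDiffAt ℝ 1 ψ q → IsLocalMin (fun x => f x - ψ x) q →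
    0 ≤ fderiv ℝ ψ q (0, 1) + G q.1 ((fderiv ℝ ψ q).comp (.inl ℝ E ℝ)) (f q)

variable {G : E → (E →L[ℝ] ℝ) → ℝ → ℝ} {Ω : Set E} {L : ℝ}

lemma LocalHam.continuousAt (hG : LocalHam G Ω L) {z : E} (hz : z ∈ Ω) (p : E →L[ℝ] ℝ) (r : ℝ) :
    ContinuousAt (fun q : E × (E →L[ℝ] ℝ) × ℝ => G q.1 q.2.1 q.2.2) (z, p, r) :=
  hG.continuousOn.continuousAt ((hG.isOpen.prod isOpen_univ).mem_nhds ⟨hz, mem_univ _⟩)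

lemma LocalHam.continuousAt_comp (hG : LocalHam G Ω L) {X : Type*} [TopologicalSpace X]
    {ζ : X → E} {ϖ : X → E →L[ℝ] ℝ} {ρ : X → ℝ} {x : X} (hx : ζ x ∈ Ω) (hζ : ContinuousAt ζ x)
    (hϖ : ContinuousAt ϖ x) (hρ : ContinuousAt ρ x) :
    ContinuousAt (fun y => G (ζ y) (ϖ y) (ρ y)) x :=
  ContinuousAt.comp (g := fun q : E × (E →L[ℝ] ℝ) × ℝ => G q.1 q.2.1 q.2.2)
    (f := fun y => (ζ y, ϖ y, ρ y)) (hG.continuousAt hx _ _) (hζ.prodMk (hϖ.prodMk hρ))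

lemma LocalHam.eventually_abs_le (hG : LocalHam G Ω L) {z₀ : E} (hz₀ : z₀ ∈ Ω) (K R : ℝ) :
    ∃ B : ℝ, 0 ≤ B ∧ ∀ᶠ z in 𝓝 z₀, ∀ p r, ‖p‖ ≤ K → |r| ≤ R → |G z p r| ≤ B := by
  obtain ⟨ρ, hρ, hρΩ⟩ := Metric.nhds_basis_closedBall.mem_iff.1 (hG.isOpen.mem_nhds hz₀)
  have hc : IsCompact (Metric.closedBall z₀ ρ ×ˢ
      (Metric.closedBall (0 : E →L[ℝ] ℝ) K ×ˢ Icc (-R) R)) :=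
    (isCompact_closedBall _ _).prod ((isCompact_closedBall _ _).prod isCompact_Icc)
  obtain ⟨B, hB⟩ := hc.exists_bound_of_continuousOn
    (hG.continuousOn.mono (prod_mono hρΩ (subset_univ _)))
  refine ⟨max B 0, le_max_right _ _, ?_⟩
  filter_upwards [Metric.closedBall_mem_nhds z₀ hρ] with z hz p r hp hr
  exact (hB (z, p, r) ⟨hz, by simpa using hp, abs_le.1 hr⟩).trans (le_max_left _ _)

/-- Convexity along rays: growth on a sphere propagates outwards. -/
lemma convexOn_scaled_ray {g : (E →L[ℝ] ℝ) → ℝ} (hg : ConvexOn ℝ univ g) (p : E →L[ℝ] ℝ) {μ : ℝ}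
    (h0 : 0 ≤ μ) (h1 : μ ≤ 1) : g (μ • p) ≤ (1 - μ) * g 0 + μ * g p := by
  have := hg.2 (mem_univ 0) (mem_univ p) (sub_nonneg.2 h1) h0 (by ring)
  simpa using this

/-- Near `z₀` the Hamiltonian is at most `C₀` at `p = 0` and exceeds `C₀ + 1` on the sphere of
radius `K`; convexity along rays then forces growth of slope at least `1 / K` outside that sphere.
-/
lemma LocalHam.linear_lower_bound (hG : LocalHam G Ω L) {z₀ : E} (hz₀ : z₀ ∈ Ω) (R : ℝ) :
    ∃ α > 0, ∃ C, 0 ≤ C ∧ ∀ᶠ z in 𝓝 z₀, ∀ p r, |r| ≤ R → α * ‖p‖ - C ≤ G z p r := by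
  obtain ⟨C₀, hC₀, hb₀⟩ := hG.eventually_abs_le hz₀ 0 R
  obtain ⟨K, hK, hcoer⟩ := hG.coercive (max R (C₀ + 1))
  obtain ⟨B, hB, hb⟩ := hG.eventually_abs_le hz₀ K R
  refine ⟨1 / K, by positivity, 1 + B, by positivity, ?_⟩
  filter_upwards [hb₀, hb, hG.isOpen.mem_nhds hz₀] with z h0 h1 hz p r hr
  rcases le_or_gt ‖p‖ K with hp | hp
  · have := (abs_le.1 (h1 p r hp hr)).1
    have h2 : 1 / K * ‖p‖ ≤ 1 := by
      rw [one_div, inv_mul_le_iff₀ hK]; simpa using hp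
    linarith
  · have hpp : 0 < ‖p‖ := hK.trans hp
    set μ := K / ‖p‖ with hμ
    have hμ0 : 0 < μ := by positivity
    have hμ1 : μ ≤ 1 := (div_le_one hpp).2 hp.le
    have hn : ‖μ • p‖ = K := by
      rw [norm_smul, Real.norm_of_nonneg hμ0.le, hμ]; field_simp
    have h3 := hcoer z hz (μ • p) r (hr.trans (le_max_left _ _)) hn.ge
    have h4 := convexOn_scaled_ray (hG.convex z hz r) p hμ0.le hμ1
    have h5 := (abs_le.1 (h0 0 r (by simp) hr)).2
    have h6 : C₀ + 1 < (1 - μ) * G z 0 r + μ * G z p r :=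
      (le_max_right _ _).trans_lt (h3.trans_le h4)
    have h7 : (1 - μ) * G z 0 r ≤ (1 - μ) * C₀ :=
      mul_le_mul_of_nonneg_left h5 (by linarith)
    have h8 : 1 / K * ‖p‖ * μ = 1 := by rw [hμ]; field_simp
    have h9 : 1 / K * ‖p‖ ≤ G z p r := by
      refine le_of_mul_le_mul_right ?_ hμ0
      rw [h8]
      nlinarith
    linarith

lemma LocalHam.lower_semi (hG : LocalHam G Ω L) {z₀ : E} (hz₀ : z₀ ∈ Ω) (a P : ℝ) {ε : ℝ}
    (hε : 0 < ε) : ∀ᶠ z in 𝓝 z₀, ∀ p, ‖p‖ ≤ P → G z₀ p a - ε < G z p a := by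
  have hc : IsCompact (Metric.closedBall (0 : E →L[ℝ] ℝ) P) := isCompact_closedBall _ _
  have := hc.eventually_forall_of_forall_eventually (x₀ := z₀)
    (P := fun z p => G z₀ p a - ε < G z p a) ?_
  · filter_upwards [this] with z hz p hp using hz p (by simpa using hp)
  · intro p _
    have h1 : ContinuousAt (fun x : E × (E →L[ℝ] ℝ) => G x.1 x.2 a) (z₀, p) :=
      hG.continuousAt_comp hz₀ continuousAt_fst continuousAt_snd continuousAt_const
    have h2 : ContinuousAt (fun x : E × (E →L[ℝ] ℝ) => G z₀ x.2 a - ε) (z₀, p) :=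
      (hG.continuousAt_comp hz₀ continuousAt_const continuousAt_snd continuousAt_const).sub
        continuousAt_const
    exact h2.eventually_lt h1 (by simpa using hε)

/-- Reflexivity, through the Riesz isomorphism. It turns a subgradient in the momentum variable into
a velocity. -/
lemma exists_eval_eq (l : (E →L[ℝ] ℝ) →L[ℝ] ℝ) :
    ∃ w : E, ∀ p, l p = p w := by
  set m : E →L[ℝ] ℝ := l.comp (innerSL ℝ (E := E)) with hm
  refine ⟨(InnerProductSpace.toDual ℝ E).symm m, fun p => ?_⟩
  have h1 : innerSL ℝ ((InnerProductSpace.toDual ℝ E).symm p) = p := by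
    ext v
    simp
  calc l p = m ((InnerProductSpace.toDual ℝ E).symm p) := by
        rw [hm, ContinuousLinearMap.comp_apply, h1]
    _ = inner ℝ ((InnerProductSpace.toDual ℝ E).symm m)
          ((InnerProductSpace.toDual ℝ E).symm p) := by simp
    _ = inner ℝ ((InnerProductSpace.toDual ℝ E).symm p)
          ((InnerProductSpace.toDual ℝ E).symm m) := real_inner_comm _ _
    _ = _ := by simp

/-- An approximate subgradient of the Hamiltonian in `p`, robust under a change of the base
point. -/
lemma LocalHam.exists_subgradient (hG : LocalHam G Ω L) {z₀ : E} (hz₀ : z₀ ∈ Ω)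
    (p₀ : E →L[ℝ] ℝ) (a : ℝ) {ε : ℝ} (hε : 0 < ε) :
    ∃ w : E, ∃ l : ℝ, (∀ᶠ z in 𝓝 z₀, ∀ p, p w - l ≤ G z p a) ∧ G z₀ p₀ a - ε ≤ p₀ w - l := by
  obtain ⟨l, c, hlc, hl0⟩ := ConvexOn.exists_affine_le_of_lt (𝕜 := ℝ) (mem_univ p₀)
    (show G z₀ p₀ a - ε / 4 < G z₀ p₀ a by linarith) isClosed_univ
    ((ConvexOn.continuousOn isOpen_univ (hG.convex z₀ hz₀ a)).lowerSemicontinuousOn)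
    (hG.convex z₀ hz₀ a)
  obtain ⟨w₀, hw₀⟩ := exists_eval_eq l
  have hsub : ∀ p, p w₀ + c ≤ G z₀ p a := fun p => by
    have := hlc ⟨p, mem_univ p⟩
    simpa [hw₀] using this
  have heq : p₀ w₀ + c = G z₀ p₀ a - ε / 4 := by simpa [hw₀] using hl0
  obtain ⟨α, hα, C, hC, hlin⟩ := hG.linear_lower_bound hz₀ |a|
  obtain ⟨C₁, hC₁, hb₁⟩ := hG.eventually_abs_le hz₀ 0 |a|
  set S := |G z₀ p₀ a| + C + ε + 1 with hS
  have hSpos : 0 < S := by positivity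
  -- The affine minorant is a convex combination: weight `1 - θ` on a near-subgradient at `z₀`,
  -- weight `θ` on the linear lower bound. The second part leaves a surplus `θ * α * ‖p‖`; `θ` is so
  -- small that the loss at `p₀` stays below `ε`.
  set θ := min (1 / 2) (ε / 4 / S) with hθ
  have hθ0 : 0 < θ := lt_min (by norm_num) (by positivity)
  have hθ1 : θ ≤ 1 / 2 := min_le_left _ _
  have hθS : θ * S ≤ ε / 4 := by
    have := mul_le_mul_of_nonneg_right (min_le_right (1 / 2) (ε / 4 / S)) hSpos.le
    rwa [div_mul_cancel₀ _ hSpos.ne'] at this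
  set ℓ := -((1 - θ) * (c - ε / 4) - θ * C) with hℓ
  -- For `‖p‖ ≤ P` uniform continuity in the base point suffices. On the sphere of radius `P` the
  -- surplus dominates `|ℓ| + C₁`, so convexity along rays from the origin carries the inequality to
  -- all larger momenta.
  set P := (|ℓ| + C₁) / (θ * α) + 1 with hP
  have hPpos : 0 < P := by positivity
  have hPθ : |ℓ| + C₁ ≤ θ * α * P := by
    have : θ * α * P = |ℓ| + C₁ + θ * α := by rw [hP]; field_simp
    nlinarith [mul_pos hθ0 hα]
  refine ⟨(1 - θ) • w₀, ℓ, ?_, ?_⟩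
  · filter_upwards [hlin, hb₁, hG.lower_semi hz₀ a P (by positivity : 0 < ε / 4),
      hG.isOpen.mem_nhds hz₀] with z h1 h2 h3 hz p
    have key : ∀ q : E →L[ℝ] ℝ, ‖q‖ ≤ P → q ((1 - θ) • w₀) - ℓ + θ * α * ‖q‖ ≤ G z q a := by
      intro q hq
      have e1 := h1 q a le_rfl
      have e2 := h3 q hq
      have e3 := hsub q
      have e4 : (1 - θ) * (q w₀ + c - ε / 4) ≤ (1 - θ) * G z q a :=
        mul_le_mul_of_nonneg_left (by linarith) (by linarith)
      have e5 : θ * (α * ‖q‖ - C) ≤ θ * G z q a := mul_le_mul_of_nonneg_left e1 hθ0.le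
      rw [map_smul, smul_eq_mul, hℓ]
      nlinarith
    rcases le_or_gt ‖p‖ P with hp | hp
    · have := key p hp
      have h4 : 0 ≤ θ * α * ‖p‖ := by positivity
      linarith
    · have hpp : 0 < ‖p‖ := hPpos.trans hp
      set μ := P / ‖p‖ with hμ
      have hμ0 : 0 < μ := by positivity
      have hμ1 : μ ≤ 1 := (div_le_one hpp).2 hp.le
      have hn : ‖μ • p‖ = P := by
        rw [norm_smul, Real.norm_of_nonneg hμ0.le, hμ]; field_simp
      have e1 := key (μ • p) hn.le
      have e2 := convexOn_scaled_ray (hG.convex z hz a) p hμ0.le hμ1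
      have e3 := (abs_le.1 (h2 0 a (by simp) le_rfl)).2
      rw [hn] at e1
      simp only [smul_apply, smul_eq_mul] at e1
      have e4 : (1 - μ) * G z 0 a ≤ (1 - μ) * C₁ :=
        mul_le_mul_of_nonneg_left e3 (by linarith)
      have e5 : (1 - μ) * (ℓ + C₁) ≤ (1 - μ) * (θ * α * P) :=
        mul_le_mul_of_nonneg_left (by linarith [le_abs_self ℓ]) (by linarith)
      have e6 : 0 ≤ μ * (θ * α * P) := by positivity
      refine le_of_mul_le_mul_left ?_ hμ0
      nlinarith
  · rw [map_smul, smul_eq_mul, hℓ]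
    have e1 : θ * |G z₀ p₀ a| + θ * C + θ * ε + θ ≤ ε / 4 := by rw [hS] at hθS; linarith
    have e2 : θ * G z₀ p₀ a ≤ θ * |G z₀ p₀ a| :=
      mul_le_mul_of_nonneg_left (le_abs_self _) hθ0.le
    have e3 : p₀ w₀ = G z₀ p₀ a - ε / 4 - c := by linarith
    rw [e3]
    nlinarith [mul_pos hθ0 hε]

end LocalHamiltonian

/-! ### Upper semicontinuous envelopes of bounded functions -/

section Envelope

set_option linter.unusedSectionVars false

variable {X : Type*} [TopologicalSpace X]

/-- The upper semicontinuous envelope. -/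
noncomputable def upperEnv (f : X → ℝ) (x : X) : ℝ := limsup f (𝓝 x)

variable {f : X → ℝ} {R : ℝ}

lemma isBoundedUnder_le_of_abs_le (hf : ∀ x, |f x| ≤ R) (l : Filter X) :
    IsBoundedUnder (· ≤ ·) l f :=
  isBoundedUnder_of ⟨R, fun x => (abs_le.1 (hf x)).2⟩

lemma isCoboundedUnder_le_of_abs_le (hf : ∀ x, |f x| ≤ R) (l : Filter X) [l.NeBot] :
    IsCoboundedUnder (· ≤ ·) l f :=
  (isBoundedUnder_of ⟨-R, fun x => (abs_le.1 (hf x)).1⟩ :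
    IsBoundedUnder (· ≥ ·) l f).isCoboundedUnder_le

lemma eventually_lt_of_upperEnv_lt (hf : ∀ x, |f x| ≤ R) {x : X} {c : ℝ} (h : upperEnv f x < c) :
    ∀ᶠ y in 𝓝 x, f y < c :=
  eventually_lt_of_limsup_lt h (isBoundedUnder_le_of_abs_le hf _)

lemma frequently_lt_of_lt_upperEnv (hf : ∀ x, |f x| ≤ R) {x : X} {c : ℝ} (h : c < upperEnv f x) :
    ∃ᶠ y in 𝓝 x, c < f y :=
  frequently_lt_of_lt_limsup (isCoboundedUnder_le_of_abs_le hf _) h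

lemma upperEnv_le (hf : ∀ x, |f x| ≤ R) {x : X} {c : ℝ} (h : ∀ᶠ y in 𝓝 x, f y ≤ c) :
    upperEnv f x ≤ c :=
  limsup_le_of_le (isCoboundedUnder_le_of_abs_le hf _) h

lemma le_upperEnv (hf : ∀ x, |f x| ≤ R) (x : X) : f x ≤ upperEnv f x := by
  by_contra! h
  exact lt_irrefl _ (eventually_lt_of_upperEnv_lt hf h).self_of_nhds

lemma abs_upperEnv_le (hf : ∀ x, |f x| ≤ R) (x : X) : |upperEnv f x| ≤ R :=
  abs_le.2 ⟨(abs_le.1 (hf x)).1.trans (le_upperEnv hf x),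
    upperEnv_le hf (Eventually.of_forall fun y => (abs_le.1 (hf y)).2)⟩

lemma upperSemicontinuous_upperEnv (hf : ∀ x, |f x| ≤ R) : UpperSemicontinuous (upperEnv f) := by
  intro x c hc
  obtain ⟨c', h1, h2⟩ := exists_between hc
  filter_upwards [(eventually_lt_of_upperEnv_lt hf h1).eventually_nhds] with y hy
  exact (upperEnv_le hf (hy.mono fun _ h => h.le)).trans_lt h2

end Envelope

end HJ

namespace HJ

/-! ### From subsolutions tested from below to subsolutions tested from above -/

section FromBelowToAbove

set_option linter.unusedSectionVars false

variable {E : Type*} [NormedAddCommGroup E] [InnerProductSpace ℝ E] [FiniteDimensional ℝ E]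
variable {G : E → (E →L[ℝ] ℝ) → ℝ → ℝ} {Ω : Set E} {L : ℝ} {D : Set (E × ℝ)} {f : E × ℝ → ℝ}

/-- An affine lower bound on the Hamiltonian reduces the nonlinear inequality to the linear one with
constant velocity `w`. -/
lemma SubBelow.transport (hf : SubBelow G D f) (hlsc : LowerSemicontinuousOn f D) {V : Set (E × ℝ)}
    (hV : IsOpen V) (hVD : V ⊆ D) {w : E} {κ : ℝ}
    (hG : ∀ q ∈ V, ∀ p : E →L[ℝ] ℝ, p w + L * (f q - κ) ≤ G q.1 p (f q))
    {z : E} {t s : ℝ} (hs : 0 < s) (hseg : ∀ τ ∈ Icc t (t + s), (z + (τ - t) • w, τ) ∈ V) :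
    f (z + s • w, t + s) - κ ≤ Real.exp (-(L * s)) * (f (z, t) - κ) := by
  refine HJ.transport hV (hlsc.mono hVD) (fun q hq ψ hψ hmin => ?_) hs hseg
  have h1 := hf q (hVD hq) ψ hψ hmin
  have h2 := hG q hq ((fderiv ℝ ψ q).comp (.inl ℝ E ℝ))
  have h3 : fderiv ℝ ψ q (w, 1) = fderiv ℝ ψ q (0, 1) + ((fderiv ℝ ψ q).comp (.inl ℝ E ℝ)) w := by
    rw [ContinuousLinearMap.comp_apply, ← map_add]
    simp
  linarith

lemma HasDerivAt.nonneg_of_right_min {Q : ℝ → ℝ} {d : ℝ} (hQ : HasDerivAt Q d 0)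
    (h : ∀ᶠ s in 𝓝[>] (0 : ℝ), Q 0 ≤ Q s) : 0 ≤ d := by
  have h1 := (hasDerivWithinAt_iff_tendsto_slope' (by simp)).1
    (hQ.hasDerivWithinAt (s := Ioi (0 : ℝ)))
  refine ge_of_tendsto h1 ?_
  filter_upwards [h, self_mem_nhdsWithin] with s hs hs0
  rw [slope_def_field]
  exact div_nonneg (by linarith) (by simpa using (le_of_lt hs0))

/-- For convex Hamiltonians, the upper semicontinuous envelope of a lower semicontinuous
subsolution tested from below is a subsolution tested from above. -/
lemma SubBelow.upperEnv (hG : LocalHam G Ω L) (hD : IsOpen D) (hDΩ : ∀ q ∈ D, q.1 ∈ Ω)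
    (hf : SubBelow G D f) (hlsc : LowerSemicontinuousOn f D) {R : ℝ} (hR : ∀ q, |f q| ≤ R) :
    SubAbove G D (upperEnv f) := by
  intro q hq ψ hψ hmax
  set a := HJ.upperEnv f q with ha
  set p₀ := (fderiv ℝ ψ q).comp (.inl ℝ E ℝ) with hp₀
  have hL := hG.pos
  refine le_of_forall_pos_le_add fun ε hε => ?_
  obtain ⟨w, l, hw, hwl⟩ := hG.exists_subgradient (hDΩ q hq) p₀ a (half_pos hε)
  set ε' := ε / (4 * L) with hε'
  have hε'0 : 0 < ε' := by positivity
  -- a good ball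
  have hgood : ∀ᶠ x in 𝓝 q, x ∈ D ∧ (∀ p : E →L[ℝ] ℝ, p w - l ≤ G x.1 p a) ∧
      HJ.upperEnv f x < a + ε' ∧ HJ.upperEnv f x - ψ x ≤ a - ψ q ∧ ContinuousAt ψ x := by
    have e1 : ∀ᶠ x in 𝓝 q, x ∈ D := hD.mem_nhds hq
    have e2 := (continuousAt_fst (p := q)).eventually hw
    have e3 := upperSemicontinuous_upperEnv hR q (a + ε') (by simpa [ha] using hε'0)
    have e4 := (hψ.eventually (by norm_num)).mono fun x hx => hx.continuousAt
    filter_upwards [e1, e2, e3, e4, hmax] with x h1 h2 h3 h4 h5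
    exact ⟨h1, h2, h3, h5, h4⟩
  obtain ⟨ρ, hρ, hball⟩ := Metric.eventually_nhds_iff_ball.1 hgood
  -- Replacing `G x.1 p a` by `G x.1 p (f x)` costs `L * |f x - a|`. Since `f x < a + ε'`, this is
  -- at most `L * (a - f x + 2 * ε')`, an affine function of `f x`; `κ` collects the constants. No
  -- lower bound on `f x` is needed.
  set κ := a + 2 * ε' + l / L with hκ
  have hLκ : L * κ = L * a + 2 * (L * ε') + l := by rw [hκ]; field_simp
  have htrans : ∀ x ∈ Metric.ball q ρ, ∀ p : E →L[ℝ] ℝ, p w + L * (f x - κ) ≤ G x.1 p (f x) := by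
    intro x hx p
    obtain ⟨h1, h2, h3, -⟩ := hball x hx
    have h4 := (abs_le.1 (hG.lip x.1 (hDΩ x h1) p (f x) a)).1
    have h5 : |f x - a| ≤ a - f x + 2 * ε' := by
      have := le_upperEnv hR x
      rw [abs_le]
      constructor <;> linarith
    have h6 := h2 p
    have h7 := mul_le_mul_of_nonneg_left h5 hL.le
    nlinarith
  set e : E × ℝ := (w, 1) with he
  -- integrated inequality
  have hint : ∀ s : ℝ, 0 < s → s * ‖e‖ < ρ / 2 →
      a - κ ≤ Real.exp (-(L * s)) * (ψ (q - s • e) - ψ q + a - κ) := by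
    intro s hs hsρ
    by_contra! hcon
    obtain ⟨m, hm1, hm2⟩ := exists_between hcon
    have hqs : q - s • e ∈ Metric.ball q ρ := by
      rw [mem_ball_iff_norm, sub_sub_cancel_left, norm_neg, norm_smul, Real.norm_of_nonneg hs.le]
      linarith
    have hc : ContinuousAt
        (fun x => Real.exp (-(L * s)) * (ψ (x - s • e) - ψ q + a - κ)) q := by
      have h1 : ContinuousAt (fun x => ψ (x - s • e)) q :=
        ContinuousAt.comp (f := fun x => x - s • e) (hball _ hqs).2.2.2.2 (by fun_prop)
      exact continuousAt_const.mul (((h1.sub continuousAt_const).add continuousAt_const).sub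
        continuousAt_const)
    have e1 := hc.eventually_lt (continuousAt_const (y := m)) hm1
    -- Transport ends at a point `x` near `q` where `f` nearly attains its envelope. At the starting
    -- point `x - s • e` the bound `f ≤ upperEnv f` and the touching from above by `ψ` apply.
    have e2 := frequently_lt_of_lt_upperEnv hR (show m + κ < HJ.upperEnv f q by linarith)
    have e3 := Metric.ball_mem_nhds q (half_pos hρ)
    obtain ⟨x, hx2, hx1, hx3⟩ := (e2.and_eventually (e1.and e3)).exists
    have hseg : ∀ τ ∈ Icc (x.2 - s) (x.2 - s + s),
        (x.1 - s • w + (τ - (x.2 - s)) • w, τ) ∈ Metric.ball q ρ := by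
      intro τ hτ
      have h1 : (x.1 - s • w + (τ - (x.2 - s)) • w, τ) = x + (τ - x.2) • e := by
        ext1
        · simp only [he, Prod.fst_add, Prod.smul_fst]; module
        · simp [he]
      rw [h1, mem_ball_iff_norm]
      have h2 : |τ - x.2| ≤ s := by rw [abs_le]; constructor <;> linarith [hτ.1, hτ.2]
      calc ‖x + (τ - x.2) • e - q‖ = ‖(x - q) + (τ - x.2) • e‖ := by congr 1; abel
        _ ≤ ‖x - q‖ + ‖(τ - x.2) • e‖ := norm_add_le _ _
        _ ≤ ‖x - q‖ + s * ‖e‖ := by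
          rw [norm_smul, Real.norm_eq_abs]; gcongr
        _ < ρ := by rw [dist_eq_norm] at hx3; linarith
    have h1 := hf.transport hlsc Metric.isOpen_ball (fun x hx => (hball x hx).1) htrans hs hseg
    have h2 : (x.1 - s • w, x.2 - s) = x - s • e := by
      ext1 <;> simp [he]
    rw [h2, sub_add_cancel, sub_add_cancel] at h1
    have h3 : x - s • e ∈ Metric.ball q ρ := by
      have := hseg (x.2 - s) ⟨le_rfl, by linarith⟩
      simpa [h2] using this
    have h4 := (hball _ h3).2.2.2.1
    have h5 := le_upperEnv hR (x - s • e)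
    have h6 := mul_le_mul_of_nonneg_left
      (show f (x - s • e) - κ ≤ ψ (x - s • e) - ψ q + a - κ by linarith)
      (Real.exp_pos (-(L * s))).le
    have h7 : f x = f (x.1, x.2) := rfl
    linarith
  -- differentiate at `0`
  have hder : HasDerivAt (fun s : ℝ => Real.exp (-(L * s)) * (ψ (q - s • e) - ψ q + a - κ))
      (-L * (a - κ) + -(fderiv ℝ ψ q e)) 0 := by
    have h1 : HasDerivAt (fun s : ℝ => Real.exp (-(L * s))) (-L) 0 := by
      have : HasDerivAt (fun s : ℝ => -(L * s)) (-L) 0 := by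
        simpa using ((hasDerivAt_id (0 : ℝ)).const_mul L).fun_neg
      simpa using this.exp
    have hline : HasDerivAt (fun r : ℝ => q - r • e) (-e) 0 := by
      simpa using ((hasDerivAt_id (0 : ℝ)).smul_const e).const_sub q
    have hψf : HasFDerivAt ψ (fderiv ℝ ψ q) (q - (0 : ℝ) • e) := by
      simpa using (hψ.differentiableAt (by norm_num)).hasFDerivAt
    have h2 := hψf.comp_hasDerivAt (0 : ℝ) hline
    have h3 := h1.mul (((h2.sub_const (ψ q)).add_const a).sub_const κ)
    convert! h3 using 1
    simp
  -- The integrated inequality is an equality at `s = 0`, so its right derivative there is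
  -- nonnegative; this is the desired inequality up to `ε`.
  have hpos := HasDerivAt.nonneg_of_right_min hder (by
    have h2 : Tendsto (fun s : ℝ => s * ‖e‖) (𝓝[>] 0) (𝓝 0) := by
      have : Tendsto (fun s : ℝ => s * ‖e‖) (𝓝 0) (𝓝 (0 * ‖e‖)) := tendsto_id.mul_const _
      rw [zero_mul] at this
      exact this.mono_left nhdsWithin_le_nhds
    filter_upwards [self_mem_nhdsWithin, h2.eventually_lt_const (half_pos hρ)] with s h3 h4
    have := hint s h3 h4
    simpa using this)
  have h3 : fderiv ℝ ψ q e = fderiv ℝ ψ q (0, 1) + p₀ w := by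
    rw [hp₀, ContinuousLinearMap.comp_apply, ← map_add]
    simp [he]
  have h4 : L * ε' = ε / 4 := by rw [hε']; field_simp
  rw [h3] at hpos
  nlinarith

/-- Domain of dependence: subsolutions do not increase, up to a linear term, along slow lines. -/
lemma SubBelow.spread (hG : LocalHam G Ω L) {T₁ : ℝ} {z₀ : E} (hz₀ : z₀ ∈ Ω)
    (hf : SubBelow G (Ω ×ˢ Ioo 0 T₁) f) (hlsc : LowerSemicontinuousOn f (Ω ×ˢ Ioo 0 T₁)) {R : ℝ}
    (hR : ∀ q, |f q| ≤ R) :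
    ∃ α > 0, ∃ C, 0 ≤ C ∧ ∃ ρ > 0, ∀ z ∈ Metric.ball z₀ ρ, ∀ z' ∈ Metric.ball z₀ ρ,
      ∀ t t' : ℝ, 0 < t → t < t' → t' < T₁ → ‖z' - z‖ ≤ α * (t' - t) →
        f (z', t') ≤ f (z, t) + C * (t' - t) := by
  obtain ⟨α, hα, C₀, hC₀, hlin⟩ := hG.linear_lower_bound hz₀ R
  have hL := hG.pos
  obtain ⟨ρ, hρ, hball⟩ := Metric.eventually_nhds_iff_ball.1
    (hlin.and (hG.isOpen.mem_nhds hz₀))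
  have hR0 : 0 ≤ R := (abs_nonneg _).trans (hR (z₀, 0))
  refine ⟨α, hα, 2 * L * R + C₀, by positivity, ρ, hρ, fun z hz z' hz' t t' ht htt' ht' hzz => ?_⟩
  set s := t' - t with hs
  have hs0 : 0 < s := by simpa [hs] using htt'
  set w := s⁻¹ • (z' - z) with hw
  have hwα : ‖w‖ ≤ α := by
    rw [hw, norm_smul, norm_inv, Real.norm_of_nonneg hs0.le, inv_mul_le_iff₀ hs0]
    linarith [mul_comm α s]
  have hsw : z + s • w = z' := by
    rw [hw, smul_smul, mul_inv_cancel₀ hs0.ne', one_smul]; abel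
  -- As `f ≤ R`, this makes `L * (f - κ) ≤ -C₀`; with `‖w‖ ≤ α` the linear lower bound of `G` then
  -- gives the transport inequality for every slow velocity.
  set κ := R + C₀ / L with hκ
  have hLκ : L * κ = L * R + C₀ := by rw [hκ]; field_simp
  have h := hf.transport (L := L) hlsc (V := Metric.ball z₀ ρ ×ˢ Ioo 0 T₁)
    (Metric.isOpen_ball.prod isOpen_Ioo) (prod_mono_left fun x hx => (hball x hx).2)
    (w := w) (κ := κ) ?_ (z := z) (t := t) hs0 ?_
  · rw [hsw, hs, add_sub_cancel] at h
    have h1 := Real.add_one_le_exp (-(L * s))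
    have h2 := (abs_le.1 (hR (z, t))).1
    have h3 := (abs_le.1 (hR (z, t))).2
    have h4 : f (z, t) - κ ≤ 0 := by
      have : 0 ≤ C₀ / L := by positivity
      linarith
    have h5 := mul_le_mul_of_nonpos_right h1 h4
    have h6 : L * (κ - f (z, t)) ≤ 2 * L * R + C₀ := by nlinarith
    have h7 := mul_le_mul_of_nonneg_left h6 hs0.le
    nlinarith
  · intro q hq p
    have h1 := (hball q.1 hq.1).1 p (f q) (hR q)
    have h2 : p w ≤ α * ‖p‖ := by
      calc p w ≤ ‖p w‖ := le_abs_self _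
        _ ≤ ‖p‖ * ‖w‖ := p.le_opNorm w
        _ ≤ α * ‖p‖ := by rw [mul_comm]; gcongr
    have h3 := mul_le_mul_of_nonneg_left ((abs_le.1 (hR q)).2) hL.le
    nlinarith
  · intro τ hτ
    rw [hs, add_sub_cancel] at hτ
    refine ⟨?_, by linarith [hτ.1], by linarith [hτ.2]⟩
    have h1 := (convex_ball z₀ ρ).add_smul_sub_mem hz hz' (t := (τ - t) / s)
      ⟨div_nonneg (by linarith [hτ.1]) hs0.le, (div_le_one hs0).2 (by linarith [hτ.2])⟩
    have h2 : (τ - t) • w = ((τ - t) / s) • (z' - z) := by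
      rw [hw, smul_smul, div_eq_mul_inv]
    simpa [h2] using h1

end FromBelowToAbove

end HJ

namespace HJ

/-! ### Doubling of the space variable -/

section Doubling

set_option linter.unusedSectionVars false

/-- A large multiple of a nonnegative penalty makes a function small on a compact set, as soon as
it is small where the penalty vanishes. -/
lemma exists_penalty {X : Type*} [TopologicalSpace X] {S : Set X} (hS : IsCompact S) {Ξ pen : X → ℝ}
    (hΞ : UpperSemicontinuousOn Ξ S) (hpen : ContinuousOn pen S) (h0 : ∀ x ∈ S, 0 ≤ pen x) {m : ℝ}
    (h : ∀ x ∈ S, pen x = 0 → Ξ x < m) :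
    ∃ N₀ : ℝ, 0 ≤ N₀ ∧ ∀ N, N₀ ≤ N → ∀ x ∈ S, Ξ x - N * pen x < m := by
  suffices H : ∃ N₀ : ℝ, 0 ≤ N₀ ∧ ∀ N, N₀ ≤ N → ∀ x ∈ S, x ∈ S → Ξ x - N * pen x < m by
    obtain ⟨N₀, h1, h2⟩ := H
    exact ⟨N₀, h1, fun N hN x hx => h2 N hN x hx hx⟩
  refine hS.induction_on (p := fun s => ∃ N₀ : ℝ, 0 ≤ N₀ ∧ ∀ N, N₀ ≤ N → ∀ x ∈ s, x ∈ S →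
    Ξ x - N * pen x < m) ⟨0, le_rfl, by simp⟩ ?_ ?_ ?_
  · rintro s t hst ⟨N, h1, h2⟩
    exact ⟨N, h1, fun N' hN' x hx => h2 N' hN' x (hst hx)⟩
  · rintro s t ⟨N, h1, h2⟩ ⟨N', h1', h2'⟩
    refine ⟨max N N', le_max_of_le_left h1, fun K hK x hx hxS => ?_⟩
    rcases hx with hx | hx
    · exact h2 K ((le_max_left _ _).trans hK) x hx hxS
    · exact h2' K ((le_max_right _ _).trans hK) x hx hxS
  · intro x hx
    rcases (h0 x hx).eq_or_lt with hp | hp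
    · refine ⟨{y | Ξ y < m}, hΞ x hx m (h x hx hp.symm), 0, le_rfl, fun N hN y hy hyS => ?_⟩
      have := mul_nonneg hN (h0 y hyS)
      have hy' : Ξ y < m := hy
      linarith
    · have e1 := hΞ x hx (Ξ x + 1) (by linarith)
      have e2 : ∀ᶠ y in 𝓝[S] x, pen x / 2 < pen y :=
        (hpen x hx).eventually_const_lt (by linarith)
      refine ⟨_, e1.and e2, |Ξ x + 1 - m| / (pen x / 2), by positivity, fun N hN y hy _ => ?_⟩
      obtain ⟨h1, h2⟩ := hy
      rw [div_le_iff₀ (by positivity)] at hN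
      have h3 : 0 ≤ N := by
        by_contra! hneg
        have := mul_neg_of_neg_of_pos hneg (half_pos hp)
        linarith [abs_nonneg (Ξ x + 1 - m)]
      have h4 := mul_le_mul_of_nonneg_left h2.le h3
      have h5 := le_abs_self (Ξ x + 1 - m)
      have h1' : Ξ y < Ξ x + 1 := h1
      linarith

variable {E : Type*} [NormedAddCommGroup E] [InnerProductSpace ℝ E] [FiniteDimensional ℝ E]
variable {G : E → (E →L[ℝ] ℝ) → ℝ → ℝ} {Ω : Set E} {L : ℝ}

lemma fderiv_separated {A : E → ℝ} {B : ℝ → ℝ} {A' : E →L[ℝ] ℝ} {b : ℝ} {q : E × ℝ}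
    (hA : HasFDerivAt A A' q.1) (hB : HasDerivAt B b q.2) :
    fderiv ℝ (fun x : E × ℝ => A x.1 + B x.2) q (0, 1) = b ∧
      (fderiv ℝ (fun x : E × ℝ => A x.1 + B x.2) q).comp (.inl ℝ E ℝ) = A' := by
  have h1 : HasFDerivAt (fun x : E × ℝ => A x.1) (A'.comp (.fst ℝ E ℝ)) q :=
    hA.comp q hasFDerivAt_fst
  have h2 : HasFDerivAt (fun x : E × ℝ => B x.2)
      ((ContinuousLinearMap.toSpanSingleton ℝ b).comp (.snd ℝ E ℝ)) q :=
    hB.hasFDerivAt.comp q hasFDerivAt_snd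
  rw [(h1.fun_add h2).fderiv]
  refine ⟨by simp, ?_⟩
  ext v
  simp

lemma hasFDerivAt_norm_sub_sq (z y : E) :
    HasFDerivAt (fun x : E => ‖x - y‖ ^ 2) (2 • innerSL ℝ (z - y)) z := by
  have := ((hasFDerivAt_id z).sub_const y).norm_sq
  simpa using this

lemma hasDerivAt_sub_sq (t s : ℝ) : HasDerivAt (fun r : ℝ => (r - s) ^ 2) (2 * (t - s)) t := by
  have := ((hasDerivAt_id t).sub_const s).fun_pow 2
  simpa using this

/-- Uniform continuity of the Hamiltonian in the space variable, for bounded momenta. -/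
lemma LocalHam.eventually_sub_lt (hG : LocalHam G Ω L) {z₀ : E} (hz₀ : z₀ ∈ Ω) (K R : ℝ) {γ : ℝ}
    (hγ : 0 < γ) : ∀ᶠ x : E × E × (E →L[ℝ] ℝ) in 𝓝 (z₀, z₀, 0), ∀ p r, ‖p‖ ≤ K → |r| ≤ R →
      G x.2.1 (p - x.2.2) r - G x.1 p r < γ := by
  have hc : IsCompact (Metric.closedBall (0 : E →L[ℝ] ℝ) K ×ˢ Icc (-R) R) :=
    (isCompact_closedBall _ _).prod isCompact_Icc
  have := hc.eventually_forall_of_forall_eventually (x₀ := (z₀, z₀, (0 : E →L[ℝ] ℝ)))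
    (P := fun x a => G x.2.1 (a.1 - x.2.2) a.2 - G x.1 a.1 a.2 < γ) ?_
  · filter_upwards [this] with x hx p r hp hr
    exact hx (p, r) ⟨by simpa using hp, abs_le.1 hr⟩
  · rintro ⟨p, r⟩ -
    have h1 : ContinuousAt (fun a : (E × E × (E →L[ℝ] ℝ)) × (E →L[ℝ] ℝ) × ℝ =>
        G a.1.2.1 (a.2.1 - a.1.2.2) a.2.2) ((z₀, z₀, 0), (p, r)) :=
      hG.continuousAt_comp hz₀ (by fun_prop) (by fun_prop) (by fun_prop)
    have h2 : ContinuousAt (fun a : (E × E × (E →L[ℝ] ℝ)) × (E →L[ℝ] ℝ) × ℝ =>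
        G a.1.1 a.2.1 a.2.2) ((z₀, z₀, 0), (p, r)) :=
      hG.continuousAt_comp hz₀ (by fun_prop) (by fun_prop) (by fun_prop)
    exact (h1.sub h2).eventually_lt_const (by simpa using hγ)

set_option maxHeartbeats 2000000 in
/-- Doubling of the space variable: at a maximum point of `U(z,t) - v(z,s) - g(t) - k (t-s)²`, the
derivative of `g` is controlled by the zeroth order gap between `U` and `v`. -/
lemma doubling (hG : LocalHam G Ω L) {D₁ D₂ : Set (E × ℝ)} (hD₁ : IsOpen D₁) (hD₂ : IsOpen D₂)
    (hDΩ : ∀ q ∈ D₁, q.1 ∈ Ω) (hDΩ' : ∀ q ∈ D₂, q.1 ∈ Ω) {U v : E × ℝ → ℝ} (hU : UpperSemicontinuousOn U D₁)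
    (hv : LowerSemicontinuousOn v D₂) (hUs : SubAbove G D₁ U) (hvs : SupBelow G D₂ v)
    {z₀ : E} {t₀ s₀ : ℝ} (h1 : (z₀, t₀) ∈ D₁) (h2 : (z₀, s₀) ∈ D₂) {g : ℝ → ℝ}
    (hg : ContDiffAt ℝ 1 g t₀) (k : ℝ)
    (hmax : ∀ᶠ x : E × ℝ × ℝ in 𝓝 (z₀, t₀, s₀),
      U (x.1, x.2.1) - v (x.1, x.2.2) - g x.2.1 - k * (x.2.1 - x.2.2) ^ 2
        ≤ U (z₀, t₀) - v (z₀, s₀) - g t₀ - k * (t₀ - s₀) ^ 2) :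
    deriv g t₀ ≤ L * |U (z₀, t₀) - v (z₀, s₀)| := by
  have hL := hG.pos
  have hz₀ : z₀ ∈ Ω := hDΩ _ h1
  set a := U (z₀, t₀) with ha
  set b := v (z₀, s₀) with hb
  refine le_of_forall_pos_le_add fun ε hε => ?_
  obtain ⟨γ, hγ0, hγ1, hγε⟩ : ∃ γ > 0, γ ≤ 1 ∧ (4 + 3 * L) * γ ≤ ε := by
    refine ⟨min 1 (ε / (4 + 3 * L)), lt_min one_pos (by positivity), min_le_left _ _, ?_⟩
    have := mul_le_mul_of_nonneg_left (min_le_right 1 (ε / (4 + 3 * L)))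
      (by positivity : 0 ≤ 4 + 3 * L)
    rwa [mul_div_cancel₀ _ (by positivity)] at this
  set R := |deriv g t₀| + 2 * |k * (t₀ - s₀)| + 3 + |a| + |b| with hRdef
  obtain ⟨K, hK, hcoer⟩ := hG.coercive R
  have hg' : ContinuousAt (deriv g) t₀ := by
    have h3 : ContinuousAt (fderiv ℝ g) t₀ := (hg.fderiv_right (m := 0) (by norm_num)).continuousAt
    exact (h3.clm_apply (continuousAt_const (y := (1 : ℝ)))).congr
      (Eventually.of_forall fun x => by simp)
  -- the good neighbourhood
  set c : E × E × ℝ × ℝ := (z₀, z₀, t₀, s₀) with hc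
  have c1 : Tendsto (fun x : E × E × ℝ × ℝ => (x.1, x.2.2.1)) (𝓝 c) (𝓝 (z₀, t₀)) := by
    have : Continuous (fun x : E × E × ℝ × ℝ => (x.1, x.2.2.1)) := by fun_prop
    exact this.tendsto c
  have c2 : Tendsto (fun x : E × E × ℝ × ℝ => (x.2.1, x.2.2.2)) (𝓝 c) (𝓝 (z₀, s₀)) := by
    have : Continuous (fun x : E × E × ℝ × ℝ => (x.2.1, x.2.2.2)) := by fun_prop
    exact this.tendsto c
  have c3 : Tendsto (fun x : E × E × ℝ × ℝ => (x.1, x.2.2.1, x.2.2.2)) (𝓝 c)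
      (𝓝 (z₀, t₀, s₀)) := by
    have : Continuous (fun x : E × E × ℝ × ℝ => (x.1, x.2.2.1, x.2.2.2)) := by fun_prop
    exact this.tendsto c
  have ct : Tendsto (fun x : E × E × ℝ × ℝ => x.2.2.1) (𝓝 c) (𝓝 t₀) := by
    have : Continuous (fun x : E × E × ℝ × ℝ => x.2.2.1) := by fun_prop
    exact this.tendsto c
  have c5 : Tendsto (fun x : E × E × ℝ × ℝ =>
      (x.1, x.2.1, (2 : ℕ) • innerSL ℝ (x.1 - z₀))) (𝓝 c) (𝓝 (z₀, z₀, 0)) := by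
    have : Continuous (fun x : E × E × ℝ × ℝ => (x.1, x.2.1, (2 : ℕ) • innerSL ℝ (x.1 - z₀))) := by
      fun_prop
    simpa [hc] using this.tendsto c
  have g1 : ∀ᶠ x in 𝓝 c, (x.1, x.2.2.1) ∈ D₁ := c1.eventually (hD₁.mem_nhds h1)
  have g2 : ∀ᶠ x in 𝓝 c, (x.2.1, x.2.2.2) ∈ D₂ := c2.eventually (hD₂.mem_nhds h2)
  have g3 : ∀ᶠ x in 𝓝 c, U (x.1, x.2.2.1) < a + γ :=
    c1.eventually (hD₁.nhdsWithin_eq h1 ▸ hU _ h1 (a + γ) (by simpa [ha] using hγ0))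
  have g4 : ∀ᶠ x in 𝓝 c, b - γ < v (x.2.1, x.2.2.2) :=
    c2.eventually (hD₂.nhdsWithin_eq h2 ▸ hv _ h2 (b - γ) (by simpa [hb] using hγ0))
  have g5 : ∀ᶠ x in 𝓝 c, ContDiffAt ℝ 1 g x.2.2.1 := ct.eventually (hg.eventually (by norm_num))
  have g6 : ∀ᶠ x in 𝓝 c, |deriv g x.2.2.1 - deriv g t₀| < γ := by
    have h3 := ((hg'.sub (continuousAt_const (y := deriv g t₀))).abs).eventually_lt_const
      (show |deriv g t₀ - deriv g t₀| < γ by simpa using hγ0)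
    exact ct.eventually h3
  have g7 : ∀ᶠ x : E × E × ℝ × ℝ in 𝓝 c, |g x.2.2.1 + k * (x.2.2.1 - x.2.2.2) ^ 2 - (g t₀ + k * (t₀ - s₀) ^ 2)| < γ := by
    have h3 : ContinuousAt (fun x : E × E × ℝ × ℝ =>
        |g x.2.2.1 + k * (x.2.2.1 - x.2.2.2) ^ 2 - (g t₀ + k * (t₀ - s₀) ^ 2)|) c := by
      have h4 : ContinuousAt (fun x : E × E × ℝ × ℝ => g x.2.2.1) c :=
        ContinuousAt.comp (g := g) (f := fun x : E × E × ℝ × ℝ => x.2.2.1) hg.continuousAt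
          (by fun_prop)
      exact ((h4.add (by fun_prop)).sub continuousAt_const).abs
    exact h3.eventually_lt_const (by simpa [hc] using hγ0)
  have g8 : ∀ᶠ x : E × E × ℝ × ℝ in 𝓝 c, |2 * (x.2.2.1 - t₀)| < γ ∧ |2 * (x.2.2.2 - s₀)| < γ ∧
      |k * (x.2.2.1 - x.2.2.2) - k * (t₀ - s₀)| < γ / 2 := by
    have e1 : Continuous (fun x : E × E × ℝ × ℝ => |2 * (x.2.2.1 - t₀)|) := by fun_prop
    have e2 : Continuous (fun x : E × E × ℝ × ℝ => |2 * (x.2.2.2 - s₀)|) := by fun_prop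
    have e3 : Continuous (fun x : E × E × ℝ × ℝ =>
      |k * (x.2.2.1 - x.2.2.2) - k * (t₀ - s₀)|) := by fun_prop
    exact ((e1.tendsto c).eventually_lt_const (by simpa [hc] using hγ0)).and
      (((e2.tendsto c).eventually_lt_const (by simpa [hc] using hγ0)).and
      ((e3.tendsto c).eventually_lt_const (by simpa [hc] using hγ0)))
  have g9 := c5.eventually (hG.eventually_sub_lt hz₀ K R hγ0)
  obtain ⟨ρ, hρ, hball⟩ := Metric.nhds_basis_closedBall.mem_iff.1
    ((c3.eventually hmax).and (g1.and (g2.and (g3.and (g4.and (g5.and (g6.and (g7.and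
      (g8.and g9)))))))))
  set Q := Metric.closedBall c ρ with hQ
  have hQc : IsCompact Q := isCompact_closedBall _ _
  -- Adding `loc` makes the maximum at `c` strict on the diagonal, so a large multiple of `pen`
  -- keeps the doubled maximum off the sphere around `c`. Its derivatives are small near `c`.
  set loc : E × E × ℝ × ℝ → ℝ := fun x => ‖x.1 - z₀‖ ^ 2 + (x.2.2.1 - t₀) ^ 2 + (x.2.2.2 - s₀) ^ 2
    with hloc
  set Ξ : E × E × ℝ × ℝ → ℝ := fun x => U (x.1, x.2.2.1) - v (x.2.1, x.2.2.2) -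
    (g x.2.2.1 + k * (x.2.2.1 - x.2.2.2) ^ 2 + loc x) with hΞ
  set pen : E × E × ℝ × ℝ → ℝ := fun x => ‖x.1 - x.2.1‖ ^ 2 with hpen
  set m := a - b - (g t₀ + k * (t₀ - s₀) ^ 2) with hm
  have hUc : UpperSemicontinuousOn (fun x : E × E × ℝ × ℝ => U (x.1, x.2.2.1)) Q := by
    intro x hx y hy
    have hx1 := (hball hx).2.1
    have : Continuous (fun x : E × E × ℝ × ℝ => (x.1, x.2.2.1)) := by fun_prop
    exact mem_nhdsWithin_of_mem_nhds
      (this.tendsto x (hD₁.nhdsWithin_eq hx1 ▸ hU _ hx1 y hy))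
  have hvc : LowerSemicontinuousOn (fun x : E × E × ℝ × ℝ => v (x.2.1, x.2.2.2)) Q := by
    intro x hx y hy
    have hx1 := (hball hx).2.2.1
    have : Continuous (fun x : E × E × ℝ × ℝ => (x.2.1, x.2.2.2)) := by fun_prop
    exact mem_nhdsWithin_of_mem_nhds
      (this.tendsto x (hD₂.nhdsWithin_eq hx1 ▸ hv _ hx1 y hy))
  have hgc : ContinuousOn (fun x : E × E × ℝ × ℝ =>
      g x.2.2.1 + k * (x.2.2.1 - x.2.2.2) ^ 2 + loc x) Q := by
    intro x hx
    have h4 : ContinuousAt (fun x : E × E × ℝ × ℝ => g x.2.2.1) x :=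
      ContinuousAt.comp (g := g) (f := fun x : E × E × ℝ × ℝ => x.2.2.1)
        (hball hx).2.2.2.2.2.1.continuousAt (by fun_prop)
    exact ((h4.add (by fun_prop)).add (by fun_prop)).continuousWithinAt
  have hneg : UpperSemicontinuousOn (fun x : E × E × ℝ × ℝ => -v (x.2.1, x.2.2.2)) Q := by
    intro x hx y hy
    filter_upwards [hvc x hx (-y) (by linarith)] with x' hx'
    have : -y < v (x'.2.1, x'.2.2.2) := hx'
    linarith
  have hΞc : UpperSemicontinuousOn Ξ Q := by
    have := (hUc.add hneg).add hgc.neg.upperSemicontinuousOn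
    simpa [hΞ, sub_eq_add_neg] using this
  have hpenc : ContinuousOn pen Q := Continuous.continuousOn (by fun_prop)
  have hsph : IsCompact (Metric.sphere c ρ) := isCompact_sphere _ _
  have hsphQ : Metric.sphere c ρ ⊆ Q := Metric.sphere_subset_closedBall
  obtain ⟨N, hN0, hN⟩ := exists_penalty hsph (hΞc.mono hsphQ) (hpenc.mono hsphQ)
    (fun x _ => by positivity) (m := m) (by
      intro x hx hx0
      have hxy : x.1 = x.2.1 := by
        have : ‖x.1 - x.2.1‖ = 0 := by simpa [hpen] using hx0
        exact sub_eq_zero.1 (norm_eq_zero.1 this)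
      have h3 := (hball (hsphQ hx)).1
      have hlocpos : 0 < loc x := by
        have h0 : 0 ≤ loc x := by positivity
        refine lt_of_le_of_ne h0 fun h0' => ?_
        have e1 : ‖x.1 - z₀‖ ^ 2 = 0 := by
          nlinarith [sq_nonneg ‖x.1 - z₀‖, sq_nonneg (x.2.2.1 - t₀), sq_nonneg (x.2.2.2 - s₀)]
        have e2 : (x.2.2.1 - t₀) ^ 2 = 0 := by
          nlinarith [sq_nonneg ‖x.1 - z₀‖, sq_nonneg (x.2.2.1 - t₀), sq_nonneg (x.2.2.2 - s₀)]
        have e3 : (x.2.2.2 - s₀) ^ 2 = 0 := by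
          nlinarith [sq_nonneg ‖x.1 - z₀‖, sq_nonneg (x.2.2.1 - t₀), sq_nonneg (x.2.2.2 - s₀)]
        have e1' : x.1 = z₀ := sub_eq_zero.1 (norm_eq_zero.1 (pow_eq_zero_iff two_ne_zero |>.1 e1))
        have e2' := sub_eq_zero.1 (pow_eq_zero_iff two_ne_zero |>.1 e2)
        have e3' := sub_eq_zero.1 (pow_eq_zero_iff two_ne_zero |>.1 e3)
        have : x = c := by
          ext1
          · exact e1'
          · ext1
            · exact hxy ▸ e1'
            · ext1
              · exact e2'
              · exact e3'
        rw [this] at hx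
        simp at hx
        exact hρ.ne hx
      simp only [hΞ, hm]
      rw [← hxy]
      linarith)
  have hcQ : c ∈ Q := Metric.mem_closedBall_self hρ.le
  have hΦc : UpperSemicontinuousOn (fun x => Ξ x - N * pen x) Q := by
    have := hΞc.add (continuousOn_const.mul hpenc : ContinuousOn (fun x => N * pen x) Q).neg.upperSemicontinuousOn
    simpa [sub_eq_add_neg] using this
  obtain ⟨x, hxQ, hx⟩ := hΦc.exists_isMaxOn ⟨c, hcQ⟩ hQc
  have hval : m ≤ Ξ x - N * pen x := by
    have := hx hcQ
    simpa [hΞ, hpen, hloc, hc, hm] using this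
  have hxball : x ∈ Metric.ball c ρ := by
    rw [Metric.mem_ball]
    refine lt_of_le_of_ne hxQ fun hd => ?_
    have := hN N le_rfl x hd
    linarith
  have hnear : ∀ᶠ y in 𝓝 x, Ξ y - N * pen y ≤ Ξ x - N * pen x := by
    filter_upwards [Metric.isOpen_ball.mem_nhds hxball] with y hy
    exact hx (Metric.ball_subset_closedBall hy)
  obtain ⟨-, m1, m2, m3, m4, m5, m6, m7, ⟨m8, m9, m10⟩, m11⟩ := hball hxQ
  obtain ⟨z, y, t, s⟩ := x
  simp only at m1 m2 m3 m4 m5 m6 m7 m8 m9 m10 m11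
  set p : E →L[ℝ] ℝ := (2 * N) • innerSL ℝ (z - y) with hp
  set e : E →L[ℝ] ℝ := (2 : ℕ) • innerSL ℝ (z - z₀) with he
  -- test function for `U`
  have sub : deriv g t + 2 * (k * (t - s)) + 2 * (t - t₀) + G z (p + e) (U (z, t)) ≤ 0 := by
    have hA : HasFDerivAt (fun x : E => N * ‖x - y‖ ^ 2 + ‖x - z₀‖ ^ 2) (p + e) z := by
      have := ((hasFDerivAt_norm_sub_sq z y).const_mul N).add (hasFDerivAt_norm_sub_sq z z₀)
      convert! this using 1
      rw [hp, he]
      congr 1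
      ext v
      simp
      ring
    have hB : HasDerivAt (fun r : ℝ => g r + k * (r - s) ^ 2 + (r - t₀) ^ 2)
        (deriv g t + 2 * (k * (t - s)) + 2 * (t - t₀)) t := by
      have := ((m5.differentiableAt (by norm_num)).hasDerivAt.add
        ((hasDerivAt_sub_sq t s).const_mul k)).add (hasDerivAt_sub_sq t t₀)
      convert! this using 1
      ring
    obtain ⟨d1, d2⟩ := fderiv_separated (q := (z, t)) hA hB
    have h3 := hUs (z, t) m1 (fun x => (N * ‖x.1 - y‖ ^ 2 + ‖x.1 - z₀‖ ^ 2) +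
      (g x.2 + k * (x.2 - s) ^ 2 + (x.2 - t₀) ^ 2)) ?_ ?_
    · rw [d1, d2] at h3
      exact h3
    · have hgx : ContDiffAt ℝ 1 (fun x : E × ℝ => g x.2) (z, t) :=
        ContDiffAt.comp (g := g) (f := fun x : E × ℝ => x.2) (z, t) m5 contDiffAt_snd
      refine ContDiffAt.add (ContDiffAt.add ?_ ?_) ((hgx.add (by fun_prop)).add (by fun_prop))
      · exact contDiffAt_const.mul (ContDiffAt.norm_sq ℝ (by fun_prop))
      · exact ContDiffAt.norm_sq ℝ (by fun_prop)
    · have hcont : Tendsto (fun q : E × ℝ => (q.1, y, q.2, s)) (𝓝 (z, t)) (𝓝 (z, y, t, s)) := by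
        have : Continuous (fun q : E × ℝ => (q.1, y, q.2, s)) := by fun_prop
        exact this.tendsto (z, t)
      filter_upwards [hcont.eventually hnear] with q hq
      simp only [hΞ, hloc, hpen] at hq
      linarith
  -- test function for `v`
  have sup : 0 ≤ 2 * (k * (t - s)) - 2 * (s - s₀) + G y p (v (y, s)) := by
    have hA : HasFDerivAt (fun x : E => (-N) * ‖x - z‖ ^ 2) p y := by
      have := (hasFDerivAt_norm_sub_sq y z).const_mul (-N)
      convert! this using 1
      rw [hp]
      ext v
      simp
      ring
    have hB : HasDerivAt (fun r : ℝ => (-k) * (r - t) ^ 2 + (-1) * (r - s₀) ^ 2)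
        (2 * (k * (t - s)) - 2 * (s - s₀)) s := by
      have := ((hasDerivAt_sub_sq s t).const_mul (-k)).add ((hasDerivAt_sub_sq s s₀).const_mul (-1))
      convert! this using 1
      ring
    obtain ⟨d1, d2⟩ := fderiv_separated (q := (y, s)) hA hB
    have h3 := hvs (y, s) m2 (fun x => ((-N) * ‖x.1 - z‖ ^ 2) +
      ((-k) * (x.2 - t) ^ 2 + (-1) * (x.2 - s₀) ^ 2)) ?_ ?_
    · rw [d1, d2] at h3
      exact h3
    · refine ContDiffAt.add ?_ (by fun_prop)
      exact contDiffAt_const.mul (ContDiffAt.norm_sq ℝ (by fun_prop))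
    · have hcont : Tendsto (fun q : E × ℝ => (z, q.1, t, q.2)) (𝓝 (y, s)) (𝓝 (z, y, t, s)) := by
        have : Continuous (fun q : E × ℝ => (z, q.1, t, q.2)) := by fun_prop
        exact this.tendsto (y, s)
      filter_upwards [hcont.eventually hnear] with q hq
      simp only [hΞ, hloc, hpen] at hq
      rw [norm_sub_rev z q.1, norm_sub_rev z y] at hq
      have e1 : (t - q.2) ^ 2 = (q.2 - t) ^ 2 := by ring
      have e2 : (t - s) ^ 2 = (s - t) ^ 2 := by ring
      rw [e1, e2] at hq
      linarith
  -- zeroth order information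
  have hlocx : 0 ≤ loc (z, y, t, s) := by positivity
  have hpenx : 0 ≤ N * pen (z, y, t, s) := by positivity
  have hgap : a - b - γ < U (z, t) - v (y, s) := by
    simp only [hΞ, hm] at hval
    have := (abs_lt.1 m7).1
    linarith
  have hUb : |U (z, t)| ≤ R := by
    have f1 := neg_abs_le a
    have f2 := le_abs_self a
    have f3 := abs_nonneg b
    have f4 := abs_nonneg (deriv g t₀)
    have f5 := abs_nonneg (k * (t₀ - s₀))
    rw [abs_le]
    constructor <;> linarith
  have f6 := abs_lt.1 m6
  have f8 := abs_lt.1 m8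
  have f9 := abs_lt.1 m9
  have f10 := abs_lt.1 m10
  -- Coercivity in the subsolution inequality bounds the momentum independently of `N`, so uniform
  -- continuity of `G` on bounded momenta replaces any modulus condition in `x`.
  have hpK : ‖p + e‖ ≤ K := by
    by_contra! hlt
    have h3 := hcoer z (hDΩ _ m1) (p + e) (U (z, t)) hUb hlt.le
    have f1 := neg_abs_le (deriv g t₀)
    have f2 := neg_abs_le (k * (t₀ - s₀))
    have f3 := abs_nonneg a
    have f4 := abs_nonneg b
    linarith
  -- When `sub` and `sup` are subtracted, the terms in `k` cancel. What remains is the difference of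
  -- the Hamiltonians, estimated by continuity at equal values and then by the Lipschitz condition.
  have hclose := m11 (p + e) (U (z, t)) hpK hUb
  rw [add_sub_cancel_right] at hclose
  have h3 := hG.lip y (hDΩ' _ m2) p (v (y, s)) (U (z, t))
  have h4 : |v (y, s) - U (z, t)| ≤ |a - b| + 3 * γ := by
    have f1 := neg_abs_le (a - b)
    have f2 := le_abs_self (a - b)
    rw [abs_le]
    constructor <;> linarith
  have h5 := (le_abs_self _).trans (h3.trans (mul_le_mul_of_nonneg_left h4 hL.le))
  nlinarith

end Doubling

end HJ

namespace HJ

/-! ### Lower relaxed limits and stability of supersolutions -/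

section Stability

set_option linter.unusedSectionVars false

/-- The lower relaxed limit of a family of functions along a filter. -/
noncomputable def lowerLim {X ι : Type*} [TopologicalSpace X] (l : Filter ι) (F : ι → X → ℝ)
    (x : X) : ℝ :=
  liminf (fun p : ι × X => F p.1 p.2) (l ×ˢ 𝓝 x)

section

variable {X ι : Type*} [TopologicalSpace X] {l : Filter ι} {F : ι → X → ℝ} {R : ℝ}

lemma isBoundedUnder_ge_of_abs_le (hF : ∀ i x, |F i x| ≤ R) (m : Filter (ι × X)) :
    IsBoundedUnder (· ≥ ·) m (fun p : ι × X => F p.1 p.2) :=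
  isBoundedUnder_of ⟨-R, fun p => (abs_le.1 (hF p.1 p.2)).1⟩

lemma isCoboundedUnder_ge_of_abs_le (hF : ∀ i x, |F i x| ≤ R) (m : Filter (ι × X)) [m.NeBot] :
    IsCoboundedUnder (· ≥ ·) m (fun p : ι × X => F p.1 p.2) :=
  (isBoundedUnder_of ⟨R, fun p => (abs_le.1 (hF p.1 p.2)).2⟩ :
    IsBoundedUnder (· ≤ ·) m (fun p : ι × X => F p.1 p.2)).isCoboundedUnder_ge

lemma eventually_lt_of_lt_lowerLim (hF : ∀ i x, |F i x| ≤ R) {x : X} {c : ℝ}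
    (h : c < lowerLim l F x) : ∀ᶠ p in l ×ˢ 𝓝 x, c < F p.1 p.2 :=
  eventually_lt_of_lt_liminf h (isBoundedUnder_ge_of_abs_le hF _)

variable [l.NeBot]

lemma frequently_lt_of_lowerLim_lt (hF : ∀ i x, |F i x| ≤ R) {x : X} {c : ℝ}
    (h : lowerLim l F x < c) : ∃ᶠ p in l ×ˢ 𝓝 x, F p.1 p.2 < c :=
  frequently_lt_of_liminf_lt (isCoboundedUnder_ge_of_abs_le hF _) h

lemma le_lowerLim (hF : ∀ i x, |F i x| ≤ R) {x : X} {c : ℝ}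
    (h : ∀ᶠ p in l ×ˢ 𝓝 x, c ≤ F p.1 p.2) : c ≤ lowerLim l F x :=
  le_liminf_of_le (isCoboundedUnder_ge_of_abs_le hF _) h

lemma abs_lowerLim_le (hF : ∀ i x, |F i x| ≤ R) (x : X) : |lowerLim l F x| ≤ R := by
  refine abs_le.2 ⟨le_lowerLim hF (Eventually.of_forall fun p => (abs_le.1 (hF p.1 p.2)).1), ?_⟩
  by_contra! h
  obtain ⟨p, hp⟩ := (eventually_lt_of_lt_lowerLim hF h).exists
  linarith [(abs_le.1 (hF p.1 p.2)).2]

lemma lowerSemicontinuous_lowerLim (hF : ∀ i x, |F i x| ≤ R) :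
    LowerSemicontinuous (lowerLim l F) := by
  intro x c hc
  obtain ⟨c', h1, h2⟩ := exists_between hc
  obtain ⟨p, hp, q, hq, hpq⟩ := eventually_prod_iff.1 (eventually_lt_of_lt_lowerLim hF h2)
  filter_upwards [hq.eventually_nhds] with y hy
  exact h1.trans_le (le_lowerLim hF (eventually_prod_iff.2
    ⟨p, hp, q, hy, fun {a} ha {b} hb => (hpq ha hb).le⟩))

end

variable {E : Type*} [NormedAddCommGroup E] [InnerProductSpace ℝ E] [FiniteDimensional ℝ E]
variable {G : E → (E →L[ℝ] ℝ) → ℝ → ℝ} {Ω : Set E} {L : ℝ} {D : Set (E × ℝ)}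

/-- Supersolutions tested from below are stable under lower relaxed limits. -/
lemma SupBelow.lowerLim {ι : Type*} {l : Filter ι} [l.NeBot] (hG : LocalHam G Ω L)
    (hD : IsOpen D) (hDΩ : ∀ q ∈ D, q.1 ∈ Ω) {F : ι → E × ℝ → ℝ} {R : ℝ}
    (hR : ∀ i q, |F i q| ≤ R) (hF : ∀ i, SupBelow G D (F i))
    (hlsc : ∀ i, LowerSemicontinuousOn (F i) D) : SupBelow G D (lowerLim l F) := by
  intro q₀ hq₀ ψ hψ hmin
  set a := HJ.lowerLim l F q₀ with ha
  by_contra! hneg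
  -- Subtracting a quadratic makes the contact strict without changing the gradient at `q₀`.
  set ψ' : E × ℝ → ℝ := fun q => ψ q - (‖q.1 - q₀.1‖ ^ 2 + (q.2 - q₀.2) ^ 2) with hψ'
  have hψ'C : ContDiffAt ℝ 1 ψ' q₀ := by
    have h1 : ContDiffAt ℝ 1 (fun q : E × ℝ => ‖q.1 - q₀.1‖ ^ 2) q₀ :=
      ContDiffAt.norm_sq ℝ (by fun_prop)
    have h2 : ContDiffAt ℝ 1 (fun q : E × ℝ => (q.2 - q₀.2) ^ 2) q₀ := by fun_prop
    exact hψ.sub (h1.add h2)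
  have hfd : fderiv ℝ ψ' q₀ = fderiv ℝ ψ q₀ := by
    have h1 : HasFDerivAt (fun q : E × ℝ => ‖q.1 - q₀.1‖ ^ 2 + (q.2 - q₀.2) ^ 2)
        (0 : E × ℝ →L[ℝ] ℝ) q₀ := by
      have h2 : HasFDerivAt (fun q : E × ℝ => ‖q.1 - q₀.1‖ ^ 2)
          ((2 • innerSL ℝ (q₀.1 - q₀.1) : E →L[ℝ] ℝ).comp (.fst ℝ E ℝ)) q₀ :=
        (hasFDerivAt_norm_sub_sq q₀.1 q₀.1).comp q₀ hasFDerivAt_fst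
      have h3 : HasFDerivAt (fun q : E × ℝ => (q.2 - q₀.2) ^ 2)
          ((ContinuousLinearMap.toSpanSingleton ℝ (2 * (q₀.2 - q₀.2))).comp (.snd ℝ E ℝ)) q₀ :=
        (hasDerivAt_sub_sq q₀.2 q₀.2).hasFDerivAt.comp q₀ hasFDerivAt_snd
      have h4 := h2.fun_add h3
      convert! h4 using 1
      ext <;> simp
    have h5 := (hψ.differentiableAt (by norm_num)).hasFDerivAt.fun_sub h1
    rw [sub_zero] at h5
    exact h5.fderiv
  -- the strict inequality persists nearby
  have hfc : ContinuousAt (fderiv ℝ ψ') q₀ :=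
    (hψ'C.fderiv_right (m := 0) (by norm_num)).continuousAt
  have hcont : ContinuousAt (fun x : (E × ℝ) × ℝ => fderiv ℝ ψ' x.1 (0, 1) +
      G x.1.1 ((fderiv ℝ ψ' x.1).comp (.inl ℝ E ℝ)) x.2) (q₀, a) := by
    have h1 : ContinuousAt (fun x : (E × ℝ) × ℝ => fderiv ℝ ψ' x.1) (q₀, a) :=
      ContinuousAt.comp (g := fderiv ℝ ψ') (f := fun x : (E × ℝ) × ℝ => x.1) hfc continuousAt_fst
    exact (h1.clm_apply continuousAt_const).add
      (hG.continuousAt_comp (hDΩ _ hq₀) (by fun_prop) (h1.clm_comp continuousAt_const)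
        continuousAt_snd)
  have hev := hcont.eventually_lt_const (u := 0) (by simpa only [hfd] using hneg)
  obtain ⟨η, hη, hηball⟩ := Metric.eventually_nhds_iff.1 hev
  -- This bounds `F i` from below by `a - η` near `q₀`, uniformly in `i` close to the limit. The
  -- value at the perturbed minimum must be close to `a`, since `G` also depends on that value.
  obtain ⟨p, hp, q, hq, hpq⟩ := eventually_prod_iff.1
    (eventually_lt_of_lt_lowerLim hR (show a - η < HJ.lowerLim l F q₀ by linarith))
  have hψ'q₀ : ψ' q₀ = ψ q₀ := by simp [hψ']
  have hgood : ∀ᶠ x in 𝓝 q₀, x ∈ D ∧ q x ∧ ContDiffAt ℝ 1 ψ' x ∧ |ψ' x - ψ q₀| < η / 2 ∧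
      a - ψ q₀ ≤ HJ.lowerLim l F x - ψ x := by
    have e1 : ∀ᶠ x in 𝓝 q₀, |ψ' x - ψ q₀| < η / 2 :=
      (hψ'C.continuousAt.sub continuousAt_const).abs.eventually_lt_const
        (by simpa [hψ'q₀] using hη)
    filter_upwards [hD.mem_nhds hq₀, hq, hψ'C.eventually (by norm_num), e1, hmin]
      with x h1 h2 h3 h4 h5 using ⟨h1, h2, h3, h4, h5⟩
  obtain ⟨ρ₁, hρ₁, hball₁⟩ := Metric.nhds_basis_closedBall.mem_iff.1 hgood
  set ρ := min ρ₁ (η / 2) with hρdef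
  have hρ : 0 < ρ := lt_min hρ₁ (half_pos hη)
  have hball : ∀ x ∈ Metric.closedBall q₀ ρ, x ∈ D ∧ q x ∧ ContDiffAt ℝ 1 ψ' x ∧
      |ψ' x - ψ q₀| < η / 2 ∧ a - ψ q₀ ≤ HJ.lowerLim l F x - ψ x :=
    fun x hx => hball₁ (Metric.closedBall_subset_closedBall (min_le_left _ _) hx)
  -- on the sphere the family stays above
  have hsphere : ∀ᶠ i in l, ∀ x ∈ Metric.sphere q₀ ρ, a - ψ q₀ + ρ ^ 2 / 2 < F i x - ψ' x := by
    suffices H : ∀ᶠ i in l, ∀ x ∈ Metric.sphere q₀ ρ, x ∈ Metric.sphere q₀ ρ →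
        a - ψ q₀ + ρ ^ 2 / 2 < F i x - ψ' x from H.mono fun i hi x hx => hi x hx hx
    refine (isCompact_sphere q₀ ρ).induction_on (p := fun s => ∀ᶠ i in l, ∀ x ∈ s,
      x ∈ Metric.sphere q₀ ρ → a - ψ q₀ + ρ ^ 2 / 2 < F i x - ψ' x) (by simp)
      (fun s t hst h => h.mono fun i hi x hx => hi x (hst hx))
      (fun s t hs ht => by
        filter_upwards [hs, ht] with i h1 h2 x hx
        exact hx.elim (h1 x) (h2 x)) ?_
    intro x hx
    obtain ⟨-, -, h3, -, h5⟩ := hball x (Metric.sphere_subset_closedBall hx)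
    have hpen : ρ ^ 2 ≤ ‖x.1 - q₀.1‖ ^ 2 + (x.2 - q₀.2) ^ 2 := by
      rw [Metric.mem_sphere, Prod.dist_eq, dist_eq_norm, Real.dist_eq] at hx
      rcases max_cases ‖x.1 - q₀.1‖ |x.2 - q₀.2| with ⟨hm, -⟩ | ⟨hm, -⟩
      · rw [hm] at hx
        rw [← hx]
        nlinarith [sq_nonneg (x.2 - q₀.2)]
      · rw [hm] at hx
        rw [← hx, sq_abs]
        nlinarith [sq_nonneg ‖x.1 - q₀.1‖]
    have hρ2 : 0 < ρ ^ 2 := by positivity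
    have e1 := eventually_lt_of_lt_lowerLim (l := l) hR (x := x)
      (c := HJ.lowerLim l F x - ρ ^ 2 / 4) (by linarith)
    have e2 : ∀ᶠ y in 𝓝 x, ψ' y < ψ' x + ρ ^ 2 / 4 :=
      h3.continuousAt.eventually_lt_const (by linarith)
    obtain ⟨p₁, hp₁, q₁, hq₁, hpq₁⟩ := eventually_prod_iff.1 e1
    refine ⟨{y | q₁ y ∧ ψ' y < ψ' x + ρ ^ 2 / 4}, mem_nhdsWithin_of_mem_nhds (hq₁.and e2), ?_⟩
    filter_upwards [hp₁] with i hi y hy _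
    have h6 := hpq₁ hi hy.1
    have h7 := hy.2
    have h8 : ψ' x = ψ x - (‖x.1 - q₀.1‖ ^ 2 + (x.2 - q₀.2) ^ 2) := rfl
    simp only at h6
    linarith
  -- an index with a small value near the centre
  set ν := min (ρ ^ 2 / 4) (η / 4) with hν
  have hν0 : 0 < ν := lt_min (by positivity) (by positivity)
  have hfreq := frequently_lt_of_lowerLim_lt (l := l) hR (x := q₀) (c := a + ν) (by linarith)
  have hψν : ∀ᶠ x in 𝓝 q₀, ψ q₀ - ν < ψ' x :=
    hψ'C.continuousAt.eventually_const_lt (by linarith)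
  obtain ⟨⟨i, x₁⟩, hlt, ⟨hip, his⟩, hx₁, hx₁'⟩ := (hfreq.and_eventually
    ((hp.and hsphere).prod_mk ((show ∀ᶠ x in 𝓝 q₀, x ∈ Metric.closedBall q₀ ρ from
      Metric.closedBall_mem_nhds q₀ hρ).and hψν))).exists
  simp only at hlt hip his hx₁ hx₁'
  have hsubD : Metric.closedBall q₀ ρ ⊆ D := fun x hx => (hball x hx).1
  have hψ'c : ContinuousOn ψ' (Metric.closedBall q₀ ρ) :=
    fun x hx => (hball x hx).2.2.1.continuousAt.continuousWithinAt
  obtain ⟨x, hx, hxmin⟩ := (lsc_sub_continuous ((hlsc i).mono hsubD) hψ'c).exists_isMinOn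
    ⟨x₁, hx₁⟩ (isCompact_closedBall _ _)
  -- The bound `2 * ν ≤ ρ ^ 2 / 2` puts the minimum off the sphere, and `2 * ν ≤ η / 2` keeps `F i
  -- x` below `a + η`.
  have hval : F i x - ψ' x < a - ψ q₀ + 2 * ν := by
    have : F i x - ψ' x ≤ F i x₁ - ψ' x₁ := hxmin hx₁
    linarith
  have hν1 : ν ≤ ρ ^ 2 / 4 := min_le_left _ _
  have hν2 : ν ≤ η / 4 := min_le_right _ _
  have hxball : x ∈ Metric.ball q₀ ρ := by
    rw [Metric.mem_ball]
    refine lt_of_le_of_ne hx fun hd => ?_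
    have := his x hd
    linarith
  obtain ⟨h1, h2, h3, h4, -⟩ := hball x hx
  have hloc : IsLocalMin (fun y => F i y - ψ' y) x := by
    filter_upwards [Metric.isOpen_ball.mem_nhds hxball] with y hy
    exact hxmin (Metric.ball_subset_closedBall hy)
  have hge := hF i x h1 ψ' h3 hloc
  have hlow := hpq hip h2
  simp only at hlow
  have h4' := abs_lt.1 h4
  have hlt0 := hηball (y := (x, F i x)) (by
    rw [Prod.dist_eq]
    refine max_lt ?_ ?_
    · have : ρ ≤ η / 2 := min_le_right _ _
      rw [Metric.mem_ball] at hxball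
      simp only
      linarith
    · rw [Real.dist_eq, abs_lt]
      simp only
      constructor <;> linarith)
  simp only at hlt0
  linarith

end Stability

end HJ

namespace HJ

/-! ### The Hamiltonian in local charts -/

section Charts

set_option linter.unusedSectionVars false

variable {n : ℕ} {M : Type*} [TopologicalSpace M] [ChartedSpace (EuclideanSpace ℝ (Fin n)) M]
  [IsManifold (𝓡 n) ∞ M]

local notation "𝔼" => EuclideanSpace ℝ (Fin n)

/-- The covector at `x` whose expression in the chart at `x₀` is `p`. -/
noncomputable def chartCovector (x₀ x : M) (p : 𝔼 →L[ℝ] ℝ) : Cotangent n x :=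
  haveI : IsManifold (𝓡 n) 1 M := IsManifold.of_le (n := ∞) (by simp)
  p.comp ((trivializationAt 𝔼 (TangentSpace (𝓡 n)) x₀).continuousLinearMapAt ℝ x)

/-- The Hamiltonian read in the chart at `x₀`. -/
noncomputable def chartHam (H : (x : M) → Cotangent n x → ℝ → ℝ) (x₀ : M) (z : 𝔼)
    (p : 𝔼 →L[ℝ] ℝ) (r : ℝ) : ℝ :=
  H ((extChartAt (𝓡 n) x₀).symm z) (chartCovector x₀ ((extChartAt (𝓡 n) x₀).symm z) p) r

lemma chartCovector_apply (x₀ x : M) (p : 𝔼 →L[ℝ] ℝ) :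
    haveI : IsManifold (𝓡 n) 1 M := IsManifold.of_le (n := ∞) (by simp)
    chartCovector x₀ x p =
      p.comp ((trivializationAt 𝔼 (TangentSpace (𝓡 n)) x₀).continuousLinearMapAt ℝ x) := rfl

/-- The map is the inverse of the local trivialisation of the cotangent bundle, which makes the
chart Hamiltonian continuous. -/
lemma continuousOn_chartCovector (x₀ : M) :
    ContinuousOn (fun q : M × (𝔼 →L[ℝ] ℝ) =>
      (⟨q.1, chartCovector x₀ q.1 q.2⟩ : CotangentBundle n M)) ((chartAt 𝔼 x₀).source ×ˢ univ) := by
  have : IsManifold (𝓡 n) 1 M := IsManifold.of_le (n := ∞) (by simp)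
  set e := trivializationAt (𝔼 →L[ℝ] ℝ)
    (fun x : M => TangentSpace (𝓡 n) x →L[ℝ] Bundle.Trivial M ℝ x) x₀ with he
  have hb : e.baseSet = (chartAt 𝔼 x₀).source := by
    simp [he, hom_trivializationAt_baseSet]
  have h1 := e.toOpenPartialHomeomorph.continuousOn_symm
  have h2 : e.target = (chartAt 𝔼 x₀).source ×ˢ univ := by rw [e.target_eq, hb]
  refine (h1.congr ?_).mono h2.ge
  rintro ⟨x, p⟩ hx
  have hx' : x ∈ e.baseSet := by rw [hb]; simpa [h2] using hx
  have h3 : (⟨x, chartCovector x₀ x p⟩ : CotangentBundle n M) ∈ e.source := by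
    rw [e.mem_source]; exact hx'
  have hx₁ : x ∈ (trivializationAt 𝔼 (TangentSpace (𝓡 n) : M → Type _) x₀).baseSet := by
    simpa [hb] using hx'
  have h4 : e ⟨x, chartCovector x₀ x p⟩ = (x, p) := by
    rw [he, hom_trivializationAt_apply]
    refine Prod.ext rfl ?_
    ext v
    simp only [ContinuousLinearMap.inCoordinates, ContinuousLinearMap.comp_apply,
      chartCovector_apply]
    rw [Trivialization.continuousLinearMapAt_symmL _ hx₁]
    simp
  have h5 := e.toOpenPartialHomeomorph.left_inv h3
  exact h5.symm.trans (congrArg _ h4)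

/-- The chart representation of the spatial differential of a function written in the chart. -/
lemma mfderiv_comp_extChartAt {x₀ x : M} (hx : x ∈ (chartAt 𝔼 x₀).source) {A : 𝔼 → ℝ}
    (hA : DifferentiableAt ℝ A (extChartAt (𝓡 n) x₀ x)) :
    mfderiv (𝓡 n) 𝓘(ℝ, ℝ) (fun y => A (extChartAt (𝓡 n) x₀ y)) x =
      chartCovector x₀ x (fderiv ℝ A (extChartAt (𝓡 n) x₀ x)) := by
  have : IsManifold (𝓡 n) 1 M := IsManifold.of_le (n := ∞) (by simp)
  have h1 : MDifferentiableAt (𝓡 n) 𝓘(ℝ, 𝔼) (extChartAt (𝓡 n) x₀) x :=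
    mdifferentiableAt_extChartAt hx
  have h2 : MDifferentiableAt 𝓘(ℝ, 𝔼) 𝓘(ℝ, ℝ) A (extChartAt (𝓡 n) x₀ x) :=
    hA.mdifferentiableAt
  have h3 := mfderiv_comp x h2 h1
  rw [chartCovector_apply, TangentBundle.continuousLinearMapAt_trivializationAt hx]
  rw [← mfderiv_eq_fderiv]
  exact h3

variable [RiemannianBundle (fun x : M => TangentSpace (𝓡 n) x)]
    [IsContMDiffRiemannianBundle (𝓡 n) ∞ (EuclideanSpace ℝ (Fin n))
      (fun x : M => TangentSpace (𝓡 n) x)]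

/-- A continuous Riemannian metric is locally comparable with the chart norm. Only this direction is
needed: a large chart momentum must be a large covector, so that coercivity passes to the chart. -/
lemma norm_le_chartCovector (x₀ : M) : ∃ C > 0, ∀ᶠ x in 𝓝 x₀, ∀ p : 𝔼 →L[ℝ] ℝ,
    ‖p‖ ≤ C * ‖chartCovector x₀ x p‖ := by
  have : IsManifold (𝓡 n) 1 M := IsManifold.of_le (n := ∞) (by simp)
  have : IsContinuousRiemannianBundle 𝔼 (fun x : M => TangentSpace (𝓡 n) x) := by
    obtain ⟨g, hg, hg'⟩ := ‹IsContMDiffRiemannianBundle (𝓡 n) ∞ 𝔼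
      (fun x : M => TangentSpace (𝓡 n) x)›.exists_contMDiff
    exact ⟨g, hg.continuous, hg'⟩
  obtain ⟨C, hC, h⟩ := eventually_norm_symmL_trivializationAt_lt 𝔼
    (fun x : M => TangentSpace (𝓡 n) x) x₀
  set e := trivializationAt 𝔼 (TangentSpace (𝓡 n) : M → Type _) x₀ with he
  refine ⟨C, hC, ?_⟩
  filter_upwards [h, e.open_baseSet.mem_nhds (FiberBundle.mem_baseSet_trivializationAt' x₀)]
    with x hx hxb p
  have hp : p = (chartCovector x₀ x p).comp (e.symmL ℝ x) := by
    ext v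
    rw [chartCovector_apply, ContinuousLinearMap.comp_apply, ContinuousLinearMap.comp_apply,
      Trivialization.continuousLinearMapAt_symmL _ hxb]
  calc ‖p‖ = ‖(chartCovector x₀ x p).comp (e.symmL ℝ x)‖ := by rw [← hp]
    _ ≤ ‖chartCovector x₀ x p‖ * ‖e.symmL ℝ x‖ := ContinuousLinearMap.opNorm_comp_le _ _
    _ ≤ _ := by rw [mul_comm]; gcongr

/-- The chart domain is shrunk to a set `Ω` on which one comparison constant for the norms works,
because coercivity in `LocalHam` is uniform in the base point. -/
lemma IsHamiltonian.localHam {H : (x : M) → Cotangent n x → ℝ → ℝ} (hH : IsHamiltonian H) {L : ℝ≥0}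
    (hL : ∀ x p, LipschitzWith L (H x p)) (hL0 : 0 < L) (x₀ : M) :
    ∃ Ω : Set 𝔼, Ω ⊆ (extChartAt (𝓡 n) x₀).target ∧ extChartAt (𝓡 n) x₀ x₀ ∈ Ω ∧
      LocalHam (chartHam H x₀) Ω L := by
  obtain ⟨C, hC, hnorm⟩ := norm_le_chartCovector (n := n) x₀
  have hsymm : ContinuousAt (extChartAt (𝓡 n) x₀).symm (extChartAt (𝓡 n) x₀ x₀) :=
    continuousAt_extChartAt_symm x₀
  have h1 : ∀ᶠ z in 𝓝 (extChartAt (𝓡 n) x₀ x₀), z ∈ (extChartAt (𝓡 n) x₀).target ∧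
      ∀ p : 𝔼 →L[ℝ] ℝ, ‖p‖ ≤ C * ‖chartCovector x₀ ((extChartAt (𝓡 n) x₀).symm z) p‖ := by
    refine Filter.Eventually.and (extChartAt_target_mem_nhds x₀) ?_
    refine hsymm.eventually (p := fun x => ∀ p : 𝔼 →L[ℝ] ℝ, ‖p‖ ≤ C * ‖chartCovector x₀ x p‖) ?_
    simpa using hnorm
  obtain ⟨Ω, hΩ, hΩo, hmem⟩ := eventually_nhds_iff.1 h1
  refine ⟨Ω, fun z hz => (hΩ z hz).1, hmem, ?_⟩
  have hsrc : ∀ z ∈ Ω, (extChartAt (𝓡 n) x₀).symm z ∈ (chartAt 𝔼 x₀).source := fun z hz => by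
    simpa using (extChartAt (𝓡 n) x₀).map_target (hΩ z hz).1
  refine ⟨hΩo, ?_, ?_, ?_, ?_, by exact_mod_cast hL0⟩
  · have h2 : ContinuousOn (fun q : 𝔼 × (𝔼 →L[ℝ] ℝ) × ℝ =>
        (((extChartAt (𝓡 n) x₀).symm q.1, q.2.1) : M × (𝔼 →L[ℝ] ℝ))) (Ω ×ˢ univ) := by
      refine ContinuousOn.prodMk ?_ (by fun_prop)
      exact (continuousOn_extChartAt_symm x₀).comp continuousOn_fst fun q hq => (hΩ _ hq.1).1
    have h3 := (continuousOn_chartCovector x₀).comp h2 fun q hq => ⟨hsrc _ hq.1, mem_univ _⟩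
    have h4 : ContinuousOn (fun q : 𝔼 × (𝔼 →L[ℝ] ℝ) × ℝ => q.2.2) (Ω ×ˢ univ) := by fun_prop
    exact hH.continuous.comp_continuousOn (h3.prodMk h4)
  · intro z _ r
    set x := (extChartAt (𝓡 n) x₀).symm z
    refine ⟨convex_univ, fun p _ q _ a b ha hb hab => ?_⟩
    have h2 := (hH.convex x r).2 (mem_univ (chartCovector x₀ x p))
      (mem_univ (chartCovector x₀ x q)) ha hb hab
    have h3 : a • chartCovector x₀ x p + b • chartCovector x₀ x q =
        chartCovector x₀ x (a • p + b • q) := by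
      simp only [chartCovector_apply]
      ext v
      simp
    rw [h3] at h2
    exact h2
  · intro z _ p r r'
    have := (hL ((extChartAt (𝓡 n) x₀).symm z)
      (chartCovector x₀ ((extChartAt (𝓡 n) x₀).symm z) p)).dist_le_mul r r'
    simpa [Real.dist_eq, chartHam] using this
  · intro R
    obtain ⟨K, hK, hcoer⟩ := hH.coercive (max R 1) (by positivity)
    refine ⟨C * K, by positivity, fun z hz p r hr hp => ?_⟩
    refine (le_max_left R 1).trans_lt (hcoer _ _ _ (hr.trans (le_max_left _ _)) ?_)
    exact le_of_mul_le_mul_left (hp.trans ((hΩ z hz).2 p)) hC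

end Charts

end HJ

namespace HJ

/-! ### Extension of local tests to global test functions -/

section TestFunctions

set_option linter.unusedSectionVars false

lemma isOpen_openCylinder {M : Type*} [TopologicalSpace M] (T : EReal) :
    IsOpen (openCylinder M T) := by
  have h1 : IsOpen {z : M × ℝ | 0 < z.2} := isOpen_lt continuous_const continuous_snd
  have h2 : IsOpen {z : M × ℝ | (z.2 : EReal) < T} :=
    isOpen_lt (continuous_coe_real_ereal.comp continuous_snd) continuous_const
  exact h1.inter h2

lemma openCylinder_subset_cylinder {M : Type*} (T : EReal) : openCylinder M T ⊆ cylinder M T :=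
  fun _ hz => ⟨hz.1.le, hz.2⟩

lemma exists_real_le_of_isCompact {X : Type*} [TopologicalSpace X] {K : Set X} (hK : IsCompact K)
    {u : X → EReal} (hu : LowerSemicontinuousOn u K) (hbot : ∀ x ∈ K, u x ≠ ⊥) :
    ∃ c : ℝ, ∀ x ∈ K, (c : EReal) ≤ u x := by
  rcases K.eq_empty_or_nonempty with rfl | hne
  · exact ⟨0, by simp⟩
  obtain ⟨x, hx, hmin⟩ := hu.exists_isMinOn hne hK
  obtain ⟨c, -, hc⟩ := EReal.lt_iff_exists_real_btwn.1 (bot_lt_iff_ne_bot.2 (hbot x hx))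
  exact ⟨c, fun y hy => hc.le.trans (hmin hy)⟩

variable {n : ℕ} {M : Type*} [TopologicalSpace M] [CompactSpace M]

lemma exists_real_le_on_slab {T : EReal} {u : M → ℝ → EReal}
    (hlsc : LowerSemicontinuousOn (fun z : M × ℝ => u z.1 z.2) (cylinder M T))
    (hbot : ∀ z ∈ cylinder M T, u z.1 z.2 ≠ ⊥) {T₁ : ℝ} (hT₁ : (T₁ : EReal) < T) :
    ∃ c : ℝ, ∀ x t, 0 ≤ t → t ≤ T₁ → (c : EReal) ≤ u x t := by
  have hsub : (univ : Set M) ×ˢ Icc 0 T₁ ⊆ cylinder M T := fun z hz =>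
    ⟨hz.2.1, lt_of_le_of_lt (EReal.coe_le_coe_iff.2 hz.2.2) hT₁⟩
  obtain ⟨c, hc⟩ := exists_real_le_of_isCompact (isCompact_univ.prod isCompact_Icc)
    (hlsc.mono hsub) fun z hz => hbot z (hsub hz)
  exact ⟨c, fun x t h0 h1 => hc (x, t) ⟨mem_univ _, h0, h1⟩⟩

/-- At each time the real lower bounds of `u` form a convex set, and a constant serves locally in
time by compactness of slabs; a partition of unity glues these constants. The map `τ` reparametrises
time by the whole line, and the guard on its sign covers parameters sent to negative times. -/
lemma exists_smooth_lower_bound_of_diffeo {T : EReal} {u : M → ℝ → EReal}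
    (hlsc : LowerSemicontinuousOn (fun z : M × ℝ => u z.1 z.2) (cylinder M T))
    (hbot : ∀ z ∈ cylinder M T, u z.1 z.2 ≠ ⊥) (τ : ℝ → ℝ) (hτ : Monotone τ)
    (hτT : ∀ s, (τ s : EReal) < T) :
    ∃ b : ℝ → ℝ, ContDiff ℝ 1 b ∧ ∀ s x, 0 ≤ τ s → (b s : EReal) ≤ u x (τ s) := by
  have hconv : ∀ s : ℝ, Convex ℝ {c : ℝ | ∀ x, 0 ≤ τ s → (c : EReal) ≤ u x (τ s)} := by
    intro s
    refine OrdConnected.convex ⟨fun a _ b hb c hc x h => ?_⟩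
    exact (EReal.coe_le_coe_iff.2 hc.2).trans (hb x h)
  have hloc : ∀ s : ℝ, ∃ c, ∀ᶠ s' in 𝓝 s,
      c ∈ {c : ℝ | ∀ x, 0 ≤ τ s' → (c : EReal) ≤ u x (τ s')} := by
    intro s
    obtain ⟨c, hc⟩ := exists_real_le_on_slab hlsc hbot (hτT (s + 1))
    refine ⟨c, ?_⟩
    filter_upwards [Iio_mem_nhds (lt_add_one s)] with s' hs' x h
    exact hc x _ h (hτ (le_of_lt hs'))
  obtain ⟨g, hg⟩ := exists_contMDiffMap_forall_mem_convex_of_local_const (n := 1) 𝓘(ℝ, ℝ)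
    hconv hloc
  exact ⟨g, g.contMDiff.contDiff, fun s x h => hg s x h⟩

/-- A global test function has to stay below `u` up to time `T`, where `u` need not be bounded
below. For finite `T` time is reparametrised by `T - exp (-s)`. -/
lemma exists_smooth_lower_bound {T : EReal} {u : M → ℝ → EReal}
    (hlsc : LowerSemicontinuousOn (fun z : M × ℝ => u z.1 z.2) (cylinder M T))
    (hbot : ∀ z ∈ cylinder M T, u z.1 z.2 ≠ ⊥) :
    ∃ b : ℝ → ℝ, ContDiffOn ℝ 1 b {t | (t : EReal) < T} ∧
      ∀ z ∈ cylinder M T, (b z.2 : EReal) ≤ u z.1 z.2 := by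
  induction T with
  | bot => exact ⟨0, contDiffOn_const, fun z hz => absurd hz.2 (by simp)⟩
  | top =>
    obtain ⟨b, hb, hb'⟩ := exists_smooth_lower_bound_of_diffeo hlsc hbot id monotone_id
      (fun s => EReal.coe_lt_top s)
    exact ⟨b, hb.contDiffOn, fun z hz => hb' z.2 z.1 hz.1⟩
  | coe T =>
    obtain ⟨b, hb, hb'⟩ := exists_smooth_lower_bound_of_diffeo hlsc hbot
      (fun s => T - Real.exp (-s)) (fun s s' h => by
        have := Real.exp_le_exp.2 (neg_le_neg h)
        simp only
        linarith)
      (fun s => by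
        have := Real.exp_pos (-s)
        exact EReal.coe_lt_coe_iff.2 (by linarith))
    refine ⟨fun t => b (-Real.log (T - t)), ?_, fun z hz => ?_⟩
    · refine hb.comp_contDiffOn (ContDiffOn.neg (ContDiffOn.log (by fun_prop) ?_))
      intro t ht
      have ht' : t < T := EReal.coe_lt_coe_iff.1 ht
      exact (sub_pos.2 ht').ne'
    · have ht : z.2 < T := EReal.coe_lt_coe_iff.1 hz.2
      have h1 : T - Real.exp (- -Real.log (T - z.2)) = z.2 := by
        rw [neg_neg, Real.exp_log (sub_pos.2 ht)]; ring
      have := hb' (-Real.log (T - z.2)) z.1 (by simp only [h1]; exact hz.1)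
      simp only [h1] at this
      exact this

variable [T2Space M] [ChartedSpace (EuclideanSpace ℝ (Fin n)) M] [IsManifold (𝓡 n) ∞ M]

/-- A `C¹` function touching `u` locally from below coincides near the contact point with a test
function touching `u` globally. -/
lemma exists_global_test {T : EReal} {u : M → ℝ → EReal}
    (hlsc : LowerSemicontinuousOn (fun z : M × ℝ => u z.1 z.2) (cylinder M T))
    (hbot : ∀ z ∈ cylinder M T, u z.1 z.2 ≠ ⊥) {z₁ : M × ℝ} (hz₁ : z₁ ∈ openCylinder M T)
    {Ψ : M × ℝ → ℝ} (hΨ : ContMDiffAt ((𝓡 n).prod 𝓘(ℝ, ℝ)) 𝓘(ℝ, ℝ) 1 Ψ z₁) {r : ℝ}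
    (hr : u z₁.1 z₁.2 = r) (hmin : ∀ᶠ z in 𝓝 z₁, ((r - Ψ z₁ + Ψ z : ℝ) : EReal) ≤ u z.1 z.2) :
    ∃ ψ : M → ℝ → ℝ, IsTest n T ψ ∧ MinAt T u ψ z₁.1 z₁.2 ∧
      (fun z : M × ℝ => ψ z.1 z.2) =ᶠ[𝓝 z₁] Ψ := by
  obtain ⟨b, hb, hbu⟩ := exists_smooth_lower_bound hlsc hbot
  have h1 : ∀ᶠ z in 𝓝 z₁, z ∈ openCylinder M T ∧
      ContMDiffAt ((𝓡 n).prod 𝓘(ℝ, ℝ)) 𝓘(ℝ, ℝ) 1 Ψ z ∧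
      ((r - Ψ z₁ + Ψ z : ℝ) : EReal) ≤ u z.1 z.2 :=
    Filter.Eventually.and ((isOpen_openCylinder T).mem_nhds hz₁) ((contMDiffAt_iff_contMDiffAt_nhds (by simp)).1 hΨ |>.and hmin)
  obtain ⟨χ, -, hχ⟩ := (SmoothBumpFunction.nhds_basis_tsupport
    (I := (𝓡 n).prod 𝓘(ℝ, ℝ)) z₁).mem_iff.1 h1
  set c₀ := r - Ψ z₁ with hc₀
  -- Adding `c₀` gives a convex combination of `c₀ + Ψ`, which lies below `u` on the support of `χ`,
  -- and `b + c₀ - |c₀|`, which lies below `b` and hence below `u` everywhere.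
  refine ⟨fun x t => χ (x, t) * Ψ (x, t) + (1 - χ (x, t)) * (b t - |c₀|), ?_, ?_, ?_⟩
  · have e1 : ContMDiff ((𝓡 n).prod 𝓘(ℝ, ℝ)) 𝓘(ℝ, ℝ) 1 (fun z : M × ℝ => χ z * Ψ z) := by
      refine contMDiff_of_tsupport fun z hz => ?_
      have hz' : z ∈ tsupport χ := closure_mono (Function.support_mul_subset_left _ _) hz
      exact ((χ.contMDiff.contMDiffAt).of_le (by simp)).mul (hχ hz').2.1
    have e2 : ContMDiffOn ((𝓡 n).prod 𝓘(ℝ, ℝ)) 𝓘(ℝ, ℝ) 1 (fun z : M × ℝ => b z.2)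
        (openCylinder M T) :=
      hb.contMDiffOn.comp contMDiffOn_snd fun z hz => hz.2
    have e3 : ContMDiff ((𝓡 n).prod 𝓘(ℝ, ℝ)) 𝓘(ℝ, ℝ) 1 χ := χ.contMDiff.of_le (by simp)
    exact e1.contMDiffOn.add ((contMDiffOn_const.sub e3.contMDiffOn).mul
      (e2.sub contMDiffOn_const))
  · have hχ1 : χ z₁ = 1 := χ.eq_one
    have key : ∀ z ∈ openCylinder M T,
        ((c₀ + (χ z * Ψ z + (1 - χ z) * (b z.2 - |c₀|)) : ℝ) : EReal) ≤ u z.1 z.2 := by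
      intro z hz
      have hb1 := hbu z (openCylinder_subset_cylinder T hz)
      have hc := le_abs_self c₀
      by_cases hzs : z ∈ tsupport χ
      · have h2 := (hχ hzs).2.2
        refine le_trans (EReal.coe_le_coe_iff.2 ?_) (max_le h2 hb1)
        have h3 := χ.nonneg (x := z)
        have h4 := χ.le_one (x := z)
        have h5 := mul_le_mul_of_nonneg_left (le_max_left (c₀ + Ψ z) (b z.2)) h3
        have h6 := mul_le_mul_of_nonneg_left (le_max_right (c₀ + Ψ z) (b z.2))
          (sub_nonneg.2 h4)
        have h7 := mul_le_mul_of_nonneg_left hc (sub_nonneg.2 h4)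
        change _ ≤ max (c₀ + Ψ z) (b z.2)
        linarith
      · have h2 : χ z = 0 := image_eq_zero_of_notMem_tsupport hzs
        refine le_trans (EReal.coe_le_coe_iff.2 ?_) hb1
        rw [h2]
        linarith
    intro z hz
    have h2 := key z hz
    have h3 : u z₁.1 z₁.2 - ((χ (z₁.1, z₁.2) * Ψ (z₁.1, z₁.2) +
        (1 - χ (z₁.1, z₁.2)) * (b z₁.2 - |c₀|) : ℝ) : EReal) = (c₀ : EReal) := by
      rw [hr, ← EReal.coe_sub, hχ1]
      simp [hc₀]
    refine le_of_eq_of_le h3 ?_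
    rw [EReal.le_sub_iff_add_le (Or.inl (EReal.coe_ne_bot _)) (Or.inl (EReal.coe_ne_top _))]
    exact_mod_cast h2
  · filter_upwards [χ.eventuallyEq_one] with z hz
    have hz' : χ z = 1 := hz
    simp [hz']

/-- Local tests written in a chart, from below, extend to global test functions. -/
lemma exists_test_of_chart {T : EReal} {u : M → ℝ → EReal}
    (hlsc : LowerSemicontinuousOn (fun z : M × ℝ => u z.1 z.2) (cylinder M T))
    (hbot : ∀ z ∈ cylinder M T, u z.1 z.2 ≠ ⊥) (x₀ : M)
    {q : EuclideanSpace ℝ (Fin n) × ℝ} (hq : q.1 ∈ (extChartAt (𝓡 n) x₀).target) (hq0 : 0 < q.2)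
    (hqT : (q.2 : EReal) < T) {ψ₀ : EuclideanSpace ℝ (Fin n) × ℝ → ℝ} (hψ₀ : ContDiffAt ℝ 1 ψ₀ q)
    {r : ℝ} (hr : u ((extChartAt (𝓡 n) x₀).symm q.1) q.2 = r)
    (hmin : ∀ᶠ z in 𝓝 q, ((r - ψ₀ q + ψ₀ z : ℝ) : EReal) ≤
      u ((extChartAt (𝓡 n) x₀).symm z.1) z.2) :
    ∃ ψ : M → ℝ → ℝ, IsTest n T ψ ∧ MinAt T u ψ ((extChartAt (𝓡 n) x₀).symm q.1) q.2 ∧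
      deriv (ψ ((extChartAt (𝓡 n) x₀).symm q.1)) q.2 = fderiv ℝ ψ₀ q (0, 1) ∧
      spaceDiff n ψ ((extChartAt (𝓡 n) x₀).symm q.1) q.2 =
        chartCovector x₀ ((extChartAt (𝓡 n) x₀).symm q.1)
          ((fderiv ℝ ψ₀ q).comp (.inl ℝ (EuclideanSpace ℝ (Fin n)) ℝ)) := by
  set e := extChartAt (𝓡 n) x₀ with he
  set x₁ := e.symm q.1 with hx₁
  have hx₁s : x₁ ∈ e.source := e.map_target hq
  have hx₁c : x₁ ∈ (chartAt (EuclideanSpace ℝ (Fin n)) x₀).source := by simpa [he] using hx₁s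
  have hex₁ : e x₁ = q.1 := e.right_inv hq
  have heq : (e x₁, q.2) = q := by rw [hex₁]
  have hec : ContMDiffAt (𝓡 n) 𝓘(ℝ, EuclideanSpace ℝ (Fin n)) 1 e x₁ :=
    (contMDiffAt_extChartAt' (n := 1) hx₁c)
  have hΦ : ContMDiffAt ((𝓡 n).prod 𝓘(ℝ, ℝ)) 𝓘(ℝ, EuclideanSpace ℝ (Fin n) × ℝ) 1
      (fun z : M × ℝ => (e z.1, z.2)) (x₁, q.2) := by
    refine ContMDiffAt.prodMk_space ?_ contMDiffAt_snd
    exact ContMDiffAt.comp (x₁, q.2) (g := e) (f := Prod.fst) hec contMDiffAt_fst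
  have hΨ : ContMDiffAt ((𝓡 n).prod 𝓘(ℝ, ℝ)) 𝓘(ℝ, ℝ) 1 (fun z : M × ℝ => ψ₀ (e z.1, z.2))
      (x₁, q.2) := by
    refine ContMDiffAt.comp (x₁, q.2) (g := ψ₀) (f := fun z : M × ℝ => (e z.1, z.2)) ?_ hΦ
    simp only [heq]
    exact hψ₀.contMDiffAt
  have hcont : Tendsto (fun z : M × ℝ => (e z.1, z.2)) (𝓝 (x₁, q.2)) (𝓝 q) := by
    have := hΦ.continuousAt
    rw [ContinuousAt, heq] at this
    exact this
  have hsrc : ∀ᶠ z : M × ℝ in 𝓝 (x₁, q.2), z.1 ∈ e.source :=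
    continuousAt_fst.eventually ((isOpen_extChartAt_source x₀).mem_nhds hx₁s)
  obtain ⟨ψ, h1, h2, h3⟩ := exists_global_test hlsc hbot (z₁ := (x₁, q.2)) ⟨hq0, hqT⟩ hΨ hr (by
    filter_upwards [hcont.eventually hmin, hsrc] with z hz hzs
    simp only [heq]
    rw [e.left_inv hzs] at hz
    exact hz)
  refine ⟨ψ, h1, h2, ?_, ?_⟩
  · have h4 : ψ x₁ =ᶠ[𝓝 q.2] fun t => ψ₀ (q.1, t) := by
      have : Tendsto (fun t : ℝ => (x₁, t)) (𝓝 q.2) (𝓝 (x₁, q.2)) :=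
        (Continuous.prodMk_right x₁).tendsto q.2
      filter_upwards [this.eventually h3] with t ht
      simpa [hex₁] using ht
    rw [h4.deriv_eq]
    have h5 : HasDerivAt (fun t : ℝ => ((q.1, t) : EuclideanSpace ℝ (Fin n) × ℝ)) (0, 1) q.2 :=
      (hasDerivAt_const q.2 q.1).prodMk (hasDerivAt_id q.2)
    have h6 : HasFDerivAt ψ₀ (fderiv ℝ ψ₀ q) (q.1, q.2) :=
      (hψ₀.differentiableAt (by norm_num)).hasFDerivAt
    exact (h6.comp_hasDerivAt q.2 h5).deriv
  · have h4 : (fun y => ψ y q.2) =ᶠ[𝓝 x₁] fun y => ψ₀ (e y, q.2) := by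
      have : Tendsto (fun y : M => (y, q.2)) (𝓝 x₁) (𝓝 (x₁, q.2)) :=
        (Continuous.prodMk_left q.2).tendsto x₁
      exact this.eventually h3
    have h5 : HasFDerivAt (fun z : EuclideanSpace ℝ (Fin n) => ψ₀ (z, q.2))
        ((fderiv ℝ ψ₀ q).comp (.inl ℝ (EuclideanSpace ℝ (Fin n)) ℝ)) (e x₁) := by
      rw [hex₁]
      have h6 : HasFDerivAt ψ₀ (fderiv ℝ ψ₀ q) (q.1, q.2) :=
        (hψ₀.differentiableAt (by norm_num)).hasFDerivAt
      exact h6.comp q.1 (hasFDerivAt_prodMk_left q.1 q.2)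
    unfold spaceDiff
    rw [h4.mfderiv_eq]
    have h6 := mfderiv_comp_extChartAt hx₁c h5.differentiableAt
    rw [h5.fderiv] at h6
    exact h6

end TestFunctions

end HJ

namespace HJ

/-! ### Truncation of extended-valued solutions by time-dependent barriers -/

section Truncation

set_option linter.unusedSectionVars false

variable {n : ℕ} {M : Type*} [TopologicalSpace M] [ChartedSpace (EuclideanSpace ℝ (Fin n)) M]

/-- Real valued subsolutions on `M × (0, T₁)`, tested from below in charts. -/
def IsRealSub [IsManifold (𝓡 n) ∞ M] (H : (x : M) → Cotangent n x → ℝ → ℝ) (T₁ : ℝ)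
    (f : M × ℝ → ℝ) : Prop :=
  ∀ x₀ : M, SubBelow (chartHam H x₀) ((extChartAt (𝓡 n) x₀).target ×ˢ Ioo 0 T₁)
    (fun q => f ((extChartAt (𝓡 n) x₀).symm q.1, q.2))

/-- Real valued supersolutions on `M × (0, T₁)`, tested from below in charts, where the Hamiltonian
is uniformly coercive. -/
def IsRealSup [IsManifold (𝓡 n) ∞ M] (H : (x : M) → Cotangent n x → ℝ → ℝ) (T₁ : ℝ)
    (f : M × ℝ → ℝ) : Prop :=
  ∀ (x₀ : M) (Ω : Set (EuclideanSpace ℝ (Fin n))) (L : ℝ), Ω ⊆ (extChartAt (𝓡 n) x₀).target →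
    LocalHam (chartHam H x₀) Ω L → SupBelow (chartHam H x₀) (Ω ×ˢ Ioo 0 T₁)
      (fun q => f ((extChartAt (𝓡 n) x₀).symm q.1, q.2))

open Classical in
/-- The truncation `min u W` on `M × [0, T₁]`, as a real function, extended by `0`. -/
noncomputable def trunc (T₁ : ℝ) (W : ℝ → ℝ) (u : M → ℝ → EReal) (z : M × ℝ) : ℝ :=
  if z.2 ∈ Icc 0 T₁ then (min (u z.1 z.2) (W z.2 : EReal)).toReal else 0

variable {T : EReal} {T₁ : ℝ} {W : ℝ → ℝ} {u : M → ℝ → EReal}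

lemma coe_trunc (hbot : ∀ z ∈ cylinder M T, u z.1 z.2 ≠ ⊥) (hT₁ : (T₁ : EReal) < T) {z : M × ℝ}
    (hz : z.2 ∈ Icc 0 T₁) : (trunc T₁ W u z : EReal) = min (u z.1 z.2) (W z.2 : EReal) := by
  rw [trunc, if_pos hz, EReal.coe_toReal]
  · exact ((min_le_right _ _).trans_lt (EReal.coe_lt_top _)).ne
  · have h1 := hbot z ⟨hz.1, lt_of_le_of_lt (EReal.coe_le_coe_iff.2 hz.2) hT₁⟩
    exact (lt_min (bot_lt_iff_ne_bot.2 h1) (EReal.bot_lt_coe _)).ne'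

lemma trunc_le (hbot : ∀ z ∈ cylinder M T, u z.1 z.2 ≠ ⊥) (hT₁ : (T₁ : EReal) < T) {z : M × ℝ}
    (hz : z.2 ∈ Icc 0 T₁) : trunc T₁ W u z ≤ W z.2 := by
  have := (coe_trunc (W := W) hbot hT₁ hz).trans_le (min_le_right _ _)
  exact_mod_cast this

lemma le_trunc (hbot : ∀ z ∈ cylinder M T, u z.1 z.2 ≠ ⊥) (hT₁ : (T₁ : EReal) < T) {z : M × ℝ}
    (hz : z.2 ∈ Icc 0 T₁) {c : ℝ} (h1 : (c : EReal) ≤ u z.1 z.2) (h2 : c ≤ W z.2) :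
    c ≤ trunc T₁ W u z := by
  have := (le_min h1 (EReal.coe_le_coe_iff.2 h2)).trans_eq (coe_trunc (W := W) hbot hT₁ hz).symm
  exact_mod_cast this

lemma coe_trunc_le (hbot : ∀ z ∈ cylinder M T, u z.1 z.2 ≠ ⊥) (hT₁ : (T₁ : EReal) < T)
    {z : M × ℝ} (hz : z.2 ∈ Icc 0 T₁) : (trunc T₁ W u z : EReal) ≤ u z.1 z.2 :=
  (coe_trunc (W := W) hbot hT₁ hz).trans_le (min_le_left _ _)

lemma lsc_trunc (hlsc : LowerSemicontinuousOn (fun z : M × ℝ => u z.1 z.2) (cylinder M T))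
    (hbot : ∀ z ∈ cylinder M T, u z.1 z.2 ≠ ⊥) (hT₁ : (T₁ : EReal) < T) (hW : Continuous W) :
    LowerSemicontinuousOn (trunc T₁ W u) (univ ×ˢ Icc 0 T₁) := by
  have hsub : (univ : Set M) ×ˢ Icc 0 T₁ ⊆ cylinder M T := fun z hz =>
    ⟨hz.2.1, lt_of_le_of_lt (EReal.coe_le_coe_iff.2 hz.2.2) hT₁⟩
  intro z hz c hc
  have h1 : (c : EReal) < min (u z.1 z.2) (W z.2 : EReal) := by
    rw [← coe_trunc hbot hT₁ hz.2]
    exact_mod_cast hc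
  obtain ⟨h2, h3⟩ := lt_min_iff.1 h1
  have h4 := (hlsc.mono hsub) z hz c h2
  have h5 : ∀ᶠ y : M × ℝ in 𝓝[univ ×ˢ Icc 0 T₁] z, c < W y.2 :=
    mem_nhdsWithin_of_mem_nhds ((hW.comp continuous_snd).continuousAt.eventually_const_lt
      (by exact_mod_cast h3))
  filter_upwards [h4, h5, self_mem_nhdsWithin] with y h6 h7 h8
  have h9 : (c : EReal) < (trunc T₁ W u y : EReal) := by
    rw [coe_trunc hbot hT₁ h8.2]
    exact lt_min h6 (by exact_mod_cast h7)
  exact_mod_cast h9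

lemma exists_abs_trunc_le [CompactSpace M]
    (hlsc : LowerSemicontinuousOn (fun z : M × ℝ => u z.1 z.2) (cylinder M T))
    (hbot : ∀ z ∈ cylinder M T, u z.1 z.2 ≠ ⊥) (hT₁ : (T₁ : EReal) < T) (hW : Continuous W) :
    ∃ R, ∀ z, |trunc T₁ W u z| ≤ R := by
  obtain ⟨c, hc⟩ := exists_real_le_on_slab hlsc hbot hT₁
  obtain ⟨B, hB⟩ := isCompact_Icc.exists_bound_of_continuousOn (hW.continuousOn (s := Icc 0 T₁))
  refine ⟨max |c| |B|, fun z => ?_⟩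
  by_cases hz : z.2 ∈ Icc 0 T₁
  · have hBz := abs_le.1 (hB z.2 hz)
    have h1 := trunc_le (W := W) hbot hT₁ hz
    have h2 := le_trunc (W := W) hbot hT₁ hz (c := min c (-|B|))
      (le_trans (EReal.coe_le_coe_iff.2 (min_le_left _ _)) (hc z.1 z.2 hz.1 hz.2))
      ((min_le_right _ _).trans (by linarith [le_abs_self B]))
    have h3 := neg_abs_le c
    have h4 := le_max_left |c| |B|
    have h5 := le_max_right |c| |B|
    rw [abs_le]
    refine ⟨le_trans (le_min ?_ ?_) h2, ?_⟩ <;> linarith [le_abs_self B]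
  · rw [trunc, if_neg hz, abs_zero]
    exact (abs_nonneg c).trans (le_max_left _ _)

variable [CompactSpace M] [T2Space M] [IsManifold (𝓡 n) ∞ M]

lemma chartCovector_zero (x₀ x : M) : (chartCovector x₀ x 0 : Cotangent n x) = 0 := by
  rw [chartCovector_apply]
  simp

/-- A test function touching a truncation from below touches either the original function, and
then extends to a global test function, or the truncating barrier. -/
lemma trunc_touch (hlsc : LowerSemicontinuousOn (fun z : M × ℝ => u z.1 z.2) (cylinder M T))
    (hbot : ∀ z ∈ cylinder M T, u z.1 z.2 ≠ ⊥) (hT₁ : (T₁ : EReal) < T) (hW : Differentiable ℝ W)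
    (x₀ : M) {q : EuclideanSpace ℝ (Fin n) × ℝ}
    (hq : q ∈ (extChartAt (𝓡 n) x₀).target ×ˢ Ioo 0 T₁)
    {ψ₀ : EuclideanSpace ℝ (Fin n) × ℝ → ℝ} (hψ₀ : ContDiffAt ℝ 1 ψ₀ q)
    (hmin : IsLocalMin (fun z : EuclideanSpace ℝ (Fin n) × ℝ =>
      trunc T₁ W u ((extChartAt (𝓡 n) x₀).symm z.1, z.2) - ψ₀ z) q) :
    (∃ ψ : M → ℝ → ℝ, IsTest n T ψ ∧ MinAt T u ψ ((extChartAt (𝓡 n) x₀).symm q.1) q.2 ∧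
      u ((extChartAt (𝓡 n) x₀).symm q.1) q.2 =
        (trunc T₁ W u ((extChartAt (𝓡 n) x₀).symm q.1, q.2) : ℝ) ∧
      deriv (ψ ((extChartAt (𝓡 n) x₀).symm q.1)) q.2 = fderiv ℝ ψ₀ q (0, 1) ∧
      spaceDiff n ψ ((extChartAt (𝓡 n) x₀).symm q.1) q.2 =
        chartCovector x₀ ((extChartAt (𝓡 n) x₀).symm q.1)
          ((fderiv ℝ ψ₀ q).comp (.inl ℝ (EuclideanSpace ℝ (Fin n)) ℝ))) ∨
    (trunc T₁ W u ((extChartAt (𝓡 n) x₀).symm q.1, q.2) = W q.2 ∧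
      fderiv ℝ ψ₀ q (0, 1) = deriv W q.2 ∧
      (fderiv ℝ ψ₀ q).comp (.inl ℝ (EuclideanSpace ℝ (Fin n)) ℝ) = 0) := by
  set e := extChartAt (𝓡 n) x₀ with he
  have hnear : ∀ᶠ z in 𝓝 q, z.2 ∈ Icc 0 T₁ := by
    filter_upwards [continuousAt_snd.eventually (isOpen_Ioo.mem_nhds hq.2)] with z hz
    exact Ioo_subset_Icc_self hz
  have hqI : q.2 ∈ Icc 0 T₁ := Ioo_subset_Icc_self hq.2
  have hqc := coe_trunc (W := W) hbot hT₁ (z := (e.symm q.1, q.2)) hqI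
  rcases le_or_gt (u (e.symm q.1) q.2) (W q.2 : EReal) with h | h
  · left
    rw [min_eq_left h] at hqc
    obtain ⟨ψ, h1, h2, h3, h4⟩ := exists_test_of_chart hlsc hbot x₀ hq.1 hq.2.1
      (lt_trans (EReal.coe_lt_coe_iff.2 hq.2.2) hT₁) hψ₀ hqc.symm (by
        filter_upwards [hmin, hnear] with z hz hz2
        have h5 := coe_trunc_le (W := W) hbot hT₁ (z := (e.symm z.1, z.2)) hz2
        refine le_trans (EReal.coe_le_coe_iff.2 ?_) h5
        linarith)
    exact ⟨ψ, h1, h2, hqc.symm, h3, h4⟩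
  · right
    rw [min_eq_right h.le] at hqc
    have hqW : trunc T₁ W u (e.symm q.1, q.2) = W q.2 := by exact_mod_cast hqc
    have hloc : IsLocalMin (fun z : EuclideanSpace ℝ (Fin n) × ℝ => W z.2 - ψ₀ z) q := by
      filter_upwards [hmin, hnear] with z hz hz2
      have h5 := trunc_le (W := W) hbot hT₁ (z := (e.symm z.1, z.2)) hz2
      simp only at h5 hqW ⊢
      linarith
    have hd : HasFDerivAt (fun z : EuclideanSpace ℝ (Fin n) × ℝ => W z.2)
        ((ContinuousLinearMap.toSpanSingleton ℝ (deriv W q.2)).comp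
          (.snd ℝ (EuclideanSpace ℝ (Fin n)) ℝ)) q :=
      (hW q.2).hasDerivAt.hasFDerivAt.comp q hasFDerivAt_snd
    have h0 := hloc.hasFDerivAt_eq_zero
      (hd.fun_sub (hψ₀.differentiableAt (by norm_num)).hasFDerivAt)
    rw [← sub_eq_zero.1 h0]
    refine ⟨hqW, by simp, ?_⟩
    ext v
    simp

/-- Because subsolutions are tested from below here, taking a minimum preserves them; with tests
from above it would be a maximum. The same truncation therefore serves sub- and supersolutions, with
different barriers. -/
lemma IsSubsol.trunc {H : (x : M) → Cotangent n x → ℝ → ℝ} (hu : IsSubsol T H u)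
    (hlsc : LowerSemicontinuousOn (fun z : M × ℝ => u z.1 z.2) (cylinder M T))
    (hbot : ∀ z ∈ cylinder M T, u z.1 z.2 ≠ ⊥) (hT₁ : (T₁ : EReal) < T) (hW : Differentiable ℝ W)
    (hWs : ∀ x : M, ∀ t ∈ Ioo 0 T₁, deriv W t + H x 0 (W t) ≤ 0) :
    IsRealSub H T₁ (trunc T₁ W u) := by
  intro x₀ q hq ψ₀ hψ₀ hmin
  rcases trunc_touch hlsc hbot hT₁ hW x₀ hq hψ₀ hmin with ⟨ψ, h1, h2, h3, h4, h5⟩ | ⟨h1, h2, h3⟩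
  · have := hu ψ h1 _ _ ⟨hq.2.1, lt_trans (EReal.coe_lt_coe_iff.2 hq.2.2) hT₁⟩ h2 _ h3
    rw [h4, h5] at this
    exact this
  · have := hWs ((extChartAt (𝓡 n) x₀).symm q.1) q.2 hq.2
    simp only [h1, h2, h3, chartHam, chartCovector_zero]
    exact this

lemma IsSupersol.trunc {H : (x : M) → Cotangent n x → ℝ → ℝ} (hu : IsSupersol T H u)
    (hlsc : LowerSemicontinuousOn (fun z : M × ℝ => u z.1 z.2) (cylinder M T))
    (hbot : ∀ z ∈ cylinder M T, u z.1 z.2 ≠ ⊥) (hT₁ : (T₁ : EReal) < T) (hW : Differentiable ℝ W)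
    (hWs : ∀ x : M, ∀ t ∈ Ioo 0 T₁, 0 ≤ deriv W t + H x 0 (W t)) :
    IsRealSup H T₁ (trunc T₁ W u) := by
  intro x₀ Ω L hΩt _ q hqΩ ψ₀ hψ₀ hmin
  have hq : q ∈ (extChartAt (𝓡 n) x₀).target ×ˢ Ioo 0 T₁ := ⟨hΩt hqΩ.1, hqΩ.2⟩
  rcases trunc_touch hlsc hbot hT₁ hW x₀ hq hψ₀ hmin with ⟨ψ, h1, h2, h3, h4, h5⟩ | ⟨h1, h2, h3⟩
  · have := hu ψ h1 _ _ ⟨hq.2.1, lt_trans (EReal.coe_lt_coe_iff.2 hq.2.2) hT₁⟩ h2 _ h3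
    rw [h4, h5] at this
    exact this
  · have := hWs ((extChartAt (𝓡 n) x₀).symm q.1) q.2 hq.2
    simp only [h1, h2, h3, chartHam, chartCovector_zero]
    exact this

end Truncation

end HJ

namespace HJ

/-! ### Comparison of bounded sub- and supersolutions on the manifold -/

section Comparison

set_option linter.unusedSectionVars false

section Euclidean

variable {E : Type*} [NormedAddCommGroup E] [InnerProductSpace ℝ E] [FiniteDimensional ℝ E]
variable {G : E → (E →L[ℝ] ℝ) → ℝ → ℝ} {Ω : Set E} {L : ℝ} {D D' : Set (E × ℝ)} {f g : E × ℝ → ℝ}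

lemma SubBelow.mono (hf : SubBelow G D f) (h : D' ⊆ D) : SubBelow G D' f :=
  fun q hq => hf q (h hq)

lemma SubAbove.shift (hf : SubAbove G D f) (hD : IsOpen D) (σ : ℝ)
    (hfg : ∀ q : E × ℝ, q + (0, σ) ∈ D → g q = f (q + (0, σ))) :
    SubAbove G {q | q + (0, σ) ∈ D} g := by
  obtain ⟨a, ha⟩ : ∃ a : E × ℝ, a = (0, σ) := ⟨_, rfl⟩
  rw [← ha] at hfg ⊢
  intro q hq ψ hψ hmax
  have hq' : q + a ∈ D := hq
  have hψ' : ContDiffAt ℝ 1 (fun x => ψ (x + -a)) (q + a) := by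
    refine ContDiffAt.comp (g := ψ) (f := fun x => x + -a) _ ?_ (by fun_prop)
    simpa using hψ
  have hfd : fderiv ℝ (fun x => ψ (x + -a)) (q + a) = fderiv ℝ ψ q := by
    rw [fderiv_comp_add_right, add_neg_cancel_right]
  have h1 := hf _ hq' _ hψ' (by
    have h2 : Tendsto (fun x => x + -a) (𝓝 (q + a)) (𝓝 q) := by
      have : Continuous (fun x => x + -a) := by fun_prop
      simpa using this.tendsto (q + a)
    filter_upwards [h2.eventually hmax, hD.mem_nhds hq'] with x hx hxD
    rw [hfg q hq', hfg (x + -a) (by simpa using hxD)] at hx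
    simpa using hx)
  have h3 : (q + a).1 = q.1 := by simp [ha]
  rw [hfd, ← hfg q hq', h3] at h1
  exact h1

end Euclidean

lemma upperEnv_comp_of_map_nhds {X Y : Type*} [TopologicalSpace X] [TopologicalSpace Y] {f : Y → ℝ}
    {Φ : X → Y} {x : X} (h : map Φ (𝓝 x) = 𝓝 (Φ x)) : upperEnv (f ∘ Φ) x = upperEnv f (Φ x) := by
  rw [upperEnv, upperEnv, ← h]
  rfl

variable {n : ℕ} {M : Type*} [TopologicalSpace M] [ChartedSpace (EuclideanSpace ℝ (Fin n)) M]

/-- The inverse chart is a local homeomorphism, the model having no boundary. Equality of filters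
lets envelopes and relaxed limits commute with the passage to charts. -/
lemma map_chart_symm_nhds (x₀ : M) {q : EuclideanSpace ℝ (Fin n) × ℝ}
    (hq : q.1 ∈ (extChartAt (𝓡 n) x₀).target) :
    map (fun q : EuclideanSpace ℝ (Fin n) × ℝ => ((extChartAt (𝓡 n) x₀).symm q.1, q.2)) (𝓝 q) =
      𝓝 ((extChartAt (𝓡 n) x₀).symm q.1, q.2) := by
  have h1 := map_extChartAt_symm_nhdsWithin_range' (I := 𝓡 n)
    ((extChartAt (𝓡 n) x₀).map_target hq)
  rw [(extChartAt (𝓡 n) x₀).right_inv hq, ModelWithCorners.Boundaryless.range_eq_univ,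
    nhdsWithin_univ] at h1
  rw [show 𝓝 q = 𝓝 q.1 ×ˢ 𝓝 q.2 from nhds_prod_eq, nhds_prod_eq, ← h1]
  exact (prod_map_map_eq (f₁ := 𝓝 q.1) (f₂ := 𝓝 q.2) (m₁ := (extChartAt (𝓡 n) x₀).symm)
    (m₂ := id)).symm.trans (by rw [map_id])

lemma tendsto_chart_symm (x₀ : M) {q : EuclideanSpace ℝ (Fin n) × ℝ}
    (hq : q.1 ∈ (extChartAt (𝓡 n) x₀).target) :
    Tendsto (fun q : EuclideanSpace ℝ (Fin n) × ℝ => ((extChartAt (𝓡 n) x₀).symm q.1, q.2)) (𝓝 q)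
      (𝓝 ((extChartAt (𝓡 n) x₀).symm q.1, q.2)) :=
  (map_chart_symm_nhds x₀ hq).le

lemma lsc_chart {T₁ : ℝ} {f : M × ℝ → ℝ} (hf : LowerSemicontinuousOn f (univ ×ˢ Icc 0 T₁)) (x₀ : M) :
    LowerSemicontinuousOn (fun q : EuclideanSpace ℝ (Fin n) × ℝ =>
      f ((extChartAt (𝓡 n) x₀).symm q.1, q.2)) ((extChartAt (𝓡 n) x₀).target ×ˢ Ioo 0 T₁) := by
  intro q hq c hc
  have hq' : ((extChartAt (𝓡 n) x₀).symm q.1, q.2) ∈ (univ : Set M) ×ˢ Ioo 0 T₁ := ⟨mem_univ _, hq.2⟩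
  have h1 := hf.mono (prod_mono_right Ioo_subset_Icc_self) _ hq' c hc
  rw [(isOpen_univ.prod isOpen_Ioo).nhdsWithin_eq hq'] at h1
  exact mem_nhdsWithin_of_mem_nhds ((tendsto_chart_symm x₀ hq.1).eventually h1)

variable [CompactSpace M] [T2Space M] [IsManifold (𝓡 n) ∞ M]
  [RiemannianBundle (fun x : M => TangentSpace (𝓡 n) x)]
  [IsContMDiffRiemannianBundle (𝓡 n) ∞ (EuclideanSpace ℝ (Fin n))
    (fun x : M => TangentSpace (𝓡 n) x)]

variable {H : (x : M) → Cotangent n x → ℝ → ℝ} {L : ℝ≥0} {T₁ : ℝ} {u v : M × ℝ → ℝ} {R : ℝ}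

/-- With `σ > 0` the shifted envelope at time `0` only depends on `u` near the positive time `σ`,
where the equation gives control; the unshifted envelope at time `0` may be far above the datum. -/
lemma IsRealSub.upperEnv_shift (hu : IsRealSub H T₁ u) (hR : ∀ z, |u z| ≤ R)
    (hlsc : LowerSemicontinuousOn u (univ ×ˢ Icc 0 T₁)) (σ : ℝ) (x₀ : M) {Ω : Set (EuclideanSpace ℝ (Fin n))}
    (hΩt : Ω ⊆ (extChartAt (𝓡 n) x₀).target) (hΩ : LocalHam (chartHam H x₀) Ω L) :
    SubAbove (chartHam H x₀) {q | q + (0, σ) ∈ Ω ×ˢ Ioo 0 T₁}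
      (fun q => upperEnv u ((extChartAt (𝓡 n) x₀).symm q.1, q.2 + σ)) := by
  have hD : IsOpen (Ω ×ˢ Ioo 0 T₁) := hΩ.isOpen.prod isOpen_Ioo
  have hsub : Ω ×ˢ Ioo 0 T₁ ⊆ (extChartAt (𝓡 n) x₀).target ×ˢ Ioo 0 T₁ := prod_mono_left hΩt
  have h1 := ((hu x₀).mono hsub).upperEnv hΩ hD (fun q hq => hq.1) ((lsc_chart hlsc x₀).mono hsub)
    (R := R) fun q => hR _
  refine h1.shift hD σ fun q hq => ?_
  have h2 := upperEnv_comp_of_map_nhds (f := u) (map_chart_symm_nhds x₀ (hΩt hq.1))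
  refine Eq.trans ?_ h2.symm
  simp

/-- The upper semicontinuous envelope of a subsolution is controlled by the initial datum. -/
lemma IsRealSub.exists_upperEnv_le (hH : IsHamiltonian H) (hL : ∀ x p, LipschitzWith L (H x p))
    (hL0 : 0 < L) (hu : IsRealSub H T₁ u) (hR : ∀ z, |u z| ≤ R)
    (hlsc : LowerSemicontinuousOn u (univ ×ˢ Icc 0 T₁))
    (hlim : ∀ x, ∀ ε > 0, ∃ᶠ t in 𝓝[>] (0 : ℝ), u (x, t) < u (x, 0) + ε) :
    ∃ C, 0 ≤ C ∧ ∀ x, ∀ σ ∈ Ioo 0 T₁, upperEnv u (x, σ) ≤ u (x, 0) + C * σ := by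
  suffices Hs : ∃ C, 0 ≤ C ∧ ∀ x ∈ (univ : Set M), ∀ σ ∈ Ioo 0 T₁,
      upperEnv u (x, σ) ≤ u (x, 0) + C * σ by
    obtain ⟨C, h1, h2⟩ := Hs
    exact ⟨C, h1, fun x => h2 x (mem_univ x)⟩
  refine isCompact_univ.induction_on (p := fun s : Set M => ∃ C, 0 ≤ C ∧ ∀ x ∈ s, ∀ σ ∈ Ioo 0 T₁,
    upperEnv u (x, σ) ≤ u (x, 0) + C * σ) ⟨0, le_rfl, by simp⟩ ?_ ?_ ?_
  · rintro s t hst ⟨C, h1, h2⟩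
    exact ⟨C, h1, fun x hx => h2 x (hst hx)⟩
  · rintro s t ⟨C, h1, h2⟩ ⟨C', h1', h2'⟩
    refine ⟨max C C', le_max_of_le_left h1, fun x hx σ hσ => ?_⟩
    have e1 := mul_le_mul_of_nonneg_right (le_max_left C C') hσ.1.le
    have e2 := mul_le_mul_of_nonneg_right (le_max_right C C') hσ.1.le
    rcases hx with hx | hx
    · have := h2 x hx σ hσ
      linarith
    · have := h2' x hx σ hσ
      linarith
  · intro x₀ _
    obtain ⟨Ω, hΩt, hx₀Ω, hΩ⟩ := hH.localHam hL hL0 x₀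
    set e := extChartAt (𝓡 n) x₀ with he
    have hsub : Ω ×ˢ Ioo 0 T₁ ⊆ e.target ×ˢ Ioo 0 T₁ := prod_mono_left hΩt
    obtain ⟨α, hα, C, hC, ρ, hρ, hsp⟩ := ((hu x₀).mono hsub).spread hΩ hx₀Ω
      ((lsc_chart hlsc x₀).mono hsub) (R := R) fun q => hR _
    have hcont : ∀ y ∈ e.source, ContinuousAt e y := fun y hy =>
      continuousAt_extChartAt' hy
    have hV : ∀ᶠ x in 𝓝 x₀, x ∈ e.source ∧ e x ∈ Metric.ball (e x₀) ρ :=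
      Filter.Eventually.and (extChartAt_source_mem_nhds x₀)
        ((hcont x₀ (mem_extChartAt_source x₀)).eventually (Metric.ball_mem_nhds _ hρ))
    refine ⟨_, mem_nhdsWithin_of_mem_nhds hV, C, hC, ?_⟩
    rintro x ⟨hxs, hxb⟩ σ hσ
    -- Every point near `(x, σ)` is reached from `(x, t₁)` along a slow line, so `SubBelow.spread`
    -- bounds the envelope by a value on the vertical line through `x`. Then `t₁` is taken small,
    -- where `hlim` makes that value close to the datum.
    have key : ∀ t₁, 0 < t₁ → t₁ < σ → upperEnv u (x, σ) ≤ u (x, t₁) + C * σ := by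
      intro t₁ ht₁ ht₁σ
      refine upperEnv_le hR ?_
      have c1 : ContinuousAt (fun z : M × ℝ => e z.1) (x, σ) :=
        ContinuousAt.comp (f := Prod.fst) (hcont x hxs) continuousAt_fst
      have e1 : ∀ᶠ z : M × ℝ in 𝓝 (x, σ), z.1 ∈ e.source :=
        continuousAt_fst.eventually ((isOpen_extChartAt_source x₀).mem_nhds hxs)
      have e2 : ∀ᶠ z : M × ℝ in 𝓝 (x, σ), e z.1 ∈ Metric.ball (e x₀) ρ :=
        c1.eventually (Metric.isOpen_ball.mem_nhds hxb)
      have e3 : ∀ᶠ z : M × ℝ in 𝓝 (x, σ), z.2 ∈ Ioo t₁ (min T₁ (σ + t₁)) :=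
        continuousAt_snd.eventually (isOpen_Ioo.mem_nhds ⟨ht₁σ, lt_min hσ.2 (by simpa using ht₁)⟩)
      have e4 : ∀ᶠ z : M × ℝ in 𝓝 (x, σ), ‖e z.1 - e x‖ - α * (z.2 - t₁) < 0 := by
        refine ((c1.sub continuousAt_const).norm.sub (by fun_prop)).eventually_lt_const ?_
        show ‖e x - e x‖ - α * (σ - t₁) < 0
        rw [sub_self, norm_zero, zero_sub, neg_lt_zero]
        exact mul_pos hα (by linarith)
      filter_upwards [e1, e2, e3, e4] with z h1 h2 h3 h4
      have h5 := hsp (e x) hxb (e z.1) h2 t₁ z.2 ht₁ h3.1 (h3.2.trans_le (min_le_left _ _))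
        (by linarith)
      simp only at h5
      rw [e.left_inv h1, e.left_inv hxs] at h5
      have h6 : z.2 - t₁ ≤ σ := by linarith [h3.2.trans_le (min_le_right _ _)]
      have h7 := mul_le_mul_of_nonneg_left h6 hC
      exact h5.trans (by linarith)
    refine le_of_forall_pos_le_add fun ε hε => ?_
    have h1 : ∀ᶠ t in 𝓝[>] (0 : ℝ), t ∈ Ioo 0 σ := Ioo_mem_nhdsGT hσ.1
    obtain ⟨t, h2, h3⟩ := ((hlim x ε hε).and_eventually h1).exists
    have := key t h3.1 h3.2
    linarith

lemma usc_sub_lsc {X : Type*} [TopologicalSpace X] {f g : X → ℝ} {s : Set X}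
    (hf : UpperSemicontinuousOn f s) (hg : LowerSemicontinuousOn g s) :
    UpperSemicontinuousOn (fun x => f x - g x) s := by
  have h1 : UpperSemicontinuousOn (fun x => -g x) s := by
    intro x hx c hc
    filter_upwards [hg x hx (-c) (by linarith)] with y hy
    have : -c < g y := hy
    linarith
  simpa [sub_eq_add_neg] using hf.add h1

lemma hasDerivAt_weight (lam T' m t : ℝ) (ht : t < T') :
    HasDerivAt (fun t => m * (Real.exp (lam * t) / (T' - t)))
      (lam * (m * (Real.exp (lam * t) / (T' - t))) + m * (Real.exp (lam * t) / (T' - t)) / (T' - t))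
      t := by
  have h1 : HasDerivAt (fun t => Real.exp (lam * t)) (Real.exp (lam * t) * lam) t := by
    have := ((hasDerivAt_id t).const_mul lam).exp
    simpa using this
  have h2 : HasDerivAt (fun t : ℝ => T' - t) (-1) t := by
    simpa using (hasDerivAt_id t).const_sub T'
  have h3 : T' - t ≠ 0 := (sub_pos.2 ht).ne'
  have := (h1.fun_div h2 h3).const_mul m
  convert! this using 1
  field_simp
  ring

set_option maxHeartbeats 1000000 in
/-- The doubling argument on the manifold: a weighted bound for the difference of a shifted upper
envelope and a supersolution. -/
lemma weighted_bound (hH : IsHamiltonian H) (hL : ∀ x p, LipschitzWith L (H x p))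
    (hL0 : 0 < L) (hu : IsRealSub H T₁ u) (hv : IsRealSup H T₁ v) (huR : ∀ z, |u z| ≤ R)
    (hvR : ∀ z, |v z| ≤ R) (hul : LowerSemicontinuousOn u (univ ×ˢ Icc 0 T₁))
    (hvl : LowerSemicontinuousOn v (univ ×ˢ Icc 0 T₁)) {σ T' m₀ : ℝ} (hσ : 0 < σ) (hT' : 0 < T')
    (hT'σ : T' + σ < T₁) (hm₀ : 0 ≤ m₀)
    (hinit : ∀ x, (upperEnv u (x, σ) - v (x, 0)) * T' ≤ m₀) (x : M) (t : ℝ) (ht : 0 ≤ t)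
    (htT' : t < T') :
    (upperEnv u (x, t + σ) - v (x, t)) * ((T' - t) * Real.exp (-((L + 1) * t))) ≤ m₀ := by
  by_contra! hcon
  set lam : ℝ := L + 1 with hlam
  have hLpos : (0 : ℝ) < L := by exact_mod_cast hL0
  set U : M × ℝ → ℝ := fun z => upperEnv u (z.1, z.2 + σ) with hU
  have hUusc : UpperSemicontinuous U := by
    intro z c hc
    have : Continuous (fun z : M × ℝ => (z.1, z.2 + σ)) := by fun_prop
    exact (this.tendsto z).eventually (upperSemicontinuous_upperEnv huR _ c hc)
  have hUR : ∀ z, |U z| ≤ R := fun z => abs_upperEnv_le huR _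
  -- The factor `T' - t` vanishes at the final time, so a positive maximum of the weighted
  -- difference cannot sit near it; the exponential rate `L + 1` beats the Lipschitz constant in the
  -- unknown.
  set w : ℝ → ℝ := fun t => (T' - t) * Real.exp (-(lam * t)) with hw
  have hwc : Continuous w := by fun_prop
  have hwpos : ∀ t, t < T' → 0 < w t := fun t ht => mul_pos (sub_pos.2 ht) (Real.exp_pos _)
  have hdiffR : ∀ x t s, U (x, t) - v (x, s) ≤ 2 * R := fun x t s => by
    have h1 := (abs_le.1 (hUR (x, t))).2
    have h2 := (abs_le.1 (hvR (x, s))).1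
    linarith
  have hR0 : 0 ≤ R := (abs_nonneg _).trans (huR (x, 0))
  set m₁ := (U (x, t) - v (x, t)) * w t with hm₁
  have hm₁0 : m₀ < m₁ := hcon
  have hm₁pos : 0 < m₁ := hm₀.trans_lt hm₁0
  -- choice of the upper time
  obtain ⟨T'', hT''t, hT''T', hT''w⟩ : ∃ T'', t < T'' ∧ T'' < T' ∧ (2 * R + 1) * w T'' < m₁ := by
    have h1 : Tendsto (fun s => (2 * R + 1) * w s) (𝓝[<] T') (𝓝 ((2 * R + 1) * w T')) :=
      ((continuous_const.mul hwc).tendsto T').mono_left nhdsWithin_le_nhds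
    have h2 : (2 * R + 1) * w T' = 0 := by simp [hw]
    rw [h2] at h1
    obtain ⟨s, hs1, hs2⟩ := ((h1.eventually_lt_const hm₁pos).and (Ioo_mem_nhdsLT htT')).exists
    exact ⟨s, hs2.1, hs2.2, hs1⟩
  have hT''0 : 0 < T'' := ht.trans_lt hT''t
  have hT'T₁ : T' < T₁ := by linarith
  -- maximum of the weighted difference
  have hKc : IsCompact ((univ : Set M) ×ˢ Icc 0 T'') := isCompact_univ.prod isCompact_Icc
  have hKsub : (univ : Set M) ×ˢ Icc 0 T'' ⊆ univ ×ˢ Icc 0 T₁ :=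
    prod_mono_right (Icc_subset_Icc_right (by linarith))
  have hmul : UpperSemicontinuousOn (fun z : M × ℝ => (U z - v z) * w z.2)
      ((univ : Set M) ×ˢ Icc 0 T'') := by
    have h1 := usc_sub_lsc (hUusc.upperSemicontinuousOn _) (hvl.mono hKsub)
    have h2 : LowerSemicontinuousOn (fun z : M × ℝ => w z.2 * (-(U z - v z)))
        ((univ : Set M) ×ˢ Icc 0 T'') := by
      refine lsc_mul_continuous ?_ (hwc.comp continuous_snd).continuousOn
        fun z hz => hwpos _ (hz.2.2.trans_lt hT''T')
      intro z hz c hc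
      filter_upwards [h1 z hz (-c) (by linarith)] with y hy
      have : U y - v y < -c := hy
      linarith
    intro z hz c hc
    filter_upwards [h2 z hz (-c) (by simp only at hc ⊢; linarith)] with y hy
    have : -c < w y.2 * (-(U y - v y)) := hy
    linarith
  obtain ⟨zm, hzm, hmaxm⟩ := hmul.exists_isMaxOn
    ⟨(x, t), (⟨mem_univ _, ht, hT''t.le⟩ : (x, t) ∈ (univ : Set M) ×ˢ Icc 0 T'')⟩ hKc
  set m := (U zm - v zm) * w zm.2 with hm
  have hm₁m : m₁ ≤ m := hmaxm (show (x, t) ∈ (univ : Set M) ×ˢ Icc 0 T'' from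
    ⟨mem_univ _, ht, hT''t.le⟩)
  have hmpos : 0 < m := hm₁pos.trans_le hm₁m
  set g : ℝ → ℝ := fun t => m * (Real.exp (lam * t) / (T' - t)) with hg
  have hgw : ∀ t, t < T' → g t * w t = m := by
    intro t ht
    have h1 : T' - t ≠ 0 := (sub_pos.2 ht).ne'
    simp only [hg, hw, Real.exp_neg]
    field_simp
  have hgT : ∀ t, 0 ≤ t → t < T' → m / T' ≤ g t := by
    intro t ht0 ht
    simp only [hg, div_eq_mul_inv]
    refine mul_le_mul_of_nonneg_left ?_ hmpos.le
    have h1 : 1 ≤ Real.exp (lam * t) := Real.one_le_exp (by positivity)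
    have h2 : T'⁻¹ ≤ (T' - t)⁻¹ := inv_anti₀ (sub_pos.2 ht) (by linarith)
    have h3 : 0 ≤ T'⁻¹ := by positivity
    nlinarith
  have hdiag : ∀ y s, 0 ≤ s → s ≤ T'' → U (y, s) - v (y, s) ≤ g s := by
    intro y s h0 h1
    have h2 : (U (y, s) - v (y, s)) * w s ≤ m :=
      hmaxm (show (y, s) ∈ (univ : Set M) ×ˢ Icc 0 T'' from ⟨mem_univ _, h0, h1⟩)
    rw [← hgw s (h1.trans_lt hT''T')] at h2
    exact le_of_mul_le_mul_right h2 (hwpos s (h1.trans_lt hT''T'))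
  -- doubling the time variable
  set S : Set (M × ℝ × ℝ) := univ ×ˢ (Icc 0 T'' ×ˢ Icc 0 T') with hS
  have hSc : IsCompact S := isCompact_univ.prod (isCompact_Icc.prod isCompact_Icc)
  set Ψ : M × ℝ × ℝ → ℝ := fun a => U (a.1, a.2.1) - v (a.1, a.2.2) - g a.2.1 with hΨ
  set pen : M × ℝ × ℝ → ℝ := fun a => (a.2.1 - a.2.2) ^ 2 with hpen
  have hΨc : UpperSemicontinuousOn Ψ S := by
    have h1 : UpperSemicontinuousOn (fun a : M × ℝ × ℝ => U (a.1, a.2.1)) S := by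
      intro a ha c hc
      have : Continuous (fun a : M × ℝ × ℝ => (a.1, a.2.1)) := by fun_prop
      exact mem_nhdsWithin_of_mem_nhds ((this.tendsto a).eventually (hUusc _ c hc))
    have h2 : LowerSemicontinuousOn (fun a : M × ℝ × ℝ => v (a.1, a.2.2)) S := by
      intro a ha c hc
      have h3 : ContinuousWithinAt (fun a : M × ℝ × ℝ => (a.1, a.2.2)) S a :=
        Continuous.continuousWithinAt (by fun_prop)
      have h4 : (a.1, a.2.2) ∈ (univ : Set M) ×ˢ Icc 0 T₁ :=
        ⟨mem_univ _, ha.2.2.1, ha.2.2.2.trans hT'T₁.le⟩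
      have h5 := h3.tendsto_nhdsWithin (t := (univ : Set M) ×ˢ Icc 0 T₁)
        fun b hb => ⟨mem_univ _, hb.2.2.1, hb.2.2.2.trans hT'T₁.le⟩
      exact h5.eventually (hvl _ h4 c hc)
    have h3 : ContinuousOn (fun a : M × ℝ × ℝ => g a.2.1) S := by
      refine continuousOn_const.mul (ContinuousOn.div (by fun_prop) (by fun_prop) fun a ha => ?_)
      exact (sub_pos.2 (ha.2.1.2.trans_lt hT''T')).ne'
    exact usc_sub_lsc (usc_sub_lsc h1 h2) h3.lowerSemicontinuousOn
  have hpenc : Continuous pen := by fun_prop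
  have hpen0 : ∀ a : M × ℝ × ℝ, pen a = 0 → a.2.2 = a.2.1 := fun a ha =>
    (sub_eq_zero.1 (pow_eq_zero_iff two_ne_zero |>.1 ha)).symm
  -- With this choice the doubling error `2 * L * η` equals `m / (2 * T')`, less than the lower
  -- bound `m / T'` for `g`.
  set η := m / (4 * L * T') with hη
  have hηpos : 0 < η := by positivity
  obtain ⟨N₁, hN₁, hN₁'⟩ := exists_penalty hSc hΨc hpenc.continuousOn
    (fun a _ => sq_nonneg _) (m := η) (by
      rintro ⟨y, s, s'⟩ ha h0
      have hs : s' = s := hpen0 _ h0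
      subst hs
      have := hdiag y s' ha.2.1.1 ha.2.1.2
      simp only [hΨ]
      linarith)
  -- On the diagonal, the time faces `0` are excluded by the initial bound, the face `T''` by the
  -- small weight there, and the face `T'` by `T'' < T'`. A large penalty extends the exclusion off
  -- the diagonal.
  set B : Set (M × ℝ × ℝ) := S ∩ {a | a.2.1 = 0 ∨ a.2.2 = 0 ∨ a.2.1 = T'' ∨ a.2.2 = T'} with hB
  have hBc : IsCompact B := by
    refine hSc.inter_right ?_
    have c1 : Continuous (fun a : M × ℝ × ℝ => a.2.1) := by fun_prop
    have c2 : Continuous (fun a : M × ℝ × ℝ => a.2.2) := by fun_prop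
    exact (isClosed_eq c1 continuous_const).union ((isClosed_eq c2 continuous_const).union
      ((isClosed_eq c1 continuous_const).union (isClosed_eq c2 continuous_const)))
  have hBS : B ⊆ S := inter_subset_left
  have hzero : ∀ y, U (y, 0) - v (y, 0) - g 0 < 0 := by
    intro y
    have h1 := hinit y
    have h2 : U (y, 0) = upperEnv u (y, σ) := by simp [hU]
    rw [← h2] at h1
    have h3 : g 0 * T' = m := by simp [hg]; field_simp
    have h4 : (U (y, 0) - v (y, 0)) * T' < g 0 * T' := by
      rw [h3]; exact h1.trans_lt (hm₁0.trans_le hm₁m)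
    linarith [lt_of_mul_lt_mul_right h4 hT'.le]
  have htop : ∀ y s, U (y, T'') - v (y, s) - g T'' < 0 := by
    intro y s
    have h1 := hdiffR y T'' s
    have h2 : (2 * R + 1) * w T'' < g T'' * w T'' := by
      rw [hgw T'' hT''T']; exact hT''w.trans_le hm₁m
    linarith [lt_of_mul_lt_mul_right h2 (hwpos T'' hT''T').le]
  obtain ⟨N₂, hN₂, hN₂'⟩ := exists_penalty hBc (hΨc.mono hBS) hpenc.continuousOn
    (fun a _ => sq_nonneg _) (m := 0) (by
      rintro ⟨y, s, s'⟩ ⟨haS, ha⟩ h0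
      have hs : s' = s := hpen0 _ h0
      subst hs
      simp only [hΨ]
      rcases ha with ha | ha | ha | ha
      · simp only at ha; rw [ha]; exact hzero y
      · simp only at ha; rw [ha]; exact hzero y
      · simp only at ha; rw [ha]; exact htop y T''
      · have : s' ≤ T'' := haS.2.1.2
        simp only at ha
        linarith)
  set N := max N₁ N₂ with hN
  have hN0 : 0 ≤ N := le_max_of_le_left hN₁
  -- The factor `2` yields an upper bound on `Ψ` itself: at the maximum `Ψ - 2 * N * pen ≥ 0`, while
  -- `Ψ - N * pen < η` everywhere, so twice the second minus the first gives `Ψ < 2 * η`.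
  have hΦc : UpperSemicontinuousOn (fun a => Ψ a - 2 * N * pen a) S :=
    usc_sub_lsc hΨc (continuous_const.mul hpenc).continuousOn.lowerSemicontinuousOn
  have hzmS : (zm.1, zm.2, zm.2) ∈ S :=
    ⟨mem_univ _, hzm.2, hzm.2.1, hzm.2.2.trans hT''T'.le⟩
  obtain ⟨⟨x₀, t₀, s₀⟩, haS, hamax⟩ := hΦc.exists_isMaxOn ⟨_, hzmS⟩ hSc
  have hval : 0 ≤ Ψ (x₀, t₀, s₀) - 2 * N * pen (x₀, t₀, s₀) := by
    have h1 : Ψ (zm.1, zm.2, zm.2) - 2 * N * pen (zm.1, zm.2, zm.2) ≤ _ := hamax hzmS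
    have h2 : (U zm - v zm) * w zm.2 = g zm.2 * w zm.2 := by
      rw [hgw zm.2 (hzm.2.2.trans_lt hT''T')]
    have h3 := mul_right_cancel₀ (hwpos zm.2 (hzm.2.2.trans_lt hT''T')).ne' h2
    have h4 : Ψ (zm.1, zm.2, zm.2) - 2 * N * pen (zm.1, zm.2, zm.2) = 0 := by
      simp only [hΨ, hpen, Prod.mk.eta]
      rw [h3]
      simp
    linarith
  have hpennn : 0 ≤ pen (x₀, t₀, s₀) := sq_nonneg _
  have hnotB : (x₀, t₀, s₀) ∉ B := fun hmem => by
    have := hN₂' (2 * N) (by linarith [le_max_right N₁ N₂]) _ hmem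
    linarith
  have hΨη : Ψ (x₀, t₀, s₀) < 2 * η := by
    have := hN₁' N (le_max_left _ _) _ haS
    linarith
  have hΨ0 : 0 ≤ Ψ (x₀, t₀, s₀) := by
    have := mul_nonneg (by linarith : 0 ≤ 2 * N) hpennn
    linarith
  have hne : t₀ ≠ 0 ∧ s₀ ≠ 0 ∧ t₀ ≠ T'' ∧ s₀ ≠ T' := by
    refine ⟨?_, ?_, ?_, ?_⟩ <;> intro h <;> exact hnotB ⟨haS, by simp [h]⟩
  have ht₀ : t₀ ∈ Ioo 0 T'' :=
    ⟨lt_of_le_of_ne haS.2.1.1 (Ne.symm hne.1), lt_of_le_of_ne haS.2.1.2 hne.2.2.1⟩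
  have hs₀ : s₀ ∈ Ioo 0 T' :=
    ⟨lt_of_le_of_ne haS.2.2.1 (Ne.symm hne.2.1), lt_of_le_of_ne haS.2.2.2 hne.2.2.2⟩
  have ht₀T' : t₀ < T' := ht₀.2.trans hT''T'
  -- doubling the space variable in a chart
  obtain ⟨Ω, hΩt, hx₀Ω, hΩ⟩ := hH.localHam hL hL0 x₀
  set e := extChartAt (𝓡 n) x₀ with he
  have hex₀ : e.symm (e x₀) = x₀ := extChartAt_to_inv x₀
  set D₁ : Set (EuclideanSpace ℝ (Fin n) × ℝ) := {q | q + (0, σ) ∈ Ω ×ˢ Ioo 0 T₁} with hD₁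
  have hD₁o : IsOpen D₁ := (hΩ.isOpen.prod isOpen_Ioo).preimage (by fun_prop)
  have hD₁Ω : ∀ q ∈ D₁, q.1 ∈ Ω := fun q hq => by
    have : q.1 + 0 ∈ Ω := hq.1
    simpa using this
  have hsub : Ω ×ˢ Ioo 0 T₁ ⊆ e.target ×ˢ Ioo 0 T₁ := prod_mono_left hΩt
  have hgd := hasDerivAt_weight lam T' m t₀ ht₀T'
  have hUl : UpperSemicontinuousOn (fun q : EuclideanSpace ℝ (Fin n) × ℝ => U (e.symm q.1, q.2))
      D₁ := by
    intro q hq c hc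
    exact mem_nhdsWithin_of_mem_nhds
      ((tendsto_chart_symm x₀ (hΩt (hD₁Ω q hq))).eventually (hUusc _ c hc))
  have hgC : ContDiffAt ℝ 1 g t₀ := by
    refine contDiffAt_const.mul (ContDiffAt.div (by fun_prop) (by fun_prop) ?_)
    exact (sub_pos.2 ht₀T').ne'
  have hfin := doubling hΩ hD₁o (hΩ.isOpen.prod isOpen_Ioo) hD₁Ω (fun q hq => hq.1) hUl
    ((lsc_chart hvl x₀).mono hsub)
    (hu.upperEnv_shift huR hul σ x₀ hΩt hΩ) (hv x₀ Ω L hΩt hΩ)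
    (z₀ := e x₀) (t₀ := t₀) (s₀ := s₀)
    (by
      refine ⟨?_, ?_, ?_⟩
      · simpa using hx₀Ω
      · simp only [Prod.snd_add]; linarith [ht₀.1]
      · simp only [Prod.snd_add]; linarith)
    ⟨hx₀Ω, hs₀.1, hs₀.2.trans hT'T₁⟩ hgC (2 * N) (by
      have hev : ∀ᶠ a : M × ℝ × ℝ in 𝓝 (x₀, t₀, s₀),
          Ψ a - 2 * N * pen a ≤ Ψ (x₀, t₀, s₀) - 2 * N * pen (x₀, t₀, s₀) := by
        have h1 : (univ : Set M) ×ˢ (Ioo 0 T'' ×ˢ Ioo 0 T') ∈ 𝓝 (x₀, t₀, s₀) :=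
          (isOpen_univ.prod (isOpen_Ioo.prod isOpen_Ioo)).mem_nhds ⟨mem_univ _, ht₀, hs₀⟩
        filter_upwards [h1] with a ha
        exact hamax ⟨mem_univ _, Ioo_subset_Icc_self ha.2.1, Ioo_subset_Icc_self ha.2.2⟩
      have hcont : Tendsto (fun a : EuclideanSpace ℝ (Fin n) × ℝ × ℝ => (e.symm a.1, a.2))
          (𝓝 (e x₀, t₀, s₀)) (𝓝 (x₀, t₀, s₀)) := by
        have h1 : ContinuousAt e.symm (e x₀) := continuousAt_extChartAt_symm x₀
        have h2 : ContinuousAt (fun a : EuclideanSpace ℝ (Fin n) × ℝ × ℝ => (e.symm a.1, a.2))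
            (e x₀, t₀, s₀) :=
          ContinuousAt.prodMk (ContinuousAt.comp (f := Prod.fst) h1 continuousAt_fst)
            continuousAt_snd
        rw [ContinuousAt, hex₀] at h2
        exact h2
      filter_upwards [hcont.eventually hev] with a ha
      simp only [hΨ, hpen] at ha
      rw [hex₀]
      exact ha)
  rw [hgd.deriv] at hfin
  have hfin' : lam * g t₀ + g t₀ / (T' - t₀) ≤ L * |U (x₀, t₀) - v (x₀, s₀)| := by
    rw [hex₀] at hfin
    exact hfin
  have hgt₀ := hgT t₀ ht₀.1.le ht₀T'
  have hgpos : 0 < g t₀ := lt_of_lt_of_le (by positivity) hgt₀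
  have hΨ0' : 0 ≤ U (x₀, t₀) - v (x₀, s₀) - g t₀ := hΨ0
  have hΨη' : U (x₀, t₀) - v (x₀, s₀) - g t₀ < 2 * η := hΨη
  rw [abs_of_nonneg (by linarith)] at hfin'
  have h1 : 0 ≤ g t₀ / (T' - t₀) := div_nonneg hgpos.le (by linarith)
  have h2 : L * (U (x₀, t₀) - v (x₀, s₀)) ≤ L * (g t₀ + 2 * η) :=
    mul_le_mul_of_nonneg_left (by linarith) hLpos.le
  have h3 : L * (2 * η) = m / T' / 2 := by rw [hη]; field_simp; norm_num
  have h4 : 0 < m / T' := by positivity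
  rw [hlam] at hfin'
  nlinarith

/-- Comparison of bounded real valued sub- and supersolutions. -/
theorem real_comparison (hH : IsHamiltonian H) (hL : ∀ x p, LipschitzWith L (H x p))
    (hL0 : 0 < L) (hu : IsRealSub H T₁ u) (hv : IsRealSup H T₁ v) (huR : ∀ z, |u z| ≤ R)
    (hvR : ∀ z, |v z| ≤ R) (hul : LowerSemicontinuousOn u (univ ×ˢ Icc 0 T₁))
    (hvl : LowerSemicontinuousOn v (univ ×ˢ Icc 0 T₁))
    (hlim : ∀ x, ∀ ε > 0, ∃ᶠ t in 𝓝[>] (0 : ℝ), u (x, t) < u (x, 0) + ε)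
    (hinit : ∀ x, u (x, 0) ≤ v (x, 0)) (x : M) {t : ℝ} (ht : 0 ≤ t) (htT : t < T₁) :
    u (x, t) ≤ v (x, t) := by
  obtain ⟨C, hC, henv⟩ := hu.exists_upperEnv_le hH hL hL0 huR hul hlim
  obtain ⟨T', htT', hT'T₁⟩ := exists_between htT
  have hT' : 0 < T' := ht.trans_lt htT'
  set W := (T' - t) * Real.exp (-((L + 1) * t)) with hW
  have hWpos : 0 < W := mul_pos (by linarith) (Real.exp_pos _)
  have key : ∀ σ, 0 < σ → T' + σ < T₁ → u (x, t + σ) ≤ v (x, t) + C * σ * T' / W := by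
    intro σ hσ hσT
    have h1 := weighted_bound hH hL hL0 hu hv huR hvR hul hvl hσ hT' hσT
      (m₀ := C * σ * T') (by positivity) (fun y => by
        have h2 := henv y σ ⟨hσ, by linarith⟩
        have h3 := hinit y
        exact mul_le_mul_of_nonneg_right (by linarith) hT'.le) x t ht htT'
    rw [← le_div_iff₀ hWpos] at h1
    have h2 := le_upperEnv huR (x, t + σ)
    linarith
  by_contra! hlt
  obtain ⟨c, hc1, hc2⟩ := exists_between hlt
  -- Lower semicontinuity of `u` undoes the time shift as `σ → 0`.
  have e1 : ∀ᶠ σ in 𝓝[>] (0 : ℝ), c < u (x, t + σ) := by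
    have h1 := hul (x, t) ⟨mem_univ _, ht, htT.le⟩ c hc2
    have h2 : Tendsto (fun σ : ℝ => (x, t + σ)) (𝓝[>] 0) (𝓝[univ ×ˢ Icc 0 T₁] (x, t)) := by
      refine tendsto_nhdsWithin_iff.2 ⟨?_, ?_⟩
      · have : Continuous (fun σ : ℝ => (x, t + σ)) := by fun_prop
        have h3 := this.tendsto 0
        rw [add_zero] at h3
        exact h3.mono_left nhdsWithin_le_nhds
      · filter_upwards [Ioo_mem_nhdsGT (sub_pos.2 htT)] with σ hσ
        exact ⟨mem_univ _, by linarith [hσ.1], by linarith [hσ.2]⟩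
    exact h2.eventually h1
  have e2 : ∀ᶠ σ in 𝓝[>] (0 : ℝ), v (x, t) + C * σ * T' / W < c := by
    have h1 : Continuous (fun σ : ℝ => v (x, t) + C * σ * T' / W) := by fun_prop
    exact ((h1.tendsto 0).mono_left nhdsWithin_le_nhds).eventually_lt_const (by simpa using hc1)
  obtain ⟨σ, h1, h2, h3⟩ := (e1.and (e2.and (Ioo_mem_nhdsGT (sub_pos.2 hT'T₁)))).exists
  have := key σ h3.1 (by linarith [h3.2])
  linarith

end Comparison

end HJ

namespace HJ

/-! ### Barriers and control at the initial time -/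

section Barriers

set_option linter.unusedSectionVars false

variable {n : ℕ} {M : Type*} [TopologicalSpace M] [ChartedSpace (EuclideanSpace ℝ (Fin n)) M]
  [IsManifold (𝓡 n) ∞ M]

/-- The differential of a function on `M`, as a covector. -/
noncomputable def covDiff (n : ℕ) {M : Type*} [TopologicalSpace M]
    [ChartedSpace (EuclideanSpace ℝ (Fin n)) M] (f : M → ℝ) (x : M) : Cotangent n x :=
  mfderiv (𝓡 n) 𝓘(ℝ, ℝ) f x

lemma covDiff_const (c : ℝ) (x : M) : covDiff n (fun _ : M => c) x = 0 := mfderiv_const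

lemma contDiffAt_chart {f : M → ℝ} (hf : ContMDiff (𝓡 n) 𝓘(ℝ, ℝ) 1 f) (x₀ : M)
    {z : EuclideanSpace ℝ (Fin n)} (hz : z ∈ (extChartAt (𝓡 n) x₀).target) :
    ContDiffAt ℝ 1 (fun z => f ((extChartAt (𝓡 n) x₀).symm z)) z := by
  have : IsManifold (𝓡 n) 1 M := IsManifold.of_le (n := ∞) (by simp)
  have h1 : ContMDiffAt 𝓘(ℝ, EuclideanSpace ℝ (Fin n)) (𝓡 n) 1 (extChartAt (𝓡 n) x₀).symm z :=
    (contMDiffOn_extChartAt_symm x₀).contMDiffAt ((isOpen_extChartAt_target x₀).mem_nhds hz)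
  exact (hf.contMDiffAt.comp z h1).contDiffAt

lemma covDiff_eq_chartCovector {f : M → ℝ} (hf : ContMDiff (𝓡 n) 𝓘(ℝ, ℝ) 1 f) {x₀ x : M}
    (hx : x ∈ (extChartAt (𝓡 n) x₀).source) :
    covDiff n f x = chartCovector x₀ x
      (fderiv ℝ (fun z => f ((extChartAt (𝓡 n) x₀).symm z)) (extChartAt (𝓡 n) x₀ x)) := by
  have h1 := (contDiffAt_chart hf x₀ ((extChartAt (𝓡 n) x₀).map_source hx)).differentiableAt
    (by norm_num)
  rw [← mfderiv_comp_extChartAt (by simpa using hx) h1]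
  refine Filter.EventuallyEq.mfderiv_eq ?_
  filter_upwards [(isOpen_extChartAt_source x₀).mem_nhds hx] with y hy
  rw [(extChartAt (𝓡 n) x₀).left_inv hy]

lemma continuous_covDiff {f : M → ℝ} (hf : ContMDiff (𝓡 n) 𝓘(ℝ, ℝ) 1 f) :
    Continuous (fun x => (⟨x, covDiff n f x⟩ : CotangentBundle n M)) := by
  refine continuous_iff_continuousAt.2 fun x₀ => ?_
  set e := extChartAt (𝓡 n) x₀ with he
  have hs : e.source ∈ 𝓝 x₀ := extChartAt_source_mem_nhds x₀
  have h0 : x₀ ∈ e.source := mem_extChartAt_source x₀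
  have h1 : ContinuousAt (fun x => fderiv ℝ (fun z => f (e.symm z)) (e x)) x₀ := by
    have h2 := (contDiffAt_chart hf x₀ (e.map_source h0)).continuousAt_fderiv (by norm_num)
    exact ContinuousAt.comp h2 (continuousAt_extChartAt x₀)
  have h3 : ContinuousAt (fun q : M × (EuclideanSpace ℝ (Fin n) →L[ℝ] ℝ) =>
      (⟨q.1, chartCovector x₀ q.1 q.2⟩ : CotangentBundle n M))
      (x₀, fderiv ℝ (fun z => f (e.symm z)) (e x₀)) := by
    refine (continuousOn_chartCovector x₀).continuousAt (prod_mem_nhds ?_ univ_mem)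
    exact chart_source_mem_nhds _ x₀
  have h4 := ContinuousAt.comp (f := fun x => (x, fderiv ℝ (fun z => f (e.symm z)) (e x))) h3
    (continuousAt_id.prodMk h1)
  refine h4.congr ?_
  filter_upwards [hs] with x hx
  simp only [Function.comp, covDiff_eq_chartCovector hf hx]
  rfl

variable [RiemannianBundle (fun x : M => TangentSpace (𝓡 n) x)]
  {H : (x : M) → Cotangent n x → ℝ → ℝ} {L : ℝ≥0} {T₁ : ℝ}

lemma IsHamiltonian.exists_abs_le [CompactSpace M] (hH : IsHamiltonian H) {f : M → ℝ}
    (hf : ContMDiff (𝓡 n) 𝓘(ℝ, ℝ) 1 f) : ∃ C, 0 ≤ C ∧ ∀ x, |H x (covDiff n f x) 0| ≤ C := by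
  have h1 : Continuous fun x : M => H x (covDiff n f x) 0 :=
    hH.continuous.comp ((continuous_covDiff hf).prodMk continuous_const)
  obtain ⟨C, hC⟩ := isCompact_univ.exists_bound_of_continuousOn h1.continuousOn
  exact ⟨max C 0, le_max_right _ _, fun x => (hC x (mem_univ x)).trans (le_max_left _ _)⟩

lemma abs_sub_zero_le_of_lipschitz (hL : ∀ x p, LipschitzWith L (H x p)) (x : M) (p : Cotangent n x)
    (r : ℝ) : |H x p r - H x p 0| ≤ L * |r| := by
  simpa [Real.dist_eq] using (hL x p).dist_le_mul r 0

/-- Truncation levels: a large subsolution and a large supersolution depending on time only. -/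
lemma exists_time_barriers [CompactSpace M] (hH : IsHamiltonian H)
    (hL : ∀ x p, LipschitzWith L (H x p)) (T₁ b : ℝ) :
    ∃ W V : ℝ → ℝ, Differentiable ℝ W ∧ Differentiable ℝ V ∧
      (∀ x : M, ∀ t ∈ Ioo 0 T₁, deriv W t + H x 0 (W t) ≤ 0) ∧
      (∀ x : M, ∀ t ∈ Ioo 0 T₁, 0 ≤ deriv V t + H x 0 (V t)) ∧ W 0 = V 0 ∧
      ∀ t ∈ Icc 0 T₁, b < W t := by
  obtain ⟨C, hC, hCb⟩ := hH.exists_abs_le (contMDiff_const (c := (0 : ℝ)))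
  simp only [covDiff_const] at hCb
  set lam : ℝ := L + 1 with hlam
  have hL0 : (0 : ℝ) ≤ L := L.2
  -- This size keeps the decaying barrier above `C + |b| + 1` up to time `T₁`. The rate `L + 1`
  -- leaves a term `∓ W` or `∓ V` after the Lipschitz estimate, which dominates `C`. Both barriers
  -- equal `N` at time `0`, so truncation keeps the order of the data.
  set N := (C + |b| + 1) * Real.exp (lam * T₁) with hN
  have hNpos : 0 < N := by positivity
  have hd : ∀ a t : ℝ, HasDerivAt (fun t => N * Real.exp (a * t)) (N * (Real.exp (a * t) * a)) t :=
    fun a t => by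
      have := (((hasDerivAt_id t).const_mul a).exp).const_mul N
      simpa using this
  have hWb : ∀ t ≤ T₁, C + |b| + 1 ≤ N * Real.exp (-lam * t) := fun t ht => by
    rw [hN, mul_assoc, ← Real.exp_add]
    refine le_mul_of_one_le_right (by positivity) (Real.one_le_exp ?_)
    have : 0 ≤ lam * (T₁ - t) := mul_nonneg (by positivity) (by linarith)
    linarith
  refine ⟨fun t => N * Real.exp (-lam * t), fun t => N * Real.exp (lam * t),
    fun t => (hd _ t).differentiableAt, fun t => (hd _ t).differentiableAt, ?_, ?_, by simp, ?_⟩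
  · intro x t ht
    rw [(hd _ t).deriv]
    have h1 := (abs_le.1 (abs_sub_zero_le_of_lipschitz hL x 0 (N * Real.exp (-lam * t)))).2
    rw [abs_of_pos (by positivity)] at h1
    have h2 := (abs_le.1 (hCb x)).2
    have h3 := hWb t ht.2.le
    have h4 := abs_nonneg b
    rw [hlam] at *
    linarith
  · intro x t ht
    rw [(hd _ t).deriv]
    have h1 := (abs_le.1 (abs_sub_zero_le_of_lipschitz hL x 0 (N * Real.exp (lam * t)))).1
    rw [abs_of_pos (by positivity)] at h1
    have h2 := (abs_le.1 (hCb x)).1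
    have h3 : N * Real.exp (-lam * t) ≤ N * Real.exp (lam * t) := by
      refine mul_le_mul_of_nonneg_left (Real.exp_le_exp.2 ?_) hNpos.le
      have : 0 ≤ lam * t := mul_nonneg (by positivity) ht.1.le
      linarith
    have h5 := hWb t ht.2.le
    have h4 := abs_nonneg b
    rw [hlam] at *
    linarith
  · intro t ht
    have := hWb t ht.2
    have h4 := le_abs_self b
    linarith

/-- A classical subsolution with separated variables. -/
lemma isRealSub_of_classical {f : M → ℝ} (hf : ContMDiff (𝓡 n) 𝓘(ℝ, ℝ) 1 f) {ρ ρ' : ℝ → ℝ}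
    (hρ : ∀ t ∈ Ioo 0 T₁, HasDerivAt ρ (ρ' t) t)
    (h : ∀ x, ∀ t ∈ Ioo 0 T₁, ρ' t + H x (covDiff n f x) (f x + ρ t) ≤ 0) :
    IsRealSub H T₁ (fun z => f z.1 + ρ z.2) := by
  intro x₀ q hq ψ₀ hψ₀ hmin
  set e := extChartAt (𝓡 n) x₀ with he
  have hF : HasFDerivAt (fun z => f (e.symm z)) (fderiv ℝ (fun z => f (e.symm z)) q.1) q.1 :=
    ((contDiffAt_chart hf x₀ hq.1).differentiableAt (by norm_num)).hasFDerivAt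
  have h1 : HasFDerivAt (fun z : EuclideanSpace ℝ (Fin n) × ℝ => f (e.symm z.1))
      ((fderiv ℝ (fun z => f (e.symm z)) q.1).comp (.fst ℝ (EuclideanSpace ℝ (Fin n)) ℝ)) q :=
    HasFDerivAt.comp q hF hasFDerivAt_fst
  have h2 : HasFDerivAt (fun z : EuclideanSpace ℝ (Fin n) × ℝ => ρ z.2)
      ((ContinuousLinearMap.toSpanSingleton ℝ (ρ' q.2)).comp
        (.snd ℝ (EuclideanSpace ℝ (Fin n)) ℝ)) q :=
    (hρ _ hq.2).hasFDerivAt.comp q hasFDerivAt_snd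
  have h0 := IsLocalMin.hasFDerivAt_eq_zero hmin
    ((h1.fun_add h2).fun_sub (hψ₀.differentiableAt (by norm_num)).hasFDerivAt)
  have h3 := covDiff_eq_chartCovector hf (e.map_target hq.1)
  rw [← he, e.right_inv hq.1] at h3
  have h4 := h (e.symm q.1) q.2 hq.2
  rw [h3] at h4
  rw [← sub_eq_zero.1 h0]
  have h5 : ((fderiv ℝ (fun z => f (e.symm z)) q.1).comp
      (.fst ℝ (EuclideanSpace ℝ (Fin n)) ℝ) + (ContinuousLinearMap.toSpanSingleton ℝ (ρ' q.2)).comp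
        (.snd ℝ (EuclideanSpace ℝ (Fin n)) ℝ)).comp (.inl ℝ (EuclideanSpace ℝ (Fin n)) ℝ) =
      fderiv ℝ (fun z => f (e.symm z)) q.1 := by
    ext v
    simp
  rw [h5]
  have h6 : ((fderiv ℝ (fun z => f (e.symm z)) q.1).comp (.fst ℝ (EuclideanSpace ℝ (Fin n)) ℝ) +
      (ContinuousLinearMap.toSpanSingleton ℝ (ρ' q.2)).comp
        (.snd ℝ (EuclideanSpace ℝ (Fin n)) ℝ)) (0, 1) = ρ' q.2 := by simp
  rw [h6]
  exact h4

variable [CompactSpace M] [T2Space M]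
  [IsContMDiffRiemannianBundle (𝓡 n) ∞ (EuclideanSpace ℝ (Fin n))
    (fun x : M => TangentSpace (𝓡 n) x)]

/-- Supersolutions decrease from smooth initial lower bounds at a uniform rate. -/
lemma IsHamiltonian.exists_initial_barrier (hH : IsHamiltonian H)
    (hL : ∀ x p, LipschitzWith L (H x p)) (hL0 : 0 < L) (hT₁ : 0 < T₁) {f : M → ℝ}
    (hf : ContMDiff (𝓡 n) 𝓘(ℝ, ℝ) 1 f) :
    ∃ K, 0 ≤ K ∧ ∀ (v : M × ℝ → ℝ) (R : ℝ), IsRealSup H T₁ v → (∀ z, |v z| ≤ R) →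
      LowerSemicontinuousOn v (univ ×ˢ Icc 0 T₁) → (∀ x, f x ≤ v (x, 0)) →
      ∀ x t, 0 ≤ t → t < T₁ → f x - K * (Real.exp ((L + 1) * t) - 1) ≤ v (x, t) := by
  obtain ⟨C, hC, hCb⟩ := hH.exists_abs_le hf
  obtain ⟨B, hB⟩ := isCompact_univ.exists_bound_of_continuousOn hf.continuous.continuousOn
  have hL0' : (0 : ℝ) < L := hL0
  set lam : ℝ := L + 1 with hlam
  -- `K` bounds `H x (covDiff n f x) (f x)`, so `f - K * (exp ((L + 1) * t) - 1)` is a classical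
  -- subsolution. It depends on `f` and `H` but not on `v`, which makes the barrier uniform over
  -- families of supersolutions.
  set K := C + L * |B| with hK
  have hK0 : 0 ≤ K := by positivity
  have hBf : ∀ x, |f x| ≤ |B| := fun x => (hB x (mem_univ x)).trans (le_abs_self B)
  refine ⟨K, hK0, fun v R hv hvR hvl hfv x t ht htT => ?_⟩
  -- Clamping time keeps the barrier bounded for all real times, as `real_comparison` requires, and
  -- changes nothing on `[0, T₁]`.
  set cl : ℝ → ℝ := fun t => max 0 (min t T₁) with hcl
  have hclm : ∀ t, 0 ≤ cl t ∧ cl t ≤ T₁ := fun t =>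
    ⟨le_max_left _ _, max_le hT₁.le (min_le_right _ _)⟩
  have hclt : ∀ t, 0 ≤ t → t ≤ T₁ → cl t = t := fun t h0 h1 => by
    simp only [hcl]
    rw [min_eq_left h1, max_eq_right h0]
  set ρ : ℝ → ℝ := fun t => -(K * (Real.exp (lam * cl t) - 1)) with hρ
  have hclc : Continuous cl := by fun_prop
  have hρc : Continuous ρ := by fun_prop
  have hexp : ∀ t, 1 ≤ Real.exp (lam * cl t) := fun t =>
    Real.one_le_exp (mul_nonneg (by positivity) (hclm t).1)
  have hρ' : ∀ t ∈ Ioo 0 T₁, HasDerivAt ρ (-(K * (Real.exp (lam * t) * lam))) t := by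
    intro t ht
    have h1 : HasDerivAt (fun t => -(K * (Real.exp (lam * t) - 1)))
        (-(K * (Real.exp (lam * t) * lam))) t := by
      have := ((((((hasDerivAt_id t).const_mul lam).exp).sub_const 1).const_mul K)).fun_neg
      simpa using this
    refine h1.congr_of_eventuallyEq ?_
    filter_upwards [isOpen_Ioo.mem_nhds ht] with s hs
    simp only [hρ, hclt s hs.1.le hs.2.le]
  have hsub : IsRealSub H T₁ (fun z => f z.1 + ρ z.2) := by
    refine isRealSub_of_classical hf hρ' fun x t ht => ?_
    have h1 := (abs_le.1 (abs_sub_zero_le_of_lipschitz hL x (covDiff n f x) (f x + ρ t))).2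
    have h2 := (abs_le.1 (hCb x)).2
    have h3 : |f x + ρ t| ≤ |B| + K * (Real.exp (lam * t) - 1) := by
      refine (abs_add_le _ _).trans (add_le_add (hBf x) ?_)
      simp only [hρ]
      rw [abs_neg, abs_of_nonneg (mul_nonneg hK0 (by linarith [hexp t])),
        hclt t ht.1.le ht.2.le]
    have h4 := mul_le_mul_of_nonneg_left h3 hL0'.le
    have h5 := hexp t
    rw [hclt t ht.1.le ht.2.le] at h5
    have h6 := mul_le_mul_of_nonneg_left h5 hK0
    have h7 : 0 ≤ L * K := by positivity
    have h8 : K * (Real.exp (lam * t) * lam) =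
        L * (K * Real.exp (lam * t)) + K * Real.exp (lam * t) := by rw [hlam]; ring
    rw [h8]
    have h9 : K = C + L * |B| := hK
    linarith
  have hmono : ∀ t, Real.exp (lam * cl t) ≤ Real.exp (lam * T₁) := fun t =>
    Real.exp_le_exp.2 (mul_le_mul_of_nonneg_left (hclm t).2 (by positivity))
  have huR : ∀ z : M × ℝ, |f z.1 + ρ z.2| ≤ max R (|B| + K * Real.exp (lam * T₁)) := by
    intro z
    refine le_max_of_le_right ((abs_add_le _ _).trans (add_le_add (hBf _) ?_))
    simp only [hρ]
    rw [abs_neg, abs_of_nonneg (mul_nonneg hK0 (by linarith [hexp z.2]))]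
    exact mul_le_mul_of_nonneg_left (by linarith [hmono z.2]) hK0
  have huc : Continuous (fun z : M × ℝ => f z.1 + ρ z.2) :=
    (hf.continuous.comp continuous_fst).add (hρc.comp continuous_snd)
  have hρ0 : ρ 0 = 0 := by simp [hρ, hclt 0 le_rfl hT₁.le]
  have := real_comparison hH hL hL0 hsub hv huR (fun z => (hvR z).trans (le_max_left _ _))
    (huc.lowerSemicontinuous.lowerSemicontinuousOn _) hvl (fun x ε hε => by
      refine Eventually.frequently ?_
      have h1 : Continuous (fun t => f x + ρ t) := by fun_prop
      exact ((h1.tendsto 0).mono_left nhdsWithin_le_nhds).eventually_lt_const (by simpa using hε))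
    (fun x => by simpa [hρ0] using hfv x) x ht htT
  simp only [hρ, hclt t ht htT.le] at this
  linarith

end Barriers

end HJ

namespace HJ

/-! ### Comparison of extended-valued solutions -/

section ExtendedComparison

set_option linter.unusedSectionVars false

variable {n : ℕ} {M : Type*} [TopologicalSpace M] [ChartedSpace (EuclideanSpace ℝ (Fin n)) M]
  {T : EReal} {T₁ : ℝ} {W : ℝ → ℝ} {u v : M → ℝ → EReal}

lemma frequently_trunc_lt (hbot : ∀ z ∈ cylinder M T, u z.1 z.2 ≠ ⊥) (hT₁ : (T₁ : EReal) < T)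
    (hT₁0 : 0 < T₁) (hW : Continuous W) {x : M}
    (hlim : liminf (fun t => u x t) (𝓝[>] (0 : ℝ)) ≤ u x 0) {ε : ℝ} (hε : 0 < ε) :
    ∃ᶠ t in 𝓝[>] (0 : ℝ), trunc T₁ W u (x, t) < trunc T₁ W u (x, 0) + ε := by
  have hIoc : ∀ᶠ t in 𝓝[>] (0 : ℝ), t ∈ Icc 0 T₁ := by
    filter_upwards [Ioo_mem_nhdsGT hT₁0] with t ht using Ioo_subset_Icc_self ht
  have h0 : (0 : ℝ) ∈ Icc 0 T₁ := ⟨le_rfl, hT₁0.le⟩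
  have hc := coe_trunc (W := W) hbot hT₁ (z := (x, 0)) h0
  rcases le_or_gt ((W 0 : ℝ) : EReal) (u x 0) with h | h
  · rw [min_eq_right h] at hc
    have hc' : trunc T₁ W u (x, 0) = W 0 := by exact_mod_cast hc
    refine Eventually.frequently ?_
    have h1 : ∀ᶠ t in 𝓝[>] (0 : ℝ), W t < W 0 + ε :=
      ((hW.tendsto 0).mono_left nhdsWithin_le_nhds).eventually_lt_const (by linarith)
    filter_upwards [h1, hIoc] with t h2 h3
    rw [hc']
    exact (trunc_le hbot hT₁ (z := (x, t)) h3).trans_lt h2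
  · rw [min_eq_left h.le] at hc
    have h1 : liminf (fun t => u x t) (𝓝[>] (0 : ℝ)) < ((trunc T₁ W u (x, 0) + ε : ℝ) : EReal) := by
      refine hlim.trans_lt ?_
      rw [← hc]
      exact EReal.coe_lt_coe_iff.2 (by linarith)
    refine ((frequently_lt_of_liminf_lt (by isBoundedDefault) h1).and_eventually hIoc).mono ?_
    rintro t ⟨h2, h3⟩
    exact EReal.coe_lt_coe_iff.1 ((coe_trunc_le hbot hT₁ (z := (x, t)) h3).trans_lt h2)

variable [CompactSpace M] [T2Space M] [IsManifold (𝓡 n) ∞ M]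
  [RiemannianBundle (fun x : M => TangentSpace (𝓡 n) x)]
  [IsContMDiffRiemannianBundle (𝓡 n) ∞ (EuclideanSpace ℝ (Fin n))
    (fun x : M => TangentSpace (𝓡 n) x)] {H : (x : M) → Cotangent n x → ℝ → ℝ}

lemma IsHamiltonian.exists_pos_lipschitz (hH : IsHamiltonian H) :
    ∃ L : ℝ≥0, 0 < L ∧ ∀ x p, LipschitzWith L (H x p) := by
  obtain ⟨L, hL⟩ := hH.lipschitz
  exact ⟨L + 1, by positivity, fun x p => (hL x p).weaken (by simp)⟩

lemma exists_real_between {t : ℝ} (ht : (t : EReal) < T) : ∃ T₁ : ℝ, t < T₁ ∧ (T₁ : EReal) < T := by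
  obtain ⟨T₁, h1, h2⟩ := EReal.lt_iff_exists_real_btwn.1 ht
  exact ⟨T₁, EReal.coe_lt_coe_iff.1 h1, h2⟩

/-- Comparison of lower semicontinuous sub- and supersolutions. -/
theorem comparison (hH : IsHamiltonian H)
    (hu : IsSubsol T H u) (hul : LowerSemicontinuousOn (fun z : M × ℝ => u z.1 z.2) (cylinder M T))
    (hub : ∀ z ∈ cylinder M T, u z.1 z.2 ≠ ⊥)
    (hlim : ∀ x, liminf (fun t => u x t) (𝓝[>] (0 : ℝ)) ≤ u x 0)
    (hv : IsSupersol T H v) (hvl : LowerSemicontinuousOn (fun z : M × ℝ => v z.1 z.2) (cylinder M T))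
    (hvb : ∀ z ∈ cylinder M T, v z.1 z.2 ≠ ⊥) (huv : ∀ x, u x 0 ≤ v x 0)
    (x : M) {t : ℝ} (ht : 0 ≤ t) (htT : (t : EReal) < T) : u x t ≤ v x t := by
  obtain ⟨L, hL0, hL⟩ := hH.exists_pos_lipschitz
  obtain ⟨T₁, htT₁, hT₁⟩ := exists_real_between htT
  have hT₁0 : 0 < T₁ := ht.trans_lt htT₁
  by_contra! hlt
  -- A real level strictly between the two values lets the barrier for `u` stay above `b`, so
  -- truncation does not destroy the strict inequality to be refuted.
  obtain ⟨b, hvb', hbu⟩ := EReal.lt_iff_exists_real_btwn.1 hlt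
  obtain ⟨W, V, hW, hV, hWs, hVs, hWV, hWb⟩ := exists_time_barriers hH hL T₁ b
  obtain ⟨R, hR⟩ := exists_abs_trunc_le hul hub hT₁ hW.continuous
  obtain ⟨R', hR'⟩ := exists_abs_trunc_le hvl hvb hT₁ hV.continuous
  have h0 : (0 : ℝ) ∈ Icc 0 T₁ := ⟨le_rfl, hT₁0.le⟩
  have htI : t ∈ Icc 0 T₁ := ⟨ht, htT₁.le⟩
  have h1 := real_comparison hH hL hL0 (hu.trunc hul hub hT₁ hW hWs) (hv.trunc hvl hvb hT₁ hV hVs)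
    (fun z => (hR z).trans (le_max_left R R')) (fun z => (hR' z).trans (le_max_right R R'))
    (lsc_trunc hul hub hT₁ hW.continuous) (lsc_trunc hvl hvb hT₁ hV.continuous)
    (fun x ε hε => frequently_trunc_lt hub hT₁ hT₁0 hW.continuous (hlim x) hε)
    (fun x => by
      refine le_trunc hvb hT₁ (z := (x, 0)) h0
        ((coe_trunc_le hub hT₁ (z := (x, 0)) h0).trans (huv x)) ?_
      exact (trunc_le hub hT₁ (z := (x, 0)) h0).trans hWV.le) x ht htT₁
  have h2 : b < trunc T₁ W u (x, t) := by
    have : (b : EReal) < trunc T₁ W u (x, t) := by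
      rw [coe_trunc hub hT₁ (z := (x, t)) htI]
      exact lt_min hbu (EReal.coe_lt_coe_iff.2 (hWb t htI))
    exact_mod_cast this
  have h3 := (EReal.coe_lt_coe_iff.2 (h2.trans_le h1)).trans_le
    (coe_trunc_le hvb hT₁ (z := (x, t)) htI)
  exact lt_asymm h3 hvb'

lemma IsRealSup.congr {f g : M × ℝ → ℝ} (hf : IsRealSup H T₁ f)
    (h : ∀ z : M × ℝ, z.2 ∈ Ioo 0 T₁ → f z = g z) : IsRealSup H T₁ g := by
  intro x₀ Ω L hΩt hΩ q hq ψ hψ hmin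
  have h' : ∀ a : EuclideanSpace ℝ (Fin n) × ℝ, a.2 ∈ Ioo 0 T₁ →
      f ((extChartAt (𝓡 n) x₀).symm a.1, a.2) = g ((extChartAt (𝓡 n) x₀).symm a.1, a.2) :=
    fun a ha => h _ ha
  have h1 := hf x₀ Ω L hΩt hΩ q hq ψ hψ (by
    have h2 : ∀ᶠ a : EuclideanSpace ℝ (Fin n) × ℝ in 𝓝 q, a.2 ∈ Ioo 0 T₁ :=
      continuousAt_snd.eventually (isOpen_Ioo.mem_nhds hq.2)
    filter_upwards [hmin, h2] with a h3 h4
    simp only [h' a h4, h' q hq.2]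
    exact h3)
  simp only [h' q hq.2] at h1
  exact h1

/-- Near an interior point of the chart the relaxed limit of the chart expressions is the chart
expression of the relaxed limit, so the Euclidean stability result applies. -/
lemma IsRealSup.lowerLim {ι : Type*} {l : Filter ι} [l.NeBot] {F : ι → M × ℝ → ℝ} {R : ℝ}
    (hF : ∀ i, IsRealSup H T₁ (F i)) (hR : ∀ i z, |F i z| ≤ R)
    (hlsc : ∀ i, LowerSemicontinuousOn (F i) (univ ×ˢ Ioo 0 T₁)) :
    IsRealSup H T₁ (lowerLim l F) := by
  intro x₀ Ω L hΩt hΩ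
  have hD : IsOpen (Ω ×ˢ Ioo 0 T₁) := hΩ.isOpen.prod isOpen_Ioo
  have h1 := SupBelow.lowerLim (l := l) hΩ hD (fun q hq => hq.1) (fun i q => hR i _)
    (fun i => hF i x₀ Ω L hΩt hΩ) (fun i q hq c hc => by
      have hq' : ((extChartAt (𝓡 n) x₀).symm q.1, q.2) ∈ (univ : Set M) ×ˢ Ioo 0 T₁ :=
        ⟨mem_univ _, hq.2⟩
      have h2 := hlsc i _ hq' c hc
      rw [(isOpen_univ.prod isOpen_Ioo).nhdsWithin_eq hq'] at h2
      exact mem_nhdsWithin_of_mem_nhds ((tendsto_chart_symm x₀ (hΩt hq.1)).eventually h2))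
  have heq : ∀ q ∈ Ω ×ˢ Ioo 0 T₁, HJ.lowerLim l
      (fun i (q : EuclideanSpace ℝ (Fin n) × ℝ) => F i ((extChartAt (𝓡 n) x₀).symm q.1, q.2)) q =
      HJ.lowerLim l F ((extChartAt (𝓡 n) x₀).symm q.1, q.2) := by
    intro q hq
    rw [HJ.lowerLim, HJ.lowerLim, ← map_chart_symm_nhds x₀ (hΩt hq.1)]
    have h3 := prod_map_map_eq (f₁ := l) (f₂ := 𝓝 q) (m₁ := id)
      (m₂ := fun q : EuclideanSpace ℝ (Fin n) × ℝ => ((extChartAt (𝓡 n) x₀).symm q.1, q.2))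
    rw [map_id] at h3
    rw [h3]
    rfl
  intro q hq ψ hψ hmin
  have h2 := h1 q hq ψ hψ (by
    filter_upwards [hmin, hD.mem_nhds hq] with a h3 h4
    rw [heq _ h4, heq _ hq]
    exact h3)
  rw [heq _ hq] at h2
  exact h2

/-- A smooth function which lies below a singular datum and whose value is prescribed near a
point. -/
lemma exists_smooth_below {φ : M → EReal} (hφ : LowerSemicontinuous φ) {m a : ℝ}
    (hm : ∀ y, (m : EReal) ≤ φ y) {y₀ x : M} (ha : (a : EReal) < pointDatum y₀ (φ y₀) x) :
    ∃ f : M → ℝ, ContMDiff (𝓡 n) 𝓘(ℝ, ℝ) 1 f ∧ (∀ y, f y ≤ a) ∧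
      (∀ᶠ y in 𝓝 y₀, (f y : EReal) ≤ φ y) ∧ ∀ᶠ y in 𝓝 x, f y = a := by
  by_cases hx : x = y₀
  · subst hx
    rw [pointDatum, if_pos rfl] at ha
    refine ⟨fun _ => a, contMDiff_const, fun _ => le_rfl, ?_, by simp⟩
    filter_upwards [hφ x a ha] with y hy using hy.le
  · obtain ⟨χ, -, hχ⟩ := (SmoothBumpFunction.nhds_basis_tsupport (I := 𝓡 n) x).mem_iff.1
      (isOpen_compl_singleton.mem_nhds hx : ({y₀}ᶜ : Set M) ∈ 𝓝 x)
    have hA : 0 ≤ a - min m a := by linarith [min_le_right m a]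
    refine ⟨fun y => χ y * (a - min m a) + min m a, ?_, fun y => ?_, ?_, ?_⟩
    · have e3 : ContMDiff (𝓡 n) 𝓘(ℝ, ℝ) 1 χ := χ.contMDiff.of_le (by simp)
      exact (e3.mul contMDiff_const).add contMDiff_const
    · have := mul_le_mul_of_nonneg_right (χ.le_one (x := y)) hA
      linarith
    · have : ∀ᶠ y in 𝓝 y₀, y ∉ tsupport χ :=
        (isClosed_tsupport χ).isOpen_compl.mem_nhds fun hy => hχ hy rfl
      filter_upwards [this] with y hy
      rw [image_eq_zero_of_notMem_tsupport hy, zero_mul, zero_add]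
      exact (EReal.coe_le_coe_iff.2 (min_le_left _ _)).trans (hm y)
    · filter_upwards [χ.eventuallyEq_one] with y hy
      have hy' : χ y = 1 := hy
      rw [hy']
      ring

end ExtendedComparison

end HJ

namespace HJ

/-! ### Lower semicontinuity of fundamental solutions and their lower envelope -/

section Fundamental

set_option linter.unusedSectionVars false

variable {n : ℕ} {M : Type*} [TopologicalSpace M] [ChartedSpace (EuclideanSpace ℝ (Fin n)) M]
  [CompactSpace M] [T2Space M] [IsManifold (𝓡 n) ∞ M]
  [RiemannianBundle (fun x : M => TangentSpace (𝓡 n) x)]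
  [IsContMDiffRiemannianBundle (𝓡 n) ∞ (EuclideanSpace ℝ (Fin n))
    (fun x : M => TangentSpace (𝓡 n) x)] {H : (x : M) → Cotangent n x → ℝ → ℝ} {T : EReal}
  {h : M → ℝ → M → EReal → EReal} {φ : M → EReal}

/-- Joint lower semicontinuity of the fundamental solution along a lower semicontinuous datum. -/
lemma IsFundamentalSolution.eventually_lt (hH : IsHamiltonian H)
    (hh : IsFundamentalSolution T H h) (hφ : LowerSemicontinuous φ) (hφ' : ∀ x, φ x ≠ ⊥)
    {z₀ : M × ℝ} (hz₀ : z₀ ∈ cylinder M T) {y₀ : M} {c : ℝ}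
    (hc : (c : EReal) < h z₀.1 z₀.2 y₀ (φ y₀)) :
    ∀ᶠ p : (M × ℝ) × M in 𝓝 (z₀, y₀), p.1 ∈ cylinder M T →
      (c : EReal) < h p.1.1 p.1.2 p.2 (φ p.2) := by
  obtain ⟨L, hL0, hL⟩ := hH.exists_pos_lipschitz
  obtain ⟨T₁, htT₁, hT₁⟩ := exists_real_between hz₀.2
  have hT₁0 : 0 < T₁ := hz₀.1.trans_lt htT₁
  obtain ⟨W, V, hW, hV, hWs, hVs, hWV, hWc⟩ := exists_time_barriers hH hL T₁ c
  have h0 : (0 : ℝ) ∈ Icc 0 T₁ := ⟨le_rfl, hT₁0.le⟩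
  have hS : ∀ y, IsBJSolution T H (pointDatum y (φ y)) (fun x t => h x t y (φ y)) :=
    fun y => hh y (φ y) (hφ' y)
  -- The family whose limit is taken is truncated by the supersolution `V`, and the solution at `y₀`
  -- by the subsolution `W`; both have the same value at time `0`.
  set v : M → M × ℝ → ℝ := fun y => trunc T₁ V (fun x t => h x t y (φ y)) with hv
  have hvs : ∀ y, IsRealSup H T₁ (v y) := fun y =>
    (hS y).supersol.trunc (hS y).lsc (hS y).ne_bot hT₁ hV hVs
  have hvl : ∀ y, LowerSemicontinuousOn (v y) (univ ×ˢ Icc 0 T₁) := fun y =>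
    lsc_trunc (hS y).lsc (hS y).ne_bot hT₁ hV.continuous
  have hbar : ∀ f : M → ℝ, ContMDiff (𝓡 n) 𝓘(ℝ, ℝ) 1 f → (∀ x, f x ≤ V 0) →
      ∃ K, 0 ≤ K ∧ ∀ y, (f y : EReal) ≤ φ y → ∀ x t, 0 ≤ t → t < T₁ →
        f x - K * (Real.exp ((L + 1) * t) - 1) ≤ v y (x, t) := by
    intro f hf hfV
    obtain ⟨K, hK, hKv⟩ := hH.exists_initial_barrier hL hL0 hT₁0 hf
    refine ⟨K, hK, fun y hy => ?_⟩
    obtain ⟨R, hR⟩ := exists_abs_trunc_le (u := fun x t => h x t y (φ y)) (hS y).lsc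
      (hS y).ne_bot hT₁ hV.continuous
    refine hKv (v y) R (hvs y) hR (hvl y) fun x => ?_
    refine le_trunc (hS y).ne_bot hT₁ (z := (x, 0)) h0 ?_ (hfV x)
    simp only [(hS y).initial x, pointDatum]
    split_ifs with hxy
    · rw [hxy]; exact hy
    · exact le_top
  obtain ⟨m, hm⟩ := exists_real_le_of_isCompact isCompact_univ (hφ.lowerSemicontinuousOn univ)
    fun x _ => hφ' x
  replace hm : ∀ y, (m : EReal) ≤ φ y := fun y => hm y (mem_univ y)
  obtain ⟨BV, hBV⟩ := isCompact_Icc.exists_bound_of_continuousOn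
    (hV.continuous.continuousOn (s := Icc 0 T₁))
  obtain ⟨K₀, hK₀, hlow⟩ := hbar (fun _ => min m (V 0)) contMDiff_const fun _ => min_le_right _ _
  set B₀ := min m (V 0) - K₀ * (Real.exp ((L + 1) * T₁) - 1) with hB₀
  set R := max |B₀| BV with hR
  have hR0 : 0 ≤ R := le_max_of_le_left (abs_nonneg _)
  classical
  -- The relaxed limit at time `0` also sees negative times. The large value `R` outside `[0, T₁)`
  -- prevents them from lowering it.
  set F : M → M × ℝ → ℝ := fun y z => if z.2 ∈ Ico 0 T₁ then v y z else R with hF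
  have hFv : ∀ y (z : M × ℝ), z.2 ∈ Ico 0 T₁ → F y z = v y z := fun y z hz => if_pos hz
  have hFR : ∀ y z, |F y z| ≤ R := by
    intro y z
    by_cases hz : z.2 ∈ Ico 0 T₁
    · rw [hFv y z hz, abs_le]
      constructor
      · have h1 := hlow y ((EReal.coe_le_coe_iff.2 (min_le_left _ _)).trans (hm y)) z.1 z.2 hz.1 hz.2
        have h2 : Real.exp ((L + 1) * z.2) ≤ Real.exp ((L + 1) * T₁) :=
          Real.exp_le_exp.2 (mul_le_mul_of_nonneg_left hz.2.le (by positivity))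
        have h3 := mul_le_mul_of_nonneg_left h2 hK₀
        have h4 := neg_abs_le B₀
        have h5 := le_max_left |B₀| BV
        linarith
      · have h1 := trunc_le (W := V) (u := fun x t => h x t y (φ y)) (hS y).ne_bot hT₁
          (Ico_subset_Icc_self hz)
        have h2 := (le_abs_self _).trans (hBV z.2 (Ico_subset_Icc_self hz))
        exact h1.trans (h2.trans (le_max_right _ _))
    · simp only [hF, if_neg hz, abs_of_nonneg hR0, le_refl]
  set g := lowerLim (𝓝 y₀) F with hg
  have hgs : IsRealSup H T₁ g := by
    refine IsRealSup.lowerLim (R := R) (fun y => (hvs y).congr fun z hz => ?_) hFR fun y => ?_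
    · exact (hFv y z (Ioo_subset_Ico_self hz)).symm
    · intro z hz a ha
      rw [hFv y z (Ioo_subset_Ico_self hz.2)] at ha
      filter_upwards [(hvl y).mono (prod_mono_right Ioo_subset_Icc_self) z hz a ha,
        self_mem_nhdsWithin] with p hp hp2
      rwa [hFv y p (Ioo_subset_Ico_self hp2.2)]
  set u := trunc T₁ W (fun x t => h x t y₀ (φ y₀)) with hu
  -- Below any level under the datum of `u` at `x` there is a smooth `f` equal to that level near
  -- `x` and below `φ` near `y₀`. The initial barrier built on `f` holds for all `y` near `y₀` with
  -- one constant `K`, hence bounds the relaxed limit.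
  have hg0 : ∀ x, u (x, 0) ≤ g (x, 0) := by
    intro x
    refine le_of_forall_lt_imp_le_of_dense fun a ha => ?_
    obtain ⟨a', haa', ha'⟩ := exists_between ha
    have h1 := coe_trunc (W := W) (u := fun x t => h x t y₀ (φ y₀)) (hS y₀).ne_bot hT₁ (z := (x, 0)) h0
    have h2 : (a' : EReal) < min (pointDatum y₀ (φ y₀) x) (W 0 : EReal) := by
      rw [← (hS y₀).initial x, ← h1]
      exact EReal.coe_lt_coe_iff.2 ha'
    obtain ⟨h3, h4⟩ := lt_min_iff.1 h2
    have h4' : a' < V 0 := by rw [← hWV]; exact_mod_cast h4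
    obtain ⟨f, hf, hfa, hfφ, hfx⟩ := exists_smooth_below (n := n) hφ hm h3
    obtain ⟨K, hK, hKv⟩ := hbar f hf fun y => (hfa y).trans h4'.le
    refine le_lowerLim hFR ?_
    have e1 : ∀ᶠ z : M × ℝ in 𝓝 (x, 0), f z.1 = a' :=
      (continuous_fst.tendsto (x, (0 : ℝ))).eventually hfx
    have e2 : ∀ᶠ z : M × ℝ in 𝓝 (x, 0), a < a' - K * (Real.exp ((L + 1) * z.2) - 1) := by
      have hcont : Continuous (fun z : M × ℝ => a' - K * (Real.exp ((L + 1) * z.2) - 1)) := by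
        fun_prop
      exact (hcont.tendsto (x, 0)).eventually_const_lt (by simpa using haa')
    filter_upwards [hfφ.prod_mk (e1.and e2)] with p hp
    obtain ⟨p1, p2, p3⟩ := hp
    by_cases hz : p.2.2 ∈ Ico 0 T₁
    · rw [hFv _ _ hz]
      have := hKv p.1 p1 p.2.1 p.2.2 hz.1 hz.2
      rw [p2] at this
      exact p3.le.trans this
    · simp only [hF, if_neg hz]
      have h5 := (le_abs_self _).trans (hBV 0 h0)
      linarith [le_max_right |B₀| BV]
  obtain ⟨R', hR'⟩ := exists_abs_trunc_le (W := W) (u := fun x t => h x t y₀ (φ y₀))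
    (hS y₀).lsc (hS y₀).ne_bot hT₁ hW.continuous
  have hcomp := real_comparison hH hL hL0
    ((hS y₀).subsol.trunc (hS y₀).lsc (hS y₀).ne_bot hT₁ hW hWs) hgs
    (fun z => (hR' z).trans (le_max_left R' R))
    (fun z => (abs_lowerLim_le hFR z).trans (le_max_right R' R))
    (lsc_trunc (hS y₀).lsc (hS y₀).ne_bot hT₁ hW.continuous)
    ((lowerSemicontinuous_lowerLim hFR).lowerSemicontinuousOn _)
    (fun x ε hε => frequently_trunc_lt (hS y₀).ne_bot hT₁ hT₁0 hW.continuous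
      (by rw [(hS y₀).liminf_initial, (hS y₀).initial]) hε) hg0 z₀.1 hz₀.1 htT₁
  have hcu : c < u z₀ := by
    have : (c : EReal) < u z₀ := by
      rw [hu, coe_trunc (hS y₀).ne_bot hT₁ ⟨hz₀.1, htT₁.le⟩]
      exact lt_min hc (EReal.coe_lt_coe_iff.2 (hWc _ ⟨hz₀.1, htT₁.le⟩))
    exact_mod_cast this
  have e1 := eventually_lt_of_lt_lowerLim hFR (hcu.trans_le hcomp)
  rw [← nhds_prod_eq] at e1
  have e2 := (continuous_swap.tendsto (z₀, y₀)).eventually e1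
  have e3 : ∀ᶠ p : (M × ℝ) × M in 𝓝 (z₀, y₀), p.1.2 < T₁ :=
    (Continuous.tendsto (by fun_prop : Continuous fun p : (M × ℝ) × M => p.1.2)
      (z₀, y₀)).eventually_lt_const htT₁
  filter_upwards [e2, e3] with p h1 h2 h3
  have h4 : p.1.2 ∈ Ico 0 T₁ := ⟨h3.1, h2⟩
  have h5 : c < F p.2 p.1 := h1
  rw [hFv _ _ h4] at h5
  exact (EReal.coe_lt_coe_iff.2 h5).trans_le
    (coe_trunc_le (hS p.2).ne_bot hT₁ (Ico_subset_Icc_self h4))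

/-- Joint lower semicontinuity, restricted to the variable `y`, gives a minimum on the compact
manifold. -/
lemma IsFundamentalSolution.exists_eq_iInf [Nonempty M] (hH : IsHamiltonian H)
    (hh : IsFundamentalSolution T H h) (hφ : LowerSemicontinuous φ) (hφ' : ∀ x, φ x ≠ ⊥)
    {z : M × ℝ} (hz : z ∈ cylinder M T) :
    ∃ y, h z.1 z.2 y (φ y) = ⨅ y, h z.1 z.2 y (φ y) := by
  have hlsc : LowerSemicontinuousOn (fun y => h z.1 z.2 y (φ y)) univ := by
    intro y _ c hc
    obtain ⟨c', h1, h2⟩ := EReal.lt_iff_exists_real_btwn.1 hc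
    have h3 := hh.eventually_lt hH hφ hφ' hz h2
    have h4 : Tendsto (fun y : M => (z, y)) (𝓝 y) (𝓝 (z, y)) :=
      (Continuous.prodMk_right z).tendsto y
    refine mem_nhdsWithin_of_mem_nhds ?_
    filter_upwards [h4.eventually h3] with y' hy'
    exact h1.trans (hy' hz)
  obtain ⟨y, -, hy⟩ := hlsc.exists_isMinOn univ_nonempty isCompact_univ
  exact ⟨y, le_antisymm (le_iInf fun y' => hy (mem_univ y')) (iInf_le _ y)⟩

/-- The lower envelope of the fundamental solutions solves the Cauchy problem. -/
theorem IsFundamentalSolution.isBJSolution_iInf [Nonempty M] (hH : IsHamiltonian H)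
    (hT : 0 < T) (hh : IsFundamentalSolution T H h) (hφ : LowerSemicontinuous φ)
    (hφ' : ∀ x, φ x ≠ ⊥) : IsBJSolution T H φ (fun x t => ⨅ y, h x t y (φ y)) := by
  have hS : ∀ y, IsBJSolution T H (pointDatum y (φ y)) (fun x t => h x t y (φ y)) :=
    fun y => hh y (φ y) (hφ' y)
  have hmin : ∀ {z : M × ℝ}, z ∈ cylinder M T → ∃ y, h z.1 z.2 y (φ y) = ⨅ y, h z.1 z.2 y (φ y) :=
    fun hz => hh.exists_eq_iInf hH hφ hφ' hz
  have hlsc : LowerSemicontinuousOn (fun z : M × ℝ => ⨅ y, h z.1 z.2 y (φ y)) (cylinder M T) := by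
    intro z hz c hc
    obtain ⟨c', h1, h2⟩ := EReal.lt_iff_exists_real_btwn.1 hc
    have h3 := isCompact_univ.eventually_forall_of_forall_eventually
      (P := fun (p : M × ℝ) (y : M) => p ∈ cylinder M T → (c' : EReal) < h p.1 p.2 y (φ y))
      (x₀ := z) fun y _ => hh.eventually_lt hH hφ hφ' hz (h2.trans_le (iInf_le _ y))
    filter_upwards [mem_nhdsWithin_of_mem_nhds h3, self_mem_nhdsWithin] with p hp hpc
    exact h1.trans_le (le_iInf fun y => (hp y (mem_univ y) hpc).le)
  -- The minimising `y` at the contact point works: its fundamental solution lies above the envelope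
  -- everywhere and agrees with it there.
  have htest : ∀ (ψ : M → ℝ → ℝ) (x : M) (t : ℝ), (x, t) ∈ openCylinder M T →
      MinAt T (fun x t => ⨅ y, h x t y (φ y)) ψ x t →
      ∃ y, h x t y (φ y) = ⨅ y, h x t y (φ y) ∧ MinAt T (fun x t => h x t y (φ y)) ψ x t := by
    intro ψ x t hxt hψ
    obtain ⟨y, hy⟩ := hmin (openCylinder_subset_cylinder T hxt)
    refine ⟨y, hy, fun z hz => ?_⟩
    have h1 := hψ hz
    simp only [mem_ofPred_eq] at h1 hy ⊢
    rw [hy]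
    exact h1.trans (EReal.sub_le_sub (iInf_le _ y) le_rfl)
  have hinit : ∀ x, ⨅ y, h x 0 y (φ y) = φ x := by
    intro x
    have h1 : ∀ y, h x 0 y (φ y) = pointDatum y (φ y) x := fun y => (hS y).initial x
    simp only [h1, pointDatum]
    refine le_antisymm (iInf_le_of_le x (by simp)) (le_iInf fun y => ?_)
    split_ifs with hxy
    · rw [hxy]
    · exact le_top
  refine ⟨fun z hz => ?_, hlsc, ?_, ?_, hinit, fun x => le_antisymm ?_ ?_⟩
  · obtain ⟨y, hy⟩ := hmin hz
    rw [← hy]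
    exact (hS y).ne_bot z hz
  · intro ψ hψ x t hxt hmin r hr
    obtain ⟨y, h1, h2⟩ := htest ψ x t hxt hmin
    exact (hS y).subsol ψ hψ x t hxt h2 r (h1.trans hr)
  · intro ψ hψ x t hxt hmin r hr
    obtain ⟨y, h1, h2⟩ := htest ψ x t hxt hmin
    exact (hS y).supersol ψ hψ x t hxt h2 r (h1.trans hr)
  -- The upper bound for the liminf uses the fundamental solution based at `x` itself, which attains
  -- its datum along the vertical line; the lower bound is lower semicontinuity at time `0`.
  · have h1 := (hS x).liminf_initial x
    rw [pointDatum, if_pos rfl] at h1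
    rw [← h1]
    exact liminf_le_liminf (Eventually.of_forall fun t => iInf_le _ x)
  · refine le_of_forall_lt fun c hc => ?_
    obtain ⟨c', h1, h2⟩ := exists_between hc
    refine h1.trans_le (le_liminf_of_le (by isBoundedDefault) ?_)
    rw [← hinit x] at h2
    have h3 := hlsc (x, 0) ⟨le_rfl, by simpa using hT⟩ c' h2
    obtain ⟨T₁, hT₁0, hT₁⟩ := exists_real_between (t := 0) (by simpa using hT)
    have h4 : Tendsto (fun t : ℝ => (x, t)) (𝓝[>] 0) (𝓝[cylinder M T] (x, 0)) := by
      refine tendsto_nhdsWithin_iff.2 ⟨?_, ?_⟩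
      · exact ((Continuous.prodMk_right x).tendsto 0).mono_left nhdsWithin_le_nhds
      · filter_upwards [Ioo_mem_nhdsGT hT₁0] with t ht
        exact ⟨ht.1.le, (EReal.coe_lt_coe_iff.2 ht.2).trans hT₁⟩
    filter_upwards [h4.eventually h3] with t ht using le_of_lt ht

end Fundamental

end HJ

/-! ### The representation formula -/

theorem theorem5p2 {n : ℕ} {M : Type*} [TopologicalSpace M] [T2Space M] [CompactSpace M]
    [ConnectedSpace M] [ChartedSpace (EuclideanSpace ℝ (Fin n)) M] [IsManifold (𝓡 n) ∞ M]
    [RiemannianBundle (fun x : M => TangentSpace (𝓡 n) x)]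
    [IsContMDiffRiemannianBundle (𝓡 n) ∞ (EuclideanSpace ℝ (Fin n))
      (fun x : M => TangentSpace (𝓡 n) x)]
    (T : EReal) (hT : 0 < T)
    (H : (x : M) → HJ.Cotangent n x → ℝ → ℝ) (hH : HJ.IsHamiltonian H)
    (h : M → ℝ → M → EReal → EReal) (hh : HJ.IsFundamentalSolution T H h)
    (φ : M → EReal) (hφ : LowerSemicontinuous φ) (hφ' : ∀ x, φ x ≠ ⊥) :
    (∃ u : M → ℝ → EReal, HJ.IsBJSolution T H φ u) ∧
    ∀ u : M → ℝ → EReal, HJ.IsBJSolution T H φ u →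
      ∀ (x : M) (t : ℝ), 0 ≤ t → (t : EReal) < T →
        IsLeast (range fun y : M => h x t y (φ y)) (u x t) := by
  have hw := hh.isBJSolution_iInf hH hT hφ hφ'
  refine ⟨⟨_, hw⟩, fun u hu x t ht htT => ?_⟩
  -- The envelope is one solution with datum `φ`; comparing it with `u` in both directions gives
  -- equality, and attainment of the infimum turns it into a least element.
  have h1 : u x t ≤ ⨅ y, h x t y (φ y) :=
    HJ.comparison hH hu.subsol hu.lsc hu.ne_bot
      (fun x => by rw [hu.liminf_initial, hu.initial]) hw.supersol hw.lsc hw.ne_bot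
      (fun x => (hu.initial x).trans_le (hw.initial x).ge) x ht htT
  have h2 : ⨅ y, h x t y (φ y) ≤ u x t :=
    HJ.comparison hH hw.subsol hw.lsc hw.ne_bot
      (fun x => by rw [hw.liminf_initial, hw.initial]) hu.supersol hu.lsc hu.ne_bot
      (fun x => (hw.initial x).trans_le (hu.initial x).ge) x ht htT
  obtain ⟨y, hy⟩ := hh.exists_eq_iInf hH hφ hφ' (z := (x, t)) ⟨ht, htT⟩
  refine ⟨⟨y, hy.trans (le_antisymm h2 h1)⟩, ?_⟩
  rintro _ ⟨y', rfl⟩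
  exact h1.trans (iInf_le _ y')
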